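/- Let $U\subset\mathbb C$ be a simply connected domain, let $A_1,\dots,A_r$ be pairwise distinct analytic functions in $U$, and let $\Phi\in L^1_{loc}(U)$ be piecewise analytic with respect to them: if $M_i$ denotes the largest open subset of $U$ in which $\Phi=A_i$ almost everywhere, then $\Gamma_\Phi:=U\setminus\bigcup_{i=1}^r M_i$ has Lebesgue measure $0$ (so $\Phi=\sum_i A_i\chi_{M_i}$ a.e.). Fix $p\in U$ and put $H_i(z)=\mathrm{Re}\int_p^z A_i(w)\,dw$. A level curve of $H_i-H_j$ is a set $\{z\in U: H_i(z)-H_j(z)=c\}$ with $c\in\mathbb R$. A point $z\in\Gamma_\Phi$ is regular if $\Gamma_\Phi$ is a $C^1$ curve near $z$ (in suitable Euclidean coordinates, the graph of a $C^1$ function); the other points of $\Gamma_\Phi$ are singular. A piecewise $C^1$ curve is the image of a continuous map $\gamma$ of a compact interval that is $C^1$ with nowhere vanishing derivative on each closed interval of some finite subdivision. Let $ds$ be the length measure (one-dimensional Hausdorff measure) on $\Gamma_\Phi$. Assume that (i) $\Gamma_\Phi$ is the union of a family of piecewise $C^1$ curves that is locally finite in $U$; (ii) $\partial\Phi/\partial\bar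 z\ge 0$ in $U$ in the sense of distributions. Then there is a positive Radon measure $\mu$ on $U$ with $\partial\Phi/\partial\bar z=\mu$ in $U$ as distributions, and the following holds. (a) Every regular point $z$ of $\Gamma_\Phi$ has an open neighborhood $N\subset U$ such that for some $i\ne j$: (1) $N\setminus\Gamma_\Phi$ consists of two connected components $N_i,N_j$, and $\Phi=A_k$ a.e. in $N_k$ for $k=i,j$; (2) $N\cap\Gamma_\Phi$ is contained in a level curve of $H_i-H_j$; (3) in $N$ one has $\mu=\tfrac12|A_i-A_j|\,ds$. (b) $\mu$ is absolutely continuous with respect to the length measure on $\Gamma_\Phi$; in particular $\mu$ has no atoms, also at the singular points of $\Gamma_\Phi$. (c) The support of $\mu$ in $U$ is $\Gamma_\Phi$. Moreover, suppose that for all $i<j$ and $k<l$ with $(i,j)\neq(k,l)$ every level curve of $H_i-H_j$ meets every level curve of $H_k-H_l$ in at most finitely many points. Then $\mu$ is determined by its support: if $\Phi'$ is another function that is piecewise analytic with respect to the same $A_1,\dots,A_r$ and satisfies (i) and (ii), and if $\mu'=\partial\Phi'/\partial\bar z$ has the same support in $U$ as $\mu$, then $\mu'=\mu$. -/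

import Mathlib

open Set Filter Topology MeasureTheory Metric TopologicalSpace
open scoped Distributions

/-! ### The integrals `∫_p^z A(w) dw` and the harmonic functions `H` -/

/-- A copy of `ℂ` with the discrete topology (only used in the next theorem, as the fibre of the
covering of `U` by germs of primitives). -/
structure DiscreteComplex where
  val : ℂ

instance : TopologicalSpace DiscreteComplex := ⊥

instance : DiscreteTopology DiscreteComplex := ⟨rfl⟩

/-- On a simply connected open set every holomorphic function has a primitive. -/
theorem exists_primitive_of_isSimplyConnected {U : Set ℂ} (hU : IsOpen U)
    (hsc : IsSimplyConnected U) {f : ℂ → ℂ} (hf : DifferentiableOn ℂ f U) :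
    Complex.IsExactOn f U := by
  classical
  have hball : ∀ i : U, ∃ r > 0, ball (i : ℂ) r ⊆ U := fun i =>
    Metric.isOpen_iff.1 hU i i.2
  choose r hr hrU using hball
  have hprim : ∀ i : U, ∃ g : ℂ → ℂ, ∀ z ∈ ball (i : ℂ) (r i), HasDerivAt g (f z) z := fun i =>
    (hf.mono (hrU i)).isExactOn_ball
  choose g hg using hprim
  have hloc : ∀ i j : U, ∀ x ∈ ball (i : ℂ) (r i) ∩ ball (j : ℂ) (r j),
      ∀ y ∈ ball (i : ℂ) (r i) ∩ ball (j : ℂ) (r j), g i x - g j x = g i y - g j y := by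
    intro i j x hx y hy
    have hc : Convex ℝ (ball (i : ℂ) (r i) ∩ ball (j : ℂ) (r j)) :=
      (convex_ball _ _).inter (convex_ball _ _)
    have ho : IsOpen (ball (i : ℂ) (r i) ∩ ball (j : ℂ) (r j)) := isOpen_ball.inter isOpen_ball
    have hd : ∀ z ∈ ball (i : ℂ) (r i) ∩ ball (j : ℂ) (r j),
        HasDerivAt (fun z => g i z - g j z) 0 z := by
      intro z hz
      simpa using (hg i z hz.1).fun_sub (hg j z hz.2)
    exact ho.is_const_of_deriv_eq_zero hc.isPreconnected
      (fun z hz => (hd z hz).differentiableAt.differentiableWithinAt)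
      (fun z hz => (hd z hz).deriv) hx hy
  let Z : FiberBundleCore U U DiscreteComplex :=
    { baseSet := fun i => {x | (x : ℂ) ∈ ball (i : ℂ) (r i)}
      isOpen_baseSet := fun i => isOpen_ball.preimage continuous_subtype_val
      indexAt := fun x => x
      mem_baseSet_at := fun x => mem_ball_self (hr x)
      coordChange := fun i j x v => ⟨v.val + (g i x - g j x)⟩
      coordChange_self := by
        intro i x _ v
        simp
      continuousOn_coordChange := by
        intro i j
        rintro ⟨x, v⟩ ⟨hx, -⟩
        refine ContinuousWithinAt.congr_of_eventuallyEq
          (continuousWithinAt_const (b := (⟨v.val + (g i x - g j x)⟩ : DiscreteComplex))) ?_ rfl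
        have h1 : ∀ᶠ p : U × DiscreteComplex in 𝓝 (x, v), p.2 = v :=
          ((isOpen_discrete ({v} : Set DiscreteComplex)).preimage continuous_snd).mem_nhds rfl
        filter_upwards [self_mem_nhdsWithin, mem_nhdsWithin_of_mem_nhds h1] with p hp hv
        rw [hv, hloc i j p.1 hp.1 x hx]
      coordChange_comp := by
        intro i j k x _ v
        change (⟨v.val + (g i x - g j x) + (g j x - g k x)⟩ : DiscreteComplex)
          = ⟨v.val + (g i x - g k x)⟩
        congr 1
        ring }
  have hcov : IsCoveringMap (Bundle.TotalSpace.proj : Z.TotalSpace → U) :=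
    FiberBundle.isCoveringMap (F := DiscreteComplex) (E := Z.Fiber)
  have := hsc.simplyConnectedSpace
  have := hU.locallyPathConnectedSpace
  obtain ⟨x₀, hx₀⟩ := hsc.nonempty
  obtain ⟨s, ⟨-, hs⟩, -⟩ := hcov.existsUnique_continuousMap_lifts (ContinuousMap.id U) ⟨x₀, hx₀⟩
    (⟨⟨x₀, hx₀⟩, (⟨0⟩ : DiscreteComplex)⟩ : Z.TotalSpace) rfl
  have hs1 : ∀ x : U, (s x).1 = x := fun x => congrFun hs x
  let w : U → ℂ := fun x => DiscreteComplex.val (s x).2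
  refine ⟨fun z => if hz : z ∈ U then w ⟨z, hz⟩ + g ⟨z, hz⟩ z else 0, fun z hz => ?_⟩
  set i : U := ⟨z, hz⟩ with hi
  have hsrc : s i ∈ (Z.localTriv i).source := by
    rw [FiberBundleCore.mem_localTriv_source]
    change ((s i).1 : ℂ) ∈ ball (i : ℂ) (r i)
    rw [hs1]; exact mem_ball_self (hr i)
  have hct : ContinuousAt (fun x : U => ((Z.localTriv i) (s x)).2) i :=
    continuous_snd.continuousAt.comp
      (((Z.localTriv i).continuousAt hsrc).comp s.continuous.continuousAt)
  have hev : ∀ᶠ x : U in 𝓝 i, ((Z.localTriv i) (s x)).2 = ((Z.localTriv i) (s i)).2 :=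
    hct.eventually (show ∀ᶠ v in 𝓝 ((Z.localTriv i) (s i)).2, v = ((Z.localTriv i) (s i)).2 by
      rw [nhds_discrete]; exact rfl)
  have hval : ∀ x : U, (((Z.localTriv i) (s x)).2 : DiscreteComplex)
      = ⟨w x + (g x x - g i x)⟩ := by
    intro x
    have : (((Z.localTriv i) (s x)).2 : DiscreteComplex)
      = ⟨w x + (g (s x).1 (s x).1 - g i (s x).1)⟩ := rfl
    rw [this, hs1]
  have hev2 : ∀ᶠ x : U in 𝓝 i, w x + g x x = w i + g i i - g i i + g i x := by
    filter_upwards [hev] with x hx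
    rw [hval, hval] at hx
    have hx' : (w x + (g x x - g i x) : ℂ) = w i + (g i i - g i i) := congrArg DiscreteComplex.val hx
    linear_combination hx'
  rw [hi, nhds_subtype_eq_comap, eventually_comap] at hev2
  refine HasDerivAt.congr_of_eventuallyEq ((hg i z (mem_ball_self (hr i))).const_add
    (w i + g i i - g i i)) ?_
  filter_upwards [hev2, hU.mem_nhds hz] with y hy hyU
  simp only [hyU, dif_pos]
  exact hy ⟨y, hyU⟩ rfl

open Classical in
/-- `integralFrom U f p z` is `∫_p^z f(w) dw`, i.e. the primitive of `f` in `U` that vanishes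
at `p`, evaluated at `z` (and `0` if `f` has no primitive in `U`; by the next theorem this does not
happen when `U` is simply connected and `f` is holomorphic in `U`). -/
noncomputable def integralFrom (U : Set ℂ) (f : ℂ → ℂ) (p : ℂ) : ℂ → ℂ :=
  if h : ∃ F : ℂ → ℂ, F p = 0 ∧ ∀ z ∈ U, HasDerivAt F (f z) z then h.choose else 0

theorem integralFrom_spec {U : Set ℂ} (hU : IsOpen U) (hsc : IsSimplyConnected U) {f : ℂ → ℂ}
    (hf : DifferentiableOn ℂ f U) (p : ℂ) :
    integralFrom U f p p = 0 ∧ ∀ z ∈ U, HasDerivAt (integralFrom U f p) (f z) z := by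
  have h : ∃ F : ℂ → ℂ, F p = 0 ∧ ∀ z ∈ U, HasDerivAt F (f z) z :=
    (exists_primitive_of_isSimplyConnected hU hsc hf).with_val_at p 0
  unfold integralFrom
  rw [dif_pos h]
  exact h.choose_spec

/-- The harmonic function `H(z) = Re ∫_p^z f(w) dw` in `U`. -/
noncomputable def harmonicPotential (U : Set ℂ) (f : ℂ → ℂ) (p z : ℂ) : ℝ :=
  (integralFrom U f p z).re

/-- The level curve `{z ∈ U | h(z) = c}`. -/
def levelCurve (U : Set ℂ) (h : ℂ → ℝ) (c : ℝ) : Set ℂ := {z ∈ U | h z = c}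

/-! ### Piecewise analytic functions -/

/-- The complement in `U` of the support of the distribution `Φ - f`: the largest open subset
of `U` on which `Φ = f` almost everywhere. -/
def piece (U : Set ℂ) (Φ f : ℂ → ℂ) : Set ℂ :=
  {z ∈ U | ∃ V ∈ 𝓝 z, Φ =ᵐ[volume.restrict V] f}

/-- `Γ_Φ = U ∖ ⋃ i, M_i`, where `M_i = U ∖ supp (Φ - A_i)`. -/
def interface (U : Set ℂ) {r : ℕ} (A : Fin r → ℂ → ℂ) (Φ : ℂ → ℂ) : Set ℂ :=
  U \ ⋃ i, piece U Φ (A i)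

/-- `Φ` is a piecewise analytic function in `U` with the canonical decomposition
`Φ = ∑ i, A_i χ_{M_i}`, `M_i = U ∖ supp (Φ - A_i)`. -/
structure IsPiecewiseAnalytic (U : Set ℂ) {r : ℕ} (A : Fin r → ℂ → ℂ) (Φ : ℂ → ℂ) : Prop where
  locallyIntegrableOn : LocallyIntegrableOn Φ U
  differentiableOn : ∀ i, DifferentiableOn ℂ (A i) U
  distinct : ∀ i j, i ≠ j → ¬ EqOn (A i) (A j) U
  volume_interface : volume (interface U A Φ) = 0

/-! ### The derivative with respect to `z̄` in the sense of distributions -/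

/-- `∂ψ/∂z̄ = (∂ψ/∂x + i ∂ψ/∂y) / 2`. -/
noncomputable def dbar (ψ : ℂ → ℝ) (z : ℂ) : ℂ :=
  ((fderiv ℝ ψ z 1 : ℝ) + Complex.I * (fderiv ℝ ψ z Complex.I : ℝ)) / 2

/-- The value `⟨∂Φ/∂z̄, ψ⟩ = -∫ Φ ∂ψ/∂z̄` of the distribution `∂Φ/∂z̄` at a test function. -/
noncomputable def dbarPairing (Φ : ℂ → ℂ) (ψ : ℂ → ℝ) : ℂ :=
  -∫ z, Φ z * dbar ψ z

/-- `∂Φ/∂z̄ ≥ 0` in `U` in the sense of distributions: the pairing with every nonnegative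
test function is a nonnegative real number. -/
def DbarNonneg (U : Opens ℂ) (Φ : ℂ → ℂ) : Prop :=
  ∀ ψ : 𝓓(U, ℝ), (∀ z, 0 ≤ ψ z) → (dbarPairing Φ ψ).im = 0 ∧ 0 ≤ (dbarPairing Φ ψ).re

/-- `μ` is a positive Radon measure on `U` (regarded as a measure on `ℂ` that vanishes outside
`U`), and `∂Φ/∂z̄ = μ` as distributions in `U`. -/
def DbarEqMeasure (U : Opens ℂ) (Φ : ℂ → ℂ) (μ : Measure ℂ) : Prop :=
  μ (U : Set ℂ)ᶜ = 0 ∧ (∀ K : Set ℂ, IsCompact K → K ⊆ U → μ K < ⊤) ∧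
    ∀ ψ : 𝓓(U, ℝ), dbarPairing Φ ψ = ((∫ z, ψ z ∂μ : ℝ) : ℂ)

/-! ### Curves -/

/-- `C` is (the trace of) a piecewise `C¹` curve: the image of a continuous `γ : [t₀, tₙ] → ℂ`
that is `C¹` with nowhere vanishing derivative on each of the intervals `[tₖ, tₖ₊₁]`. -/
def IsPiecewiseC1Curve (C : Set ℂ) : Prop :=
  ∃ (n : ℕ) (t : ℕ → ℝ) (γ : ℝ → ℂ), 0 < n ∧ StrictMono t ∧
    ContinuousOn γ (Icc (t 0) (t n)) ∧
    (∀ k < n, ContDiffOn ℝ 1 γ (Icc (t k) (t (k + 1))) ∧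
      ∀ s ∈ Icc (t k) (t (k + 1)), derivWithin γ (Icc (t k) (t (k + 1))) s ≠ 0) ∧
    C = γ '' Icc (t 0) (t n)

/-- `Γ` is the union of a family of piecewise `C¹` curves that is locally finite in `U`. -/
def IsLocallyFiniteUnionOfCurves (U Γ : Set ℂ) : Prop :=
  ∃ S : Set (Set ℂ), (∀ C ∈ S, IsPiecewiseC1Curve C) ∧
    (∀ z ∈ U, ∃ V ∈ 𝓝 z, {C ∈ S | (C ∩ V).Nonempty}.Finite) ∧ Γ = ⋃₀ S

/-- `z` is a regular point of `Γ` (the normal to `Γ` is defined at `z`): near `z` the set `Γ` is a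
`C¹` curve, that is, the graph of a `C¹` function in suitable Euclidean coordinates centred at `z`.
In particular `z ∈ Γ`. -/
def IsRegularPoint (Γ : Set ℂ) (z : ℂ) : Prop :=
  ∃ (e : ℂ) (δ : ℝ) (g : ℝ → ℝ), ‖e‖ = 1 ∧ 0 < δ ∧ ContDiff ℝ 1 g ∧ g 0 = 0 ∧
    ∀ s t : ℝ, |s| < δ → |t| < δ → (z + e * (s + t * Complex.I) ∈ Γ ↔ t = g s)

/-! Existence of `μ`: a nonnegative functional on test functions extends to a positive functional on
`C_c(U)`, which is integration against a measure (`exists_dbarEqMeasure`).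

Local description: near a regular point, Γ is an arc γ with `Φ = A` on one side and `Φ = B` on the
other. For holomorphic `A` one has `∂(Aψ)/∂z̄ = A ∂ψ/∂z̄`, so Green's formula on both sides gives
`⟨∂Φ/∂z̄, ψ⟩ = ∫ (i/2)(A - B)(γ) γ' ψ(γ) ds` (`dbarPairing_eq_integral_graph`). The left side is `∫
ψ dμ`, so the density `(i/2)(A - B)γ'` is real and nonnegative. Reality says `Re((A - B)γ') = 0`, so
the difference of the potentials is constant along γ. Nonnegativity says that the density is its own
modulus `|A - B||γ'|/2`, and `|γ'| ds` is length.

Absolute continuity: inside a piece there is no jump, so `μ` vanishes off Γ. Since Γ is a null set,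
Φ is locally bounded. A bump of width ρ has gradient of order `1/ρ` on an area of order `ρ²`, hence
`μ(B(z,ρ)) ≤ Cρ` at all points, regular or not (`exists_measure_closedBall_le`), and comparison with
the gauge of Hausdorff measure finishes.

Support: if `μ` vanished near a regular point, then `A = B` on an arc and hence in `U`, against
distinctness. It remains to see that regular points are dense in Γ (`exists_isRegularPoint_mem`).
Locally Γ is covered by finitely many closed graph arcs, so a relatively open part of Γ lies on one
of them. The two sides of this arc belong to different pieces, so a whole subarc belongs to Γ, and
at some point of it the remaining arcs add nothing new.

Uniqueness: equal supports give equal interfaces. At a regular point the arc lies on level curves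
for Φ and for Φ', so finiteness forces the same pair of functions, and the sign of the density
forces the same order. Thus `Φ - Φ' = 0` near every regular point. But `Φ - Φ'` is piecewise
analytic for the functions `A i - A k`, with interface inside Γ. The density statement, valid for
any interface contained in Γ, shows that this interface is empty. So `Φ - Φ'` is one analytic
function on `U`, which vanishes near a regular point if Γ is nonempty. -/

/-! ### Charts adapted to graphs -/

/-- The homeomorphism `(s, τ) ↦ z + e (s + i (g s + τ))`, which straightens the graph of `g` in the
Euclidean coordinates with origin `z` and axis direction `e`. -/
noncomputable def graphChart (z : ℂ) {e : ℂ} (he : ‖e‖ = 1) {g : ℝ → ℝ} (hg : Continuous g) :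
    ℝ × ℝ ≃ₜ ℂ where
  toFun p := z + e * (p.1 + (g p.1 + p.2 : ℝ) * Complex.I)
  invFun w := ((e⁻¹ * (w - z)).re, (e⁻¹ * (w - z)).im - g (e⁻¹ * (w - z)).re)
  left_inv p := by
    have h0 : e ≠ 0 := norm_ne_zero_iff.1 (by simp [he])
    simp [h0]
  right_inv w := by
    have h0 : e ≠ 0 := norm_ne_zero_iff.1 (by simp [he])
    simp only [add_sub_cancel, Complex.re_add_im]
    field_simp
    ring
  continuous_toFun := by fun_prop
  continuous_invFun := by fun_prop

/-- The parametrization `s ↦ z + e (s + i g(s))` of a graph. -/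
noncomputable def graphCurve (z e : ℂ) (g : ℝ → ℝ) (s : ℝ) : ℂ := z + e * (s + g s * Complex.I)

section Chart

variable {z e : ℂ} {he : ‖e‖ = 1} {g : ℝ → ℝ} {hg : Continuous g}

theorem graphChart_apply (p : ℝ × ℝ) :
    graphChart z he hg p = z + e * (p.1 + (g p.1 + p.2 : ℝ) * Complex.I) := rfl

theorem graphChart_zero (s : ℝ) : graphChart z he hg (s, 0) = graphCurve z e g s := by
  simp [graphChart_apply, graphCurve]

/-- The chart is a shear in the second variable followed by a rotation and a translation, all of
which preserve area. Continuity of `g` is enough, and no Jacobian enters Green's formula. -/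
theorem measurePreserving_graphChart : MeasurePreserving (graphChart z he hg) := by
  have h1 : MeasurePreserving (fun p : ℝ × ℝ => (p.1, g p.1 + p.2)) :=
    (MeasurePreserving.id volume).skew_product (g := fun s τ => g s + τ) (by fun_prop)
      (ae_of_all _ fun s => (measurePreserving_add_left volume (g s)).map_eq)
  have h2 := Complex.volume_preserving_equiv_real_prod.symm
  have h3 : MeasurePreserving (rotation ⟨e, by simpa [Submonoid.unitSphere] using he⟩) :=
    LinearIsometryEquiv.measurePreserving _
  have h4 : MeasurePreserving (fun w : ℂ => z + w) := measurePreserving_add_left volume z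
  have := h4.comp (h3.comp (h2.comp h1))
  convert this using 1
  ext1 p
  simp only [graphChart_apply, Function.comp_apply, Complex.measurableEquivRealProd_symm_apply,
    Complex.mk_eq_add_mul_I]
  rfl

theorem measurableEmbedding_graphChart : MeasurableEmbedding (graphChart z he hg) :=
  (graphChart z he hg).measurableEmbedding

end Chart

/-- The open square `(-η, η)²`. -/
def openSquare (η : ℝ) : Set (ℝ × ℝ) := Ioo (-η) η ×ˢ Ioo (-η) η

theorem isOpen_openSquare (η : ℝ) : IsOpen (openSquare η) := isOpen_Ioo.prod isOpen_Ioo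

theorem exists_openSquare_subset {S : Set (ℝ × ℝ)} (hS : S ∈ 𝓝 (0 : ℝ × ℝ)) :
    ∃ η > 0, openSquare η ⊆ S := by
  obtain ⟨η, hη, h⟩ := Metric.mem_nhds_iff.1 hS
  refine ⟨η, hη, fun p hp => h ?_⟩
  simpa [Prod.norm_def, abs_lt, openSquare] using hp

/-- The upper half of the open square. -/
def upperSquare (η : ℝ) : Set (ℝ × ℝ) := Ioo (-η) η ×ˢ Ioo 0 η

/-- The lower half of the open square. -/
def lowerSquare (η : ℝ) : Set (ℝ × ℝ) := Ioo (-η) η ×ˢ Ioo (-η) 0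

theorem isOpen_upperSquare (η : ℝ) : IsOpen (upperSquare η) := isOpen_Ioo.prod isOpen_Ioo

theorem isOpen_lowerSquare (η : ℝ) : IsOpen (lowerSquare η) := isOpen_Ioo.prod isOpen_Ioo

theorem isConnected_upperSquare {η : ℝ} (hη : 0 < η) : IsConnected (upperSquare η) :=
  (isConnected_Ioo (by linarith)).prod (isConnected_Ioo hη)

theorem isConnected_lowerSquare {η : ℝ} (hη : 0 < η) : IsConnected (lowerSquare η) :=
  (isConnected_Ioo (by linarith)).prod (isConnected_Ioo (by linarith))

theorem upperSquare_subset {η : ℝ} : upperSquare η ⊆ openSquare η := by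
  rintro p ⟨h1, h2, h3⟩
  exact ⟨h1, by linarith [h1.1, h1.2], h3⟩

theorem lowerSquare_subset {η : ℝ} : lowerSquare η ⊆ openSquare η := by
  rintro p ⟨h1, h2, h3⟩
  exact ⟨h1, h2, by linarith [h1.1, h1.2]⟩

theorem graphCurve_injective {z e : ℂ} (he : ‖e‖ = 1) {g : ℝ → ℝ} (hg : Continuous g) :
    Function.Injective (graphCurve z e g) := by
  intro s t h
  rw [← graphChart_zero (he := he) (hg := hg), ← graphChart_zero (he := he) (hg := hg)] at h
  simpa using (graphChart z he hg).injective h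

theorem continuous_graphCurve {z e : ℂ} {g : ℝ → ℝ} (hg : Continuous g) :
    Continuous (graphCurve z e g) := by
  unfold graphCurve; fun_prop

theorem isClosedEmbedding_graphCurve {z e : ℂ} (he : ‖e‖ = 1) {g : ℝ → ℝ} (hg : Continuous g) :
    IsClosedEmbedding (graphCurve z e g) := by
  have : graphCurve z e g = graphChart z he hg ∘ fun s : ℝ => (s, (0 : ℝ)) := by
    ext1 s; simp [graphChart_zero]
  rw [this]
  refine (graphChart z he hg).isClosedEmbedding.comp ⟨isEmbedding_prodMkLeft 0, ?_⟩
  have : range (fun s : ℝ => (s, (0 : ℝ))) = univ ×ˢ {0} := by ext ⟨a, b⟩; simp [eq_comm]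
  rw [this]
  exact isClosed_univ.prod isClosed_singleton

theorem hasStrictDerivAt_graphCurve {z e : ℂ} {g : ℝ → ℝ} (hg : ContDiff ℝ 1 g) (s : ℝ) :
    HasStrictDerivAt (graphCurve z e g) (e * (1 + (deriv g s : ℝ) * Complex.I)) s := by
  have h1 : HasStrictDerivAt (fun s : ℝ => (s : ℂ)) 1 s :=
    Complex.ofRealCLM.hasStrictDerivAt
  have h2 : HasStrictDerivAt (fun s : ℝ => (g s : ℂ)) ((deriv g s : ℝ) : ℂ) s := by
    have := (hg.contDiffAt (x := s)).hasStrictDerivAt one_ne_zero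
    exact Complex.ofRealCLM.hasStrictFDerivAt.comp_hasStrictDerivAt s this
  exact ((h1.add (h2.mul_const Complex.I)).const_mul e).const_add z

/-! ### Length of graphs -/

/-- If each point has a neighborhood in which `ν ≤ c λ`, then `ν ≤ c λ`. -/
theorem measure_le_smul_of_locally {X : Type*} [TopologicalSpace X] [SecondCountableTopology X]
    [MeasurableSpace X] [BorelSpace X] {ν lam : Measure X} {c : ENNReal}
    (h : ∀ x, ∃ W : Set X, IsOpen W ∧ x ∈ W ∧ ∀ S ⊆ W, MeasurableSet S → ν S ≤ c * lam S) :
    ν ≤ c • lam := by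
  choose W hWo hxW hW using h
  obtain ⟨T, hT, hcov⟩ := TopologicalSpace.countable_cover_nhds
    fun x => (hWo x).mem_nhds (hxW x)
  rcases isEmpty_or_nonempty X with hX | ⟨⟨x0⟩⟩
  · rw [Measure.eq_zero_of_isEmpty ν]; exact Measure.zero_le _
  have hTne : T.Nonempty := by
    obtain ⟨i, hi, -⟩ := mem_iUnion₂.1 (hcov ▸ mem_univ x0 : x0 ∈ ⋃ x ∈ T, W x)
    exact ⟨i, hi⟩
  obtain ⟨f, rfl⟩ := hT.exists_eq_range hTne
  have hD : ∀ n, MeasurableSet (disjointed (fun n => W (f n)) n) :=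
    MeasurableSet.disjointed fun n => (hWo _).measurableSet
  have hU : ⋃ n, disjointed (fun n => W (f n)) n = univ := by
    rw [iUnion_disjointed]; simpa using hcov
  refine Measure.le_iff.2 fun S hS => ?_
  have key : ∀ κ : Measure X, κ S = ∑' n, κ (S ∩ disjointed (fun n => W (f n)) n) := by
    intro κ
    rw [← measure_iUnion (fun i j hij => ((disjoint_disjointed _ hij).mono
      inter_subset_right inter_subset_right)) fun n => hS.inter (hD n), ← inter_iUnion, hU,
      inter_univ]
  rw [Measure.smul_apply, smul_eq_mul, key ν, key lam, ← ENNReal.tsum_mul_left]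
  exact ENNReal.tsum_le_tsum fun n => hW (f n) _
    (inter_subset_right.trans (disjointed_subset _ _)) (hS.inter (hD n))

/-- The local comparison globalizes for each fixed `c > 1`; then `c` tends to 1. -/
theorem measure_le_of_locally_le {X : Type*} [TopologicalSpace X] [SecondCountableTopology X]
    [MeasurableSpace X] [BorelSpace X] {ν lam : Measure X}
    (h : ∀ c : NNReal, 1 < c → ∀ x, ∃ W : Set X, IsOpen W ∧ x ∈ W ∧
      ∀ S ⊆ W, MeasurableSet S → ν S ≤ c * lam S) : ν ≤ lam := by
  refine Measure.le_iff.2 fun S _ => ?_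
  have h1 : ∀ c : NNReal, 1 < c → ν S ≤ c * lam S := fun c hc => by
    simpa using measure_le_smul_of_locally (h c hc) S
  have h2 : Tendsto (fun c : NNReal => (c : ENNReal) * lam S) (𝓝[>] 1)
      (𝓝 (((1 : NNReal) : ENNReal) * lam S)) := by
    refine ENNReal.Tendsto.mul_const ?_ (Or.inl (by simp))
    exact (ENNReal.tendsto_coe.2 tendsto_id).mono_left nhdsWithin_le_nhds
  rw [ENNReal.coe_one, one_mul] at h2
  exact ge_of_tendsto h2 (by filter_upwards [self_mem_nhdsWithin] with c hc using h1 c hc)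

/-- Strict differentiability makes `γ` bi-Lipschitz near `s₀` with constants `‖γ' s₀‖ ± ε`. Hence
the length of the image and the integral of the speed lie between the same two multiples of Lebesgue
measure. -/
theorem exists_length_comparison {γ γ' : ℝ → ℂ} (hγ : IsClosedEmbedding γ)
    (hd : ∀ s, HasStrictDerivAt γ (γ' s) s) (hc : Continuous γ') (s₀ : ℝ) {ε : ℝ} (hε : 0 < ε)
    (hεv : ε < ‖γ' s₀‖) :
    ∃ W : Set ℝ, IsOpen W ∧ s₀ ∈ W ∧ ∀ S ⊆ W, MeasurableSet S →
      (μH[1] (γ '' S) ≤ ENNReal.ofReal (‖γ' s₀‖ + ε) * volume S ∧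
      ENNReal.ofReal (‖γ' s₀‖ - ε) * volume S ≤ μH[1] (γ '' S)) ∧
      (∫⁻ s in S, ‖γ' s‖ₑ) ≤ ENNReal.ofReal (‖γ' s₀‖ + ε) * volume S ∧
      ENNReal.ofReal (‖γ' s₀‖ - ε) * volume S ≤ ∫⁻ s in S, ‖γ' s‖ₑ := by
  set v := ‖γ' s₀‖
  have h1 : ∀ᶠ q : ℝ × ℝ in 𝓝 (s₀, s₀),
      ‖γ q.1 - γ q.2 - (q.1 - q.2) • γ' s₀‖ ≤ ε * ‖q.1 - q.2‖ := by
    have := (hd s₀).isLittleO.bound hε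
    simpa using this
  rw [nhds_prod_eq] at h1
  obtain ⟨t, ht, htW⟩ := eventually_prod_self_iff'.1 h1
  have h2 : ∀ᶠ s in 𝓝 s₀, ‖γ' s‖ ∈ Ioo (v - ε) (v + ε) :=
    hc.norm.continuousAt.eventually (Ioo_mem_nhds (by linarith) (by linarith))
  have h3 := h2.and ht
  obtain ⟨W, hW, hWo, hsW⟩ := _root_.eventually_nhds_iff.1 h3
  refine ⟨W, hWo, hsW, fun S hS hSm => ?_⟩
  have hest : ∀ s ∈ S, ∀ u ∈ S, ‖γ s - γ u - (s - u) • γ' s₀‖ ≤ ε * ‖s - u‖ :=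
    fun s hs u hu => htW s (hW s (hS hs)).2 u (hW u (hS hu)).2
  have hup : ∀ s ∈ S, ∀ u ∈ S, ‖γ s - γ u‖ ≤ (v + ε) * ‖s - u‖ := by
    intro s hs u hu
    have := hest s hs u hu
    have h5 := norm_le_norm_add_norm_sub' (γ s - γ u) ((s - u) • γ' s₀)
    rw [norm_smul] at h5
    nlinarith
  have hlo : ∀ s ∈ S, ∀ u ∈ S, (v - ε) * ‖s - u‖ ≤ ‖γ s - γ u‖ := by
    intro s hs u hu
    have := hest s hs u hu
    have h5 := norm_sub_norm_le ((s - u) • γ' s₀) (γ s - γ u)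
    rw [norm_smul] at h5
    rw [norm_sub_rev] at this
    nlinarith
  have hv : 0 < v - ε := by linarith
  refine ⟨⟨?_, ?_⟩, ?_, ?_⟩
  · have hL : LipschitzOnWith (v + ε).toNNReal γ S := by
      refine LipschitzOnWith.of_dist_le_mul fun s hs u hu => ?_
      rw [Real.coe_toNNReal _ (by linarith), dist_eq_norm, dist_eq_norm]
      exact hup s hs u hu
    have := hL.hausdorffMeasure_image_le (d := 1) zero_le_one
    rw [hausdorffMeasure_real] at this
    simpa [ENNReal.ofReal] using this
  · have hinj := hγ.injective
    have hL : LipschitzOnWith (v - ε)⁻¹.toNNReal (Function.invFun γ) (γ '' S) := by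
      refine LipschitzOnWith.of_dist_le_mul ?_
      rintro _ ⟨s, hs, rfl⟩ _ ⟨u, hu, rfl⟩
      rw [Real.coe_toNNReal _ (by positivity), dist_eq_norm, dist_eq_norm,
        Function.leftInverse_invFun hinj, Function.leftInverse_invFun hinj, inv_mul_eq_div,
        le_div_iff₀ hv, mul_comm]
      exact hlo s hs u hu
    have := hL.hausdorffMeasure_image_le (d := 1) zero_le_one
    rw [hausdorffMeasure_real, image_image] at this
    simp only [Function.leftInverse_invFun hinj _, image_id', ENNReal.rpow_one] at this
    calc ENNReal.ofReal (v - ε) * volume S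
        ≤ ENNReal.ofReal (v - ε) * (ENNReal.ofReal (v - ε)⁻¹ * μH[1] (γ '' S)) := by
          gcongr; exact this
      _ = μH[1] (γ '' S) := by
          rw [← mul_assoc, ← ENNReal.ofReal_mul hv.le, mul_inv_cancel₀ hv.ne', ENNReal.ofReal_one,
            one_mul]
  · rw [← setLIntegral_const]
    refine setLIntegral_mono' hSm fun s hs => ?_
    rw [← ofReal_norm]
    exact ENNReal.ofReal_le_ofReal (hW s (hS hs)).1.2.le
  · rw [← setLIntegral_const]
    refine setLIntegral_mono' hSm fun s hs => ?_
    rw [← ofReal_norm]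
    exact ENNReal.ofReal_le_ofReal (hW s (hS hs)).1.1.le

/-- The length of a `C¹` embedded curve is the integral of its speed. -/
theorem hausdorffMeasure_image_eq_lintegral {γ γ' : ℝ → ℂ} (hγ : IsClosedEmbedding γ)
    (hd : ∀ s, HasStrictDerivAt γ (γ' s) s) (hc : Continuous γ') (h0 : ∀ s, γ' s ≠ 0)
    {S : Set ℝ} (hS : MeasurableSet S) : μH[1] (γ '' S) = ∫⁻ s in S, ‖γ' s‖ₑ := by
  set ν : Measure ℝ := Measure.comap γ μH[1]
  set lam : Measure ℝ := volume.withDensity fun s => ‖γ' s‖ₑ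
  have hν : ∀ S, ν S = μH[1] (γ '' S) := hγ.measurableEmbedding.comap_apply _
  have hlam : ∀ S, MeasurableSet S → lam S = ∫⁻ s in S, ‖γ' s‖ₑ :=
    fun S hS => withDensity_apply _ hS
  -- The ratio of the two Lipschitz bounds should be `c`: solving `v + ε = c (v - ε)` gives `ε = v
  -- (c - 1) / (c + 1)`.
  have hε : ∀ c : NNReal, 1 < c → ∀ s, ∃ ε > 0, ε < ‖γ' s‖ ∧
      ENNReal.ofReal (‖γ' s‖ + ε) = c * ENNReal.ofReal (‖γ' s‖ - ε) := by
    intro c hc s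
    have hv : 0 < ‖γ' s‖ := norm_pos_iff.2 (h0 s)
    have hc' : (1 : ℝ) < c := by exact_mod_cast hc
    have hc1 : (0 : ℝ) < c + 1 := by linarith
    have h2 : ‖γ' s‖ - ‖γ' s‖ * (c - 1) / (c + 1) = ‖γ' s‖ * 2 / (c + 1) := by
      field_simp; ring
    refine ⟨‖γ' s‖ * (c - 1) / (c + 1), ?_, ?_, ?_⟩
    · exact div_pos (mul_pos hv (by linarith)) hc1
    · have : 0 < ‖γ' s‖ * 2 / (c + 1) := by positivity
      linarith
    · rw [← ENNReal.ofReal_coe_nnreal, ← ENNReal.ofReal_mul (NNReal.coe_nonneg c)]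
      congr 1
      rw [h2]
      field_simp
      ring
  have h1 : ν ≤ lam := by
    refine measure_le_of_locally_le fun c hc1 s => ?_
    obtain ⟨ε, hε0, hεv, hεc⟩ := hε c hc1 s
    obtain ⟨W, hW, hsW, h⟩ := exists_length_comparison hγ hd hc s hε0 hεv
    refine ⟨W, hW, hsW, fun S hS hSm => ?_⟩
    obtain ⟨⟨ha, hb⟩, h3, h4⟩ := h S hS hSm
    rw [hν, hlam S hSm]
    refine ha.trans ?_
    rw [hεc, mul_assoc]
    gcongr
  have h2 : lam ≤ ν := by
    refine measure_le_of_locally_le fun c hc1 s => ?_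
    obtain ⟨ε, hε0, hεv, hεc⟩ := hε c hc1 s
    obtain ⟨W, hW, hsW, h⟩ := exists_length_comparison hγ hd hc s hε0 hεv
    refine ⟨W, hW, hsW, fun S hS hSm => ?_⟩
    obtain ⟨⟨ha, hb⟩, h3, h4⟩ := h S hS hSm
    rw [hν, hlam S hSm]
    refine h3.trans ?_
    rw [hεc, mul_assoc]
    gcongr
  rw [← hν, ← hlam S hS, le_antisymm h1 h2]

/-! ### Green's formula on both sides of a graph -/

/-- Nothing is known about `A` outside `N`, but off the support of `ψ` the product is locally zero.
-/
theorem contDiff_mul_of_tsupport_subset {A : ℂ → ℂ} {ψ : ℂ → ℝ} {N : Set ℂ} (hN : IsOpen N)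
    (hA : DifferentiableOn ℂ A N) (hψ : ContDiff ℝ 1 ψ) (hψN : tsupport ψ ⊆ N) :
    ContDiff ℝ 1 fun w => A w * (ψ w : ℂ) := by
  rw [contDiff_iff_contDiffAt]
  intro w
  by_cases hw : w ∈ tsupport ψ
  · have h1 : ContDiffAt ℂ 1 A w := (hA.contDiffOn hN).contDiffAt (hN.mem_nhds (hψN hw))
    exact (h1.restrict_scalars ℝ).mul (Complex.ofRealCLM.contDiff.contDiffAt.comp w hψ.contDiffAt)
  · have : (fun w => A w * (ψ w : ℂ)) =ᶠ[𝓝 w] fun _ => 0 := by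
      filter_upwards [notMem_tsupport_iff_eventuallyEq.1 hw] with v hv
      simp [hv]
    exact contDiffAt_const.congr_of_eventuallyEq this

theorem tsupport_mul_ofReal_subset (A : ℂ → ℂ) (ψ : ℂ → ℝ) :
    tsupport (fun w => A w * (ψ w : ℂ)) ⊆ tsupport ψ := by
  refine closure_mono fun w hw => ?_
  contrapose! hw
  simp only [Function.mem_support, not_not] at hw ⊢
  simp [hw]

theorem dbar_eq_zero_of_notMem_tsupport {ψ : ℂ → ℝ} {w : ℂ} (hw : w ∉ tsupport ψ) :
    dbar ψ w = 0 := by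
  have : fderiv ℝ ψ w = 0 := by
    have := notMem_tsupport_iff_eventuallyEq.1 hw
    rw [this.fderiv_eq]
    exact fderiv_const_apply _
  simp [dbar, this]

/-- `∂(Aψ)/∂z̄ = A ∂ψ/∂z̄` for holomorphic `A`. -/
theorem mul_dbar_eq {A : ℂ → ℂ} {ψ : ℂ → ℝ} {N : Set ℂ} (hN : IsOpen N)
    (hA : DifferentiableOn ℂ A N) (hψ : ContDiff ℝ 1 ψ) (hψN : tsupport ψ ⊆ N) (w : ℂ) :
    A w * dbar ψ w = (fderiv ℝ (fun w => A w * (ψ w : ℂ)) w 1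
      + Complex.I * fderiv ℝ (fun w => A w * (ψ w : ℂ)) w Complex.I) / 2 := by
  by_cases hw : w ∈ tsupport ψ
  · have hA1 : HasDerivAt A (deriv A w) w :=
      (hA.differentiableAt (hN.mem_nhds (hψN hw))).hasDerivAt
    have hA2 := hA1.hasFDerivAt.restrictScalars ℝ
    have hψ1 : HasFDerivAt ψ (fderiv ℝ ψ w) w := (hψ.differentiable one_ne_zero w).hasFDerivAt
    have hψ2 := Complex.ofRealCLM.hasFDerivAt.comp w hψ1
    have h := (hA2.mul hψ2).fderiv
    have h' : fderiv ℝ (fun w => A w * (ψ w : ℂ)) w = _ := h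
    rw [h']
    simp only [dbar, add_apply, smul_apply,
      ContinuousLinearMap.comp_apply, Complex.ofRealCLM_apply, smul_eq_mul,
      ContinuousLinearMap.coe_restrictScalars', Function.comp_apply,
      ContinuousLinearMap.toSpanSingleton_apply]
    -- The terms with `A'` carry the factor `1 + I * I = 0`, which is the Cauchy–Riemann equation.
    linear_combination (-(1 / 2 : ℂ) * ψ w * deriv A w) * Complex.I_mul_I
  · have h0 : w ∉ tsupport (fun w => A w * (ψ w : ℂ)) :=
      fun h => hw (tsupport_mul_ofReal_subset A ψ h)
    have : fderiv ℝ (fun w => A w * (ψ w : ℂ)) w = 0 := by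
      rw [(notMem_tsupport_iff_eventuallyEq.1 h0).fderiv_eq]
      exact fderiv_const_apply _
    simp [this, dbar_eq_zero_of_notMem_tsupport hw]

/-- In the chart, `e (1 + m I)` is the direction of `∂/∂s` along a graph of slope `m`, and `e I`
that of `∂/∂τ`. The identity reads `∂/∂z̄ = (e/2)(∂/∂s + (i - m) ∂/∂τ)` and uses `|e| = 1`. -/
theorem dbar_eq_directional {e : ℂ} (he : ‖e‖ = 1) (D : ℂ →L[ℝ] ℂ) (m : ℝ) :
    (D 1 + Complex.I * D Complex.I) / 2 =
      e / 2 * (D (e * (1 + m * Complex.I)) + (Complex.I - m) * D (e * Complex.I)) := by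
  have hD : ∀ v : ℂ, D v = v.re * D 1 + v.im * D Complex.I := by
    intro v
    conv_lhs => rw [show v = v.re • (1 : ℂ) + v.im • Complex.I by
      simp [Complex.re_add_im]]
    rw [map_add, map_smul, map_smul]
    simp
  have h1 : e.re * e.re + e.im * e.im = 1 := by
    have := Complex.normSq_eq_norm_sq e
    rw [he, Complex.normSq_apply] at this
    simpa using this
  have h2 : (e.re : ℂ) * e.re + e.im * e.im = 1 := by exact_mod_cast h1
  rw [hD (e * (1 + m * Complex.I)), hD (e * Complex.I)]
  conv_rhs => rw [show e / 2 = ((e.re : ℂ) + e.im * Complex.I) / 2 by rw [Complex.re_add_im]]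
  simp only [Complex.mul_re, Complex.mul_im, Complex.add_re, Complex.add_im, Complex.one_re,
    Complex.one_im, Complex.ofReal_re, Complex.ofReal_im, Complex.I_re, Complex.I_im]
  push_cast
  have hI := Complex.I_sq
  generalize (e.re : ℂ) = a at *
  generalize (e.im : ℂ) = b at *
  generalize D 1 = x at *
  generalize D Complex.I = y at *
  generalize Complex.I = i at *
  generalize (m : ℂ) = m at *
  linear_combination (-(x + i * y) / 2) * h2 + ((b ^ 2 * x - a * b * y) / 2) * hI

/-- The `s`-derivative integrates to zero along every line `τ = const`, and the `τ`-derivative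
leaves the boundary term at `τ = 0`. The set `T` stands for a half-line ending at 0, with `κ = -1`
for the upper and `κ = 1` for the lower one, so that both sides are treated at once. -/
theorem integral_halfPlane_dbar {z e : ℂ} (he : ‖e‖ = 1) {g : ℝ → ℝ} (hg : ContDiff ℝ 1 g)
    {F : ℂ → ℂ} (hF : ContDiff ℝ 1 F) (hFc : HasCompactSupport F) {T : Set ℝ} {κ : ℂ}
    (hT : ∀ f : ℝ → ℂ, ContDiff ℝ 1 f → HasCompactSupport f → ∫ x in T, deriv f x = κ * f 0) :
    ∫ p in univ ×ˢ T, (fderiv ℝ F (graphChart z he hg.continuous p) 1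
        + Complex.I * fderiv ℝ F (graphChart z he hg.continuous p) Complex.I) / 2 =
      κ * ∫ s, Complex.I / 2 * (F (graphCurve z e g s) * (e * (1 + deriv g s * Complex.I))) := by
  set ch := graphChart z he hg.continuous with hch
  have hD : Continuous (fderiv ℝ F) := hF.continuous_fderiv one_ne_zero
  have hg' : Continuous (deriv g) := hg.continuous_deriv_one
  have hDc : HasCompactSupport (fun p => fderiv ℝ F (ch p)) :=
    (hFc.fderiv ℝ).comp_homeomorph ch
  have hFd : ∀ w, HasFDerivAt F (fderiv ℝ F w) w :=
    fun w => (hF.differentiable one_ne_zero w).hasFDerivAt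
  -- the two partial derivatives
  have hs : ∀ s τ, HasDerivAt (fun s => F (ch (s, τ)))
      (fderiv ℝ F (ch (s, τ)) (e * (1 + deriv g s * Complex.I))) s := by
    intro s τ
    have h1 : HasDerivAt (fun s => ch (s, τ)) (e * (1 + deriv g s * Complex.I)) s := by
      have := (hasStrictDerivAt_graphCurve (z := z) (e := e) hg s).hasDerivAt.add_const
        (e * (τ * Complex.I))
      refine this.congr_of_eventuallyEq (Eventually.of_forall fun u => ?_)
      simp only [hch, graphChart_apply, graphCurve]
      push_cast
      ring
    exact (hFd (ch (s, τ))).comp_hasDerivAt s h1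
  have ht : ∀ s τ, HasDerivAt (fun τ => F (ch (s, τ)))
      (fderiv ℝ F (ch (s, τ)) (e * Complex.I)) τ := by
    intro s τ
    have h1 : HasDerivAt (fun τ : ℝ => ch (s, τ)) (e * Complex.I) τ := by
      have h0 : HasDerivAt (fun τ : ℝ => (τ : ℂ)) 1 τ := Complex.ofRealCLM.hasDerivAt
      have := (h0.const_mul (e * Complex.I)).const_add (z + e * (s + g s * Complex.I))
      rw [mul_one] at this
      refine this.congr_of_eventuallyEq (Eventually.of_forall fun u => ?_)
      simp only [hch, graphChart_apply]
      push_cast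
      ring
    exact (hFd (ch (s, τ))).comp_hasDerivAt τ h1
  have hcs : Continuous fun p : ℝ × ℝ =>
      fderiv ℝ F (ch p) (e * (1 + deriv g p.1 * Complex.I)) := by
    refine (hD.comp ch.continuous).clm_apply ?_
    have : Continuous fun p : ℝ × ℝ => deriv g p.1 := hg'.comp continuous_fst
    fun_prop
  have hct : Continuous fun p : ℝ × ℝ =>
      (Complex.I - deriv g p.1) * fderiv ℝ F (ch p) (e * Complex.I) := by
    have : Continuous fun p : ℝ × ℝ => deriv g p.1 := hg'.comp continuous_fst
    have h2 := (hD.comp ch.continuous).clm_apply (continuous_const (y := e * Complex.I))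
    exact Continuous.mul (by fun_prop) h2
  have his : Integrable fun p : ℝ × ℝ => fderiv ℝ F (ch p) (e * (1 + deriv g p.1 * Complex.I)) := by
    refine hcs.integrable_of_hasCompactSupport (hDc.mono fun p hp => ?_)
    contrapose! hp
    simp only [Function.mem_support, not_not] at hp ⊢
    simp [hp]
  have hit : Integrable fun p : ℝ × ℝ =>
      (Complex.I - deriv g p.1) * fderiv ℝ F (ch p) (e * Complex.I) := by
    refine hct.integrable_of_hasCompactSupport (hDc.mono fun p hp => ?_)
    contrapose! hp
    simp only [Function.mem_support, not_not] at hp ⊢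
    simp [hp]
  have hFch : HasCompactSupport (fun p => F (ch p)) := hFc.comp_homeomorph ch
  have hF1 : ∀ τ, HasCompactSupport (fun s => F (ch (s, τ))) := fun τ =>
    hFch.comp_isClosedEmbedding (g := fun s : ℝ => (s, τ))
      ⟨isEmbedding_prodMkLeft τ, by
        rw [show range (fun s : ℝ => (s, τ)) = univ ×ˢ {τ} by ext ⟨a, b⟩; simp [eq_comm]]
        exact isClosed_univ.prod isClosed_singleton⟩
  have hF2 : ∀ s, HasCompactSupport (fun τ => F (ch (s, τ))) := fun s =>
    hFch.comp_isClosedEmbedding (g := fun τ : ℝ => (s, τ))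
      ⟨isEmbedding_prodMkRight s, by
        rw [show range (fun τ : ℝ => (s, τ)) = {s} ×ˢ univ by ext ⟨a, b⟩; simp [eq_comm]]
        exact isClosed_singleton.prod isClosed_univ⟩
  have hC1 : ∀ τ, ContDiff ℝ 1 (fun s => F (ch (s, τ))) := fun τ => by
    rw [contDiff_one_iff_deriv]
    refine ⟨fun s => (hs s τ).differentiableAt, ?_⟩
    rw [show deriv (fun s => F (ch (s, τ))) = _ from funext fun s => (hs s τ).deriv]
    exact hcs.comp (continuous_id.prodMk continuous_const)
  have hC2 : ∀ s, ContDiff ℝ 1 (fun τ => F (ch (s, τ))) := fun s => by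
    rw [contDiff_one_iff_deriv]
    refine ⟨fun τ => (ht s τ).differentiableAt, ?_⟩
    rw [show deriv (fun τ => F (ch (s, τ))) = _ from funext fun τ => (ht s τ).deriv]
    exact ((hD.comp ch.continuous).clm_apply (continuous_const (y := e * Complex.I))).comp
      (continuous_const.prodMk continuous_id)
  have hsplit : ∀ p, (fderiv ℝ F (ch p) 1 + Complex.I * fderiv ℝ F (ch p) Complex.I) / 2 =
      e / 2 * (fderiv ℝ F (ch p) (e * (1 + deriv g p.1 * Complex.I)) +
        (Complex.I - deriv g p.1) * fderiv ℝ F (ch p) (e * Complex.I)) :=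
    fun p => dbar_eq_directional he _ _
  simp_rw [hsplit]
  rw [integral_const_mul, integral_add his.integrableOn hit.integrableOn]
  have hvol : (volume : Measure (ℝ × ℝ)).restrict (univ ×ˢ T) = volume.prod (volume.restrict T) := by
    rw [Measure.volume_eq_prod, ← Measure.prod_restrict, Measure.restrict_univ]
  have e1 : ∫ p in univ ×ˢ T, fderiv ℝ F (ch p) (e * (1 + deriv g p.1 * Complex.I)) = 0 := by
    have hi := his.integrableOn (s := univ ×ˢ T)
    rw [IntegrableOn] at hi
    rw [hvol] at hi ⊢
    rw [integral_prod_symm _ hi]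
    have : ∀ τ, ∫ s, fderiv ℝ F (ch (s, τ)) (e * (1 + deriv g s * Complex.I)) = 0 := by
      intro τ
      simp_rw [← fun s => (hs s τ).deriv]
      have h2 := (hC1 τ).continuous_deriv_one.integrable_of_hasCompactSupport (μ := volume)
        (hF1 τ).deriv
      rw [← integral_add_compl (measurableSet_Iic (a := (0 : ℝ))) h2, compl_Iic,
        (hF1 τ).integral_Iic_deriv_eq (hC1 τ), (hF1 τ).integral_Ioi_deriv_eq (hC1 τ)]
      ring
    simp [this]
  have e2 : ∫ p in univ ×ˢ T, (Complex.I - deriv g p.1) * fderiv ℝ F (ch p) (e * Complex.I)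
      = ∫ s, (Complex.I - deriv g s) * (κ * F (graphCurve z e g s)) := by
    have hi := hit.integrableOn (s := univ ×ˢ T)
    rw [IntegrableOn] at hi
    rw [hvol] at hi ⊢
    rw [integral_prod _ hi]
    congr 1
    ext1 s
    simp only
    rw [integral_const_mul]
    congr 1
    simp_rw [← fun τ => (ht s τ).deriv]
    rw [hT _ (hC2 s) (hF2 s), hch, graphChart_zero]
  rw [e1, e2, zero_add, ← integral_const_mul, ← integral_const_mul]
  congr 1
  ext1 s
  -- The boundary coefficient `(e/2)(i - g')` is `(i/2) e (1 + i g')`, that is, `i/2` times the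
  -- velocity of the curve.
  linear_combination (-(1 / 2 : ℂ) * κ * F (graphCurve z e g s) * e * (deriv g s : ℝ)) * Complex.I_mul_I

/-- Almost everywhere in the half-plane `Φ ∂ψ/∂z̄ = ∂(Aψ)/∂z̄`: in the half-square because `Φ = A`
there, and outside `N` because both sides vanish. The line `τ = 0`, which `T` may contain, is a null
set. -/
theorem setIntegral_halfPlane_of_ae_eq {z e : ℂ} (he : ‖e‖ = 1) {g : ℝ → ℝ} (hg : ContDiff ℝ 1 g)
    {η : ℝ} {N : Set ℂ} (hNo : IsOpen N) (hN : N = graphChart z he hg.continuous '' openSquare η)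
    {T : Set ℝ} (hTm : MeasurableSet T) {κ : ℂ}
    (hT : ∀ f : ℝ → ℂ, ContDiff ℝ 1 f → HasCompactSupport f → ∫ x in T, deriv f x = κ * f 0)
    {A Φ : ℂ → ℂ} (hA : DifferentiableOn ℂ A N)
    (hΦ : Φ =ᵐ[volume.restrict
      (graphChart z he hg.continuous '' (Ioo (-η) η ×ˢ (Ioo (-η) η ∩ (T \ {0}))))] A)
    {ψ : ℂ → ℝ} (hψ : ContDiff ℝ 1 ψ) (hψc : HasCompactSupport ψ) (hψN : tsupport ψ ⊆ N) :
    IntegrableOn (fun p => Φ (graphChart z he hg.continuous p) *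
      dbar ψ (graphChart z he hg.continuous p)) (univ ×ˢ T) ∧
    ∫ p in univ ×ˢ T, Φ (graphChart z he hg.continuous p) *
      dbar ψ (graphChart z he hg.continuous p) =
      κ * ∫ s, Complex.I / 2 * (A (graphCurve z e g s) * ψ (graphCurve z e g s) *
        (e * (1 + deriv g s * Complex.I))) := by
  set ch := graphChart z he hg.continuous with hch
  have hF := contDiff_mul_of_tsupport_subset hNo hA hψ hψN
  have hFc : HasCompactSupport fun w => A w * (ψ w : ℂ) :=
    hψc.of_isClosed_subset (isClosed_tsupport _) (tsupport_mul_ofReal_subset A ψ)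
  have key := integral_halfPlane_dbar (z := z) he hg hF hFc hT
  have h0 : ∀ᵐ p : ℝ × ℝ, p.2 ≠ 0 := by
    have : (volume : Measure (ℝ × ℝ)) (univ ×ˢ {0}) = 0 := by
      rw [Measure.volume_eq_prod, Measure.prod_prod]; simp
    refine measure_mono_null (fun p hp => ?_) this
    simpa using hp
  have hae : ∀ᵐ p ∂(volume : Measure (ℝ × ℝ)).restrict (univ ×ˢ T),
      Φ (ch p) * dbar ψ (ch p) = (fderiv ℝ (fun w => A w * (ψ w : ℂ)) (ch p) 1
        + Complex.I * fderiv ℝ (fun w => A w * (ψ w : ℂ)) (ch p) Complex.I) / 2 := by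
    have hm : MeasurableSet (ch '' (Ioo (-η) η ×ˢ (Ioo (-η) η ∩ (T \ {0})))) :=
      measurableEmbedding_graphChart.measurableSet_image.2 (measurableSet_Ioo.prod
        (measurableSet_Ioo.inter (hTm.diff (measurableSet_singleton 0))))
    have h1 := measurePreserving_graphChart (z := z) (he := he)
      (hg := hg.continuous) |>.quasiMeasurePreserving.ae ((ae_restrict_iff' hm).1 hΦ)
    rw [ae_restrict_iff' (MeasurableSet.univ.prod hTm)]
    filter_upwards [h1, h0] with p hp hp0 hpT
    rw [← mul_dbar_eq hNo hA hψ hψN]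
    by_cases hpN : ch p ∈ N
    · rw [hN] at hpN
      obtain ⟨q, hq, hqp⟩ := hpN
      obtain rfl := ch.injective hqp
      rw [hp (mem_image_of_mem ch ⟨hq.1, hq.2, hpT.2, hp0⟩)]
    · rw [dbar_eq_zero_of_notMem_tsupport fun h => hpN (hψN h)]
      simp
  refine ⟨?_, ?_⟩
  · refine (Integrable.congr ?_ (ae_eq_symm hae))
    refine Integrable.integrableOn ?_
    have hc : Continuous (fderiv ℝ fun w => A w * (ψ w : ℂ)) := hF.continuous_fderiv one_ne_zero
    have hc' := hc.comp ch.continuous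
    refine Continuous.integrable_of_hasCompactSupport ?_
      (((hFc.fderiv ℝ).comp_homeomorph ch).mono fun p hp => ?_)
    · exact ((hc'.clm_apply continuous_const).add
        (continuous_const.mul (hc'.clm_apply continuous_const))).div_const _
    · contrapose! hp
      simp only [Function.mem_support, not_not, Function.comp_apply] at hp ⊢
      simp [hp]
  · rw [integral_congr_ae hae, key]

/-- Jump formula: the boundary terms of the two sides have opposite orientation, so only `A - B`
survives. With `A = B` it says that `∂Φ/∂z̄` vanishes where Φ is analytic. -/
theorem dbarPairing_eq_integral_graph {z e : ℂ} (he : ‖e‖ = 1) {g : ℝ → ℝ} (hg : ContDiff ℝ 1 g)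
    {η : ℝ} {N : Set ℂ} (hNo : IsOpen N) (hN : N = graphChart z he hg.continuous '' openSquare η)
    {A B Φ : ℂ → ℂ} (hA : DifferentiableOn ℂ A N) (hB : DifferentiableOn ℂ B N)
    (hΦA : Φ =ᵐ[volume.restrict (graphChart z he hg.continuous '' upperSquare η)] A)
    (hΦB : Φ =ᵐ[volume.restrict (graphChart z he hg.continuous '' lowerSquare η)] B)
    {ψ : ℂ → ℝ} (hψ : ContDiff ℝ 1 ψ) (hψc : HasCompactSupport ψ) (hψN : tsupport ψ ⊆ N) :
    dbarPairing Φ ψ = ∫ s in Ioo (-η) η, Complex.I / 2 * ((A (graphCurve z e g s)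
      - B (graphCurve z e g s)) * (e * (1 + deriv g s * Complex.I))) * ψ (graphCurve z e g s) := by
  set ch := graphChart z he hg.continuous with hch
  have hup := setIntegral_halfPlane_of_ae_eq (z := z) (η := η) he hg hNo hN (T := Ioi 0) (κ := -1)
    measurableSet_Ioi (fun f h1 h2 => by rw [h2.integral_Ioi_deriv_eq h1, neg_one_mul]) hA (Φ := Φ)
    (ae_mono (Measure.restrict_mono (image_mono (prod_mono_right fun t ht =>
      (⟨ht.2.1, ht.1.2⟩ : t ∈ Ioo 0 η))) le_rfl) hΦA) hψ hψc hψN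
  have hlo := setIntegral_halfPlane_of_ae_eq (z := z) (η := η) he hg hNo hN (T := Iic 0) (κ := 1)
    measurableSet_Iic (fun f h1 h2 => by rw [h2.integral_Iic_deriv_eq h1, one_mul]) hB (Φ := Φ)
    (ae_mono (Measure.restrict_mono (image_mono (prod_mono_right fun t ht =>
      (⟨ht.1.1, lt_of_le_of_ne ht.2.1 ht.2.2⟩ : t ∈ Ioo (-η) 0))) le_rfl) hΦB) hψ hψc hψN
  have hcurve : ∀ s, s ∉ Ioo (-η) η → ψ (graphCurve z e g s) = 0 := by
    intro s hs
    by_contra h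
    have := hψN (subset_tsupport _ h)
    rw [hN, ← graphChart_zero (he := he) (hg := hg.continuous)] at this
    obtain ⟨q, hq, hqp⟩ := this
    obtain rfl := (graphChart z he hg.continuous).injective hqp
    exact hs hq.1
  have hcont : ∀ A : ℂ → ℂ, DifferentiableOn ℂ A N → Integrable fun s =>
      Complex.I / 2 * (A (graphCurve z e g s) * ψ (graphCurve z e g s) *
        (e * (1 + deriv g s * Complex.I))) := by
    intro A hA
    have hF := (contDiff_mul_of_tsupport_subset hNo hA hψ hψN).continuous
    have hFc : HasCompactSupport fun w => A w * (ψ w : ℂ) :=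
      hψc.of_isClosed_subset (isClosed_tsupport _) (tsupport_mul_ofReal_subset A ψ)
    have hg' : Continuous (deriv g) := hg.continuous_deriv_one
    have h1 := hF.comp (continuous_graphCurve (z := z) (e := e) hg.continuous)
    have h2 := hFc.comp_isClosedEmbedding (isClosedEmbedding_graphCurve (z := z) he hg.continuous)
    refine Continuous.integrable_of_hasCompactSupport ?_ (h2.mono fun p hp => ?_)
    · exact continuous_const.mul (h1.mul (by fun_prop))
    · contrapose! hp
      simp only [Function.mem_support, not_not, Function.comp_apply] at hp ⊢
      simp [hp]
  have hU : (univ : Set (ℝ × ℝ)) = univ ×ˢ Ioi 0 ∪ univ ×ˢ Iic 0 := by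
    ext p; simpa using lt_or_ge 0 p.2
  have hd : Disjoint ((univ : Set ℝ) ×ˢ Ioi (0 : ℝ)) (univ ×ˢ Iic 0) := by
    rw [Set.disjoint_left]
    rintro p ⟨-, h1⟩ ⟨-, h2⟩
    exact (not_lt.2 (show p.2 ≤ 0 from h2)) h1
  rw [dbarPairing, ← measurePreserving_graphChart.integral_comp
    (measurableEmbedding_graphChart (z := z) (he := he) (hg := hg.continuous)), ← setIntegral_univ,
    hU, setIntegral_union hd (MeasurableSet.univ.prod measurableSet_Iic) hup.1 hlo.1, hup.2, hlo.2,
    setIntegral_eq_integral_of_forall_compl_eq_zero]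
  · rw [neg_one_mul, one_mul, neg_add, neg_neg, ← sub_eq_add_neg,
      ← integral_sub (hcont A hA) (hcont B hB)]
    congr 1
    ext1 s
    ring
  · intro s hs
    simp [hcurve s hs]

/-! ### Test functions -/

theorem exists_testFunction {U : Opens ℂ} {K O : Set ℂ} (hK : IsCompact K) (hO : IsOpen O)
    (hKO : K ⊆ O) (hOU : O ⊆ U) :
    ∃ ψ : 𝓓(U, ℝ), tsupport ψ ⊆ O ∧ (∀ w, 0 ≤ ψ w ∧ ψ w ≤ 1) ∧ ∀ w ∈ K, ψ w = 1 := by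
  obtain ⟨V, hV, hKV, hVO, hVc⟩ := exists_open_between_and_isCompact_closure hK hO hKO
  obtain ⟨f, hfs, hf, hf1⟩ := exists_contMDiff_support_eq_eq_one_iff
    (modelWithCornersSelf ℝ ℂ) (n := (⊤ : ℕ∞)) hV hK.isClosed hKV
  have hts : tsupport f = closure V := by rw [tsupport, hf1.1]
  refine ⟨⟨f, contMDiff_iff_contDiff.1 hfs, by rwa [HasCompactSupport, hts],
    hts ▸ hVO.trans hOU⟩, ?_, fun w => ?_, fun w hw => (hf1.2 w).1 hw⟩
  · change tsupport f ⊆ O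
    exact hts ▸ hVO
  · have := hf (mem_range_self w)
    exact ⟨this.1, this.2⟩

theorem integral_testFunction_restrict {U : Opens ℂ} {N : Set ℂ}
    {ψ : 𝓓(U, ℝ)} (hψ : tsupport ψ ⊆ N) (μ : Measure ℂ) : ∫ w in N, ψ w ∂μ = ∫ w, ψ w ∂μ :=
  setIntegral_eq_integral_of_forall_compl_eq_zero fun _ hw =>
    image_eq_zero_of_notMem_tsupport fun h => hw (hψ h)

/-- A test function equal to 1 on a compact `K` and supported in an open `O ⊇ K` gives `μ K ≤ ν O`.
Outer regularity of `ν` at compact sets and inner regularity of `μ` extend this to Borel sets. -/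
theorem restrict_le_restrict_of_integral_testFunction {U : Opens ℂ} {N : Set ℂ} (hN : IsOpen N)
    (hNU : N ⊆ U) {μ ν : Measure ℂ} (hμ : μ N < ⊤) (hν : ν N < ⊤)
    (h : ∀ ψ : 𝓓(U, ℝ), tsupport ψ ⊆ N → (∀ w, 0 ≤ ψ w) → ∫ w, ψ w ∂μ = ∫ w, ψ w ∂ν) :
    μ.restrict N ≤ ν.restrict N := by
  have : IsFiniteMeasure (μ.restrict N) := ⟨by simpa using hμ⟩
  have : IsFiniteMeasure (ν.restrict N) := ⟨by simpa using hν⟩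
  have hK : ∀ K, IsCompact K → K ⊆ N → μ.restrict N K ≤ ν.restrict N K := by
    intro K hK hKN
    rw [hK.measure_eq_iInf_isOpen (μ := ν.restrict N)]
    refine le_iInf₂ fun O hKO => le_iInf fun hO => ?_
    obtain ⟨ψ, hψO, hψ01, hψK⟩ := exists_testFunction (U := U) hK (hO.inter hN)
      (subset_inter hKO hKN) (inter_subset_right.trans hNU)
    have hψN := hψO.trans inter_subset_right
    have hi : ∀ κ : Measure ℂ, [IsFiniteMeasure κ] → Integrable ψ κ := fun κ _ =>
      ψ.continuous.integrable_of_hasCompactSupport ψ.hasCompactSupport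
    have h1 := h ψ hψN fun w => (hψ01 w).1
    rw [← integral_testFunction_restrict hψN μ,
      ← integral_testFunction_restrict hψN ν] at h1
    have h2 : ∫⁻ w, ENNReal.ofReal (ψ w) ∂μ.restrict N = ∫⁻ w, ENNReal.ofReal (ψ w) ∂ν.restrict N := by
      rw [← ofReal_integral_eq_lintegral_ofReal (hi _) (ae_of_all _ fun w => (hψ01 w).1), h1,
        ofReal_integral_eq_lintegral_ofReal (hi _) (ae_of_all _ fun w => (hψ01 w).1)]
    calc μ.restrict N K = ∫⁻ w in K, 1 ∂μ.restrict N := by simp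
      _ = ∫⁻ w in K, ENNReal.ofReal (ψ w) ∂μ.restrict N :=
          setLIntegral_congr_fun hK.measurableSet fun w hw => by simp [hψK w hw]
      _ ≤ ∫⁻ w, ENNReal.ofReal (ψ w) ∂μ.restrict N := setLIntegral_le_lintegral _ _
      _ = ∫⁻ w, ENNReal.ofReal (ψ w) ∂ν.restrict N := h2
      _ ≤ ∫⁻ w, O.indicator 1 w ∂ν.restrict N := by
          refine lintegral_mono fun w => ?_
          by_cases hw : w ∈ O
          · simpa [hw] using (hψ01 w).2
          · have : ψ w = 0 := image_eq_zero_of_notMem_tsupport fun h => hw (hψO h).1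
            simp [this]
      _ = ν.restrict N O := by rw [lintegral_indicator_one hO.measurableSet]
  refine Measure.le_iff.2 fun S hS => ?_
  have hSN : ∀ κ : Measure ℂ, κ.restrict N S = κ.restrict N (S ∩ N) := fun κ => by
    rw [Measure.restrict_apply hS, Measure.restrict_apply (hS.inter hN.measurableSet), inter_assoc,
      inter_self]
  rw [hSN μ, hSN ν, (hS.inter hN.measurableSet).measure_eq_iSup_isCompact]
  exact iSup₂_le fun K hKS => iSup_le fun hKc =>
    (hK K hKc (hKS.trans inter_subset_right)).trans (measure_mono hKS)

theorem restrict_eq_restrict_of_integral_testFunction {U : Opens ℂ} {N : Set ℂ} (hN : IsOpen N)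
    (hNU : N ⊆ U) {μ ν : Measure ℂ} (hμ : μ N < ⊤) (hν : ν N < ⊤)
    (h : ∀ ψ : 𝓓(U, ℝ), tsupport ψ ⊆ N → (∀ w, 0 ≤ ψ w) → ∫ w, ψ w ∂μ = ∫ w, ψ w ∂ν) :
    μ.restrict N = ν.restrict N :=
  le_antisymm (restrict_le_restrict_of_integral_testFunction hN hNU hμ hν h)
    (restrict_le_restrict_of_integral_testFunction hN hNU hν hμ fun ψ h1 h2 => (h ψ h1 h2).symm)

/-- If `f` were negative at `s₀`, a bump at the corresponding point of the curve would make the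
integral negative. As the curve is embedded, the set `f < 0` is the trace of an open set `O` of the
plane, in which the bump can be supported. -/
theorem nonneg_of_integral_graph_nonneg {U : Opens ℂ} {z e : ℂ} (he : ‖e‖ = 1) {g : ℝ → ℝ}
    (hg : Continuous g) {η : ℝ} {N : Set ℂ} (hNo : IsOpen N) (hNU : N ⊆ U)
    (hN : ∀ s ∈ Ioo (-η) η, graphCurve z e g s ∈ N)
    {f : ℝ → ℝ} (hf : ContinuousOn f (Ioo (-η) η))
    (h : ∀ ψ : 𝓓(U, ℝ), tsupport ψ ⊆ N → (∀ w, 0 ≤ ψ w) →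
      0 ≤ ∫ s in Ioo (-η) η, f s * ψ (graphCurve z e g s)) :
    ∀ s ∈ Ioo (-η) η, 0 ≤ f s := by
  intro s₀ hs₀
  by_contra! hneg
  have hemb := isClosedEmbedding_graphCurve (z := z) he hg
  have hV : IsOpen (Ioo (-η) η ∩ f ⁻¹' Iio 0) := hf.isOpen_inter_preimage isOpen_Ioo isOpen_Iio
  obtain ⟨O, hO, hOV⟩ := hemb.isInducing.isOpen_iff.1 hV
  have hmem : ∀ s, graphCurve z e g s ∈ O → s ∈ Ioo (-η) η ∧ f s < 0 := fun s hs => by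
    have : s ∈ Ioo (-η) η ∩ f ⁻¹' Iio 0 := hOV ▸ hs
    exact this
  have hs₀O : graphCurve z e g s₀ ∈ O := by
    have : s₀ ∈ graphCurve z e g ⁻¹' O := hOV ▸ ⟨hs₀, hneg⟩
    exact this
  obtain ⟨ψ, hψO, hψ01, hψ1⟩ := exists_testFunction (U := U) isCompact_singleton (hO.inter hNo)
    (singleton_subset_iff.2 ⟨hs₀O, hN s₀ hs₀⟩) (inter_subset_right.trans hNU)
  have hzero : ∀ s, s ∉ Ioo (-η) η → ψ (graphCurve z e g s) = 0 := fun s hs =>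
    image_eq_zero_of_notMem_tsupport fun h => hs (hmem s (hψO h).1).1
  have hcont : Continuous fun s => -(f s * ψ (graphCurve z e g s)) := by
    refine Continuous.neg (continuous_iff_continuousAt.2 fun s => ?_)
    by_cases hs : graphCurve z e g s ∈ tsupport ψ
    · exact (hf.continuousAt (isOpen_Ioo.mem_nhds (hmem s (hψO hs).1).1)).mul
        (ψ.continuous.comp hemb.continuous).continuousAt
    · have h1 := hemb.continuous.continuousAt.eventually (notMem_tsupport_iff_eventuallyEq.1 hs)
      have : (fun s => f s * ψ (graphCurve z e g s)) =ᶠ[𝓝 s] fun _ => 0 := by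
        filter_upwards [h1] with u hu
        simp [hu]
      exact continuousAt_const.congr this.symm
  have hcs : HasCompactSupport fun s => -(f s * ψ (graphCurve z e g s)) := by
    have := ψ.hasCompactSupport.comp_isClosedEmbedding hemb
    refine this.mono fun s hs => ?_
    contrapose! hs
    simp only [Function.mem_support, not_not, Function.comp_apply] at hs ⊢
    simp [hs]
  have hpos := hcont.integral_pos_of_hasCompactSupport_nonneg_nonzero (μ := volume) hcs
    (fun s => by
      by_cases hs : graphCurve z e g s ∈ O
      · have := mul_nonneg (neg_nonneg.2 (hmem s hs).2.le) (hψ01 (graphCurve z e g s)).1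
        simp only [Pi.zero_apply]; linarith
      · have : ψ (graphCurve z e g s) = 0 :=
          image_eq_zero_of_notMem_tsupport fun h => hs (hψO h).1
        simp [this]) (x := s₀) (by rw [hψ1 _ rfl]; simpa using hneg.ne)
  rw [integral_neg] at hpos
  have h1 := h ψ (hψO.trans inter_subset_right) fun w => (hψ01 w).1
  rw [setIntegral_eq_integral_of_forall_compl_eq_zero fun s hs => by simp [hzero s hs]] at h1
  linarith

/-! ### Positive distributions are measures -/

open scoped CompactlySupported in
/-- The restriction of test functions to `U`. -/
noncomputable def testFunctionRestrict (U : Opens ℂ) : 𝓓(U, ℝ) →ₗ[ℝ] C_c(U, ℝ) where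
  toFun ψ := ⟨⟨fun x => ψ x, ψ.continuous.comp continuous_subtype_val⟩, by
    refine HasCompactSupport.of_support_subset_isCompact
      (K := Subtype.val ⁻¹' tsupport ψ) ?_ fun x hx => subset_tsupport ψ hx
    refine (Topology.IsInducing.isCompact_preimage_iff Topology.IsInducing.subtypeVal ?_).2
      ψ.hasCompactSupport
    simpa using ψ.tsupport_subset⟩
  map_add' _ _ := rfl
  map_smul' _ _ := rfl

theorem testFunctionRestrict_injective (U : Opens ℂ) :
    Function.Injective (testFunctionRestrict U) := by
  intro ψ φ h
  ext w
  by_cases hw : w ∈ U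
  · exact DFunLike.congr_fun h (⟨w, hw⟩ : U)
  · rw [image_eq_zero_of_notMem_tsupport fun h => hw (ψ.tsupport_subset h),
      image_eq_zero_of_notMem_tsupport fun h => hw (φ.tsupport_subset h)]

-- M. Riesz's extension theorem for the cone of nonnegative functions extends `T` from test
-- functions to `C_c(U)`; then the Riesz–Markov–Kakutani theorem applies. Neither continuity of `T`
-- nor density of test functions is needed, only that every function in `C_c(U)` is dominated by a
-- test function.
open scoped CompactlySupported in
theorem exists_measure_of_testFunction_nonneg {U : Opens ℂ} (T : 𝓓(U, ℝ) →ₗ[ℝ] ℝ)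
    (hT : ∀ ψ : 𝓓(U, ℝ), (∀ w, 0 ≤ ψ w) → 0 ≤ T ψ) :
    ∃ μ : Measure ℂ, μ (U : Set ℂ)ᶜ = 0 ∧ (∀ K : Set ℂ, IsCompact K → K ⊆ U → μ K < ⊤) ∧
      ∀ ψ : 𝓓(U, ℝ), T ψ = ∫ z, ψ z ∂μ := by
  let L := testFunctionRestrict U
  let eL := LinearEquiv.ofInjective L (testFunctionRestrict_injective U)
  let f : C_c(U, ℝ) →ₗ.[ℝ] ℝ := ⟨LinearMap.range L, T ∘ₗ eL.symm.toLinearMap⟩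
  let cone : PointedCone ℝ C_c(U, ℝ) :=
    { carrier := {φ | ∀ x, 0 ≤ φ x}
      add_mem' := fun ha hb x => add_nonneg (ha x) (hb x)
      zero_mem' := fun x => le_rfl
      smul_mem' := fun c φ hφ x => mul_nonneg c.2 (hφ x) }
  have hf : ∀ ψ (h : L ψ ∈ f.domain), f ⟨L ψ, h⟩ = T ψ := by
    intro ψ h
    change T (eL.symm ⟨L ψ, h⟩) = T ψ
    congr 1
    rw [LinearEquiv.symm_apply_eq]
    rfl
  have hLnn : ∀ ψ : 𝓓(U, ℝ), L ψ ∈ cone → ∀ w, 0 ≤ ψ w := by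
    intro ψ h w
    by_cases hw : w ∈ U
    · exact h ⟨w, hw⟩
    · rw [image_eq_zero_of_notMem_tsupport fun h => hw (ψ.tsupport_subset h)]
  obtain ⟨G, hG, hGnn⟩ := riesz_extension cone f
    (by
      rintro ⟨φ, ψ, rfl⟩ h
      exact (hT ψ (hLnn ψ h)).trans_eq (hf ψ _).symm)
    (by
      intro y
      obtain ⟨C, hC⟩ := y.continuous.bounded_above_of_compact_support y.hasCompactSupport
      obtain ⟨χ, -, hχ01, hχ⟩ := exists_testFunction (U := U)
        (y.hasCompactSupport.isCompact.image continuous_subtype_val) U.isOpen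
        (by rintro _ ⟨x, -, rfl⟩; exact x.2) le_rfl
      -- The bump `χ` is 1 on the support of `y`, so adding `max C 0` times `χ` makes `y`
      -- nonnegative.
      refine ⟨⟨L ((max C 0) • χ), LinearMap.mem_range_self _ _⟩, fun x => ?_⟩
      change 0 ≤ max C 0 * χ x + y x
      by_cases hx : x ∈ tsupport y
      · rw [hχ x (mem_image_of_mem _ hx), mul_one]
        have : -C ≤ y x := (abs_le.1 (hC x)).1
        linarith [le_max_left C 0]
      · rw [image_eq_zero_of_notMem_tsupport hx, add_zero]
        exact mul_nonneg (le_max_right _ _) (hχ01 x).1)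
  have hLC : LocallyCompactSpace U := U.isOpen.locallyCompactSpace
  let Λ : C_c(U, ℝ) →ₚ[ℝ] ℝ := PositiveLinearMap.mk₀ G fun φ hφ => hGnn φ hφ
  have hemb : MeasurableEmbedding (Subtype.val : U → ℂ) :=
    MeasurableEmbedding.subtype_coe U.isOpen.measurableSet
  refine ⟨(RealRMK.rieszMeasure Λ).map Subtype.val, ?_, fun K hK hKU => ?_, fun ψ => ?_⟩
  · rw [hemb.map_apply]
    convert measure_empty (μ := RealRMK.rieszMeasure Λ)
    ext x
    simp
  · rw [hemb.map_apply]
    refine IsCompact.measure_lt_top ?_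
    refine (Topology.IsInducing.isCompact_preimage_iff Topology.IsInducing.subtypeVal ?_).2 hK
    simpa using hKU
  · rw [hemb.integral_map]
    have h1 := RealRMK.integral_rieszMeasure Λ (L ψ)
    have h2 : Λ (L ψ) = T ψ := (hG ⟨L ψ, LinearMap.mem_range_self _ _⟩).trans (hf ψ _)
    rw [← h2, ← h1]
    rfl

/-! ### The functional `∂Φ/∂z̄` on test functions. -/

theorem continuous_dbar {ψ : ℂ → ℝ} (hψ : ContDiff ℝ 1 ψ) : Continuous (dbar ψ) := by
  have h := hψ.continuous_fderiv one_ne_zero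
  have h1 := h.clm_apply (continuous_const (y := (1 : ℂ)))
  have h2 := h.clm_apply (continuous_const (y := Complex.I))
  unfold dbar
  fun_prop

theorem contDiff_one_testFunction {U : Opens ℂ} (ψ : 𝓓(U, ℝ)) : ContDiff ℝ 1 ψ :=
  ψ.contDiff.of_le (by exact_mod_cast le_top)

theorem integrable_mul_dbar {U : Opens ℂ} {Φ : ℂ → ℂ} (hΦ : LocallyIntegrableOn Φ U)
    (ψ : 𝓓(U, ℝ)) : Integrable fun w => Φ w * dbar ψ w := by
  have h1 : IntegrableOn Φ (tsupport ψ) :=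
    hΦ.integrableOn_compact_subset ψ.tsupport_subset ψ.hasCompactSupport
  have h2 := h1.mul_continuousOn (continuous_dbar (contDiff_one_testFunction ψ)).continuousOn
    ψ.hasCompactSupport
  refine (integrableOn_iff_integrable_of_support_subset fun w hw => ?_).1 h2
  by_contra h
  exact hw (by simp [dbar_eq_zero_of_notMem_tsupport h])

theorem dbarPairing_add {U : Opens ℂ} {Φ : ℂ → ℂ} (hΦ : LocallyIntegrableOn Φ U)
    (ψ φ : 𝓓(U, ℝ)) : dbarPairing Φ (ψ + φ : 𝓓(U, ℝ)) = dbarPairing Φ ψ + dbarPairing Φ φ := by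
  have h : ∀ w, dbar (ψ + φ : 𝓓(U, ℝ)) w = dbar ψ w + dbar φ w := by
    intro w
    have h1 := (contDiff_one_testFunction ψ).differentiable one_ne_zero w
    have h2 := (contDiff_one_testFunction φ).differentiable one_ne_zero w
    have : fderiv ℝ (ψ + φ : 𝓓(U, ℝ)) w = fderiv ℝ ψ w + fderiv ℝ φ w := fderiv_add h1 h2
    simp only [dbar, this, add_apply]
    push_cast
    ring
  simp only [dbarPairing, h, mul_add]
  rw [integral_add (integrable_mul_dbar hΦ ψ) (integrable_mul_dbar hΦ φ)]
  ring

theorem dbarPairing_smul {U : Opens ℂ} {Φ : ℂ → ℂ} (c : ℝ) (ψ : 𝓓(U, ℝ)) :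
    dbarPairing Φ (c • ψ : 𝓓(U, ℝ)) = c * dbarPairing Φ ψ := by
  have h : ∀ w, Φ w * dbar (c • ψ : 𝓓(U, ℝ)) w = c * (Φ w * dbar ψ w) := by
    intro w
    have h1 := (contDiff_one_testFunction ψ).differentiable one_ne_zero w
    have : fderiv ℝ (c • ψ : 𝓓(U, ℝ)) w = c • fderiv ℝ ψ w := fderiv_const_smul h1 c
    simp only [dbar, this, smul_apply, smul_eq_mul]
    push_cast
    ring
  simp only [dbarPairing, h]
  rw [integral_const_mul]
  ring

theorem exists_dbarEqMeasure {U : Opens ℂ} {Φ : ℂ → ℂ} (hΦ : LocallyIntegrableOn Φ U)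
    (hpos : DbarNonneg U Φ) : ∃ μ : Measure ℂ, DbarEqMeasure U Φ μ := by
  let T : 𝓓(U, ℝ) →ₗ[ℝ] ℝ :=
    { toFun := fun ψ => (dbarPairing Φ ψ).re
      map_add' := fun ψ φ => by rw [dbarPairing_add hΦ, Complex.add_re]
      map_smul' := fun c ψ => by rw [dbarPairing_smul]; simp }
  obtain ⟨μ, h1, h2, h3⟩ := exists_measure_of_testFunction_nonneg T fun ψ hψ => (hpos ψ hψ).2
  refine ⟨μ, h1, h2, fun ψ => ?_⟩
  -- Reality is given for nonnegative test functions only; `ψ` is the difference of the nonnegative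
  -- functions `ψ + Cχ` and `Cχ`.
  have him : (dbarPairing Φ ψ).im = 0 := by
    obtain ⟨χ, -, hχ01, hχ⟩ := exists_testFunction (U := U) ψ.hasCompactSupport.isCompact U.isOpen
      ψ.tsupport_subset le_rfl
    obtain ⟨C, hC⟩ := ψ.continuous.bounded_above_of_compact_support ψ.hasCompactSupport
    have e1 := (hpos (max C 0 • χ) fun w =>
      mul_nonneg (le_max_right _ _) (hχ01 w).1).1
    have e2 := (hpos (ψ + max C 0 • χ) fun w => by
      change 0 ≤ ψ w + max C 0 * χ w
      by_cases hw : w ∈ tsupport ψ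
      · rw [hχ w hw, mul_one]
        have := (abs_le.1 (hC w)).1
        linarith [le_max_left C 0]
      · rw [image_eq_zero_of_notMem_tsupport hw, zero_add]
        exact mul_nonneg (le_max_right _ _) (hχ01 w).1).1
    rw [dbarPairing_add hΦ, Complex.add_im, e1, add_zero] at e2
    exact e2
  rw [← h3 ψ]
  exact Complex.ext (by simp [T]) (by simpa using him)

/-! ### Pieces of piecewise analytic functions -/

theorem isOpen_piece {U : Set ℂ} (hU : IsOpen U) (Ψ f : ℂ → ℂ) : IsOpen (piece U Ψ f) := by
  rw [isOpen_iff_mem_nhds]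
  rintro z ⟨hz, V, hV, h⟩
  filter_upwards [hU.mem_nhds hz, eventually_mem_nhds_iff.2 hV] with w hw hwV
  exact ⟨hw, V, hwV, h⟩

theorem piece_subset (U : Set ℂ) (Ψ f : ℂ → ℂ) : piece U Ψ f ⊆ U := fun _ h => h.1

theorem mem_piece_of_ae_eq {U N : Set ℂ} {Ψ f : ℂ → ℂ} (hN : IsOpen N) (hNU : N ⊆ U)
    (h : Ψ =ᵐ[volume.restrict N] f) : N ⊆ piece U Ψ f :=
  fun _ hz => ⟨hNU hz, N, hN.mem_nhds hz, h⟩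

/-- Locally null sets are null because the plane is second countable. -/
theorem ae_eq_of_subset_piece {U N : Set ℂ} {Ψ f : ℂ → ℂ} (hN : IsOpen N)
    (h : N ⊆ piece U Ψ f) : Ψ =ᵐ[volume.restrict N] f := by
  refine (ae_restrict_iff' hN.measurableSet).2 ?_
  refine measure_null_of_locally_null _ fun z hz => ?_
  simp only [Classical.not_imp, mem_compl_iff, mem_ofPred_eq] at hz
  obtain ⟨-, V, hV, hVf⟩ := h hz.1
  refine ⟨{w | Ψ w ≠ f w} ∩ V, ?_, ?_⟩
  · rw [mem_nhdsWithin_iff_eventually]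
    filter_upwards [hV] with w hw hw'
    simp only [Classical.not_imp, mem_compl_iff, mem_ofPred_eq] at hw'
    exact ⟨hw'.2, hw⟩
  · exact le_antisymm ((Measure.le_restrict_apply V _).trans_eq hVf) zero_le

/-- Continuous functions that agree almost everywhere on an open set agree there; then the identity
theorem applies. -/
theorem eqOn_of_mem_piece_of_mem_piece {U : Set ℂ} (hU : IsOpen U) (hc : IsPreconnected U)
    {Ψ f₁ f₂ : ℂ → ℂ} (h₁ : DifferentiableOn ℂ f₁ U) (h₂ : DifferentiableOn ℂ f₂ U) {z : ℂ}
    (hz₁ : z ∈ piece U Ψ f₁) (hz₂ : z ∈ piece U Ψ f₂) : EqOn f₁ f₂ U := by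
  set N := piece U Ψ f₁ ∩ piece U Ψ f₂
  have hN : IsOpen N := (isOpen_piece hU _ _).inter (isOpen_piece hU _ _)
  have e1 := ae_eq_of_subset_piece (N := N) hN inter_subset_left
  have e2 := ae_eq_of_subset_piece (N := N) hN inter_subset_right
  have hNU : N ⊆ U := inter_subset_left.trans (piece_subset _ _ _)
  have e3 : EqOn f₁ f₂ N := Measure.eqOn_open_of_ae_eq (e1.symm.trans e2) hN
    (h₁.mono hNU).continuousOn (h₂.mono hNU).continuousOn
  exact (h₁.analyticOnNhd hU).eqOn_of_preconnected_of_eventuallyEq (h₂.analyticOnNhd hU) hc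
    hz₁.1 (e3.eventuallyEq_of_mem (hN.mem_nhds ⟨hz₁, hz₂⟩))

theorem piece_congr {U : Set ℂ} (hU : IsOpen U) {Ψ f₁ f₂ : ℂ → ℂ} (h : EqOn f₁ f₂ U) :
    piece U Ψ f₁ = piece U Ψ f₂ := by
  have key : ∀ f₁ f₂ : ℂ → ℂ, EqOn f₁ f₂ U → piece U Ψ f₁ ⊆ piece U Ψ f₂ := by
    intro f₁ f₂ h
    refine mem_piece_of_ae_eq (isOpen_piece hU _ _) (piece_subset _ _ _) ?_
    refine (ae_eq_of_subset_piece (isOpen_piece hU _ _) le_rfl).trans ?_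
    exact (ae_restrict_iff' (isOpen_piece hU _ _).measurableSet).2
      (ae_of_all _ fun w hw => h (piece_subset _ _ _ hw))
  exact (key _ _ h).antisymm (key _ _ h.symm)

/-- A connected set that does not meet the interface lies in one piece. -/
theorem exists_subset_piece {U : Set ℂ} (hU : IsOpen U) (hc : IsPreconnected U) {ι : Type*}
    {Ψ : ℂ → ℂ} {f : ι → ℂ → ℂ} (hf : ∀ q, DifferentiableOn ℂ (f q) U) {N : Set ℂ}
    (hN : IsPreconnected N) (hne : N.Nonempty) (hNU : N ⊆ ⋃ q, piece U Ψ (f q)) :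
    ∃ q, N ⊆ piece U Ψ (f q) := by
  obtain ⟨z, hz⟩ := hne
  obtain ⟨q, hq⟩ := mem_iUnion.1 (hNU hz)
  refine ⟨q, ?_⟩
  -- The family may have repetitions, as the differences `A i - A k` do. Functions equal to `f q` on
  -- `U` have the same piece; the pieces of all others are disjoint from it.
  let V := ⋃ q' : {q' // ¬ EqOn (f q) (f q') U}, piece U Ψ (f q')
  have hV : IsOpen V := isOpen_iUnion fun _ => isOpen_piece hU _ _
  refine IsPreconnected.subset_left_of_subset_union (isOpen_piece hU _ _) hV ?_ ?_ ⟨z, hz, hq⟩ hN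
  · rw [Set.disjoint_left]
    intro w hw hwV
    obtain ⟨⟨q', hq'⟩, hw'⟩ := mem_iUnion.1 hwV
    exact hq' (eqOn_of_mem_piece_of_mem_piece hU hc (hf q) (hf q') hw hw')
  · intro w hw
    obtain ⟨q', hq'⟩ := mem_iUnion.1 (hNU hw)
    by_cases h : EqOn (f q) (f q') U
    · left; rwa [piece_congr hU h]
    · right; exact mem_iUnion.2 ⟨⟨q', h⟩, hq'⟩

theorem isOpen_compl_interface {U : Set ℂ} (hU : IsOpen U) {r : ℕ} (A : Fin r → ℂ → ℂ) (Φ : ℂ → ℂ) :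
    IsOpen (U \ interface U A Φ) := by
  rw [interface, sdiff_sdiff_right_self]
  exact hU.inter (isOpen_iUnion fun _ => isOpen_piece hU _ _)

/-- The compact set `K` ensures that the chart has finite `μ`-measure and that the densities are
continuous up to the ends of the parameter interval. -/
theorem exists_openSquare_image_subset {z e : ℂ} (he : ‖e‖ = 1) {g : ℝ → ℝ} (hg : Continuous g)
    (hg0 : g 0 = 0) {O : Set ℂ} (hO : IsOpen O) (hz : z ∈ O) :
    ∃ η > 0, ∃ K, IsCompact K ∧ K ⊆ O ∧ graphChart z he hg '' openSquare η ⊆ K := by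
  obtain ⟨R, hR, hRO⟩ := Metric.nhds_basis_closedBall.mem_iff.1 (hO.mem_nhds hz)
  have h0 : graphChart z he hg (0 : ℝ × ℝ) = z := by simp [graphChart_apply, hg0]
  have h1 : closedBall z R ∈ 𝓝 (graphChart z he hg 0) := by rw [h0]; exact closedBall_mem_nhds z hR
  obtain ⟨η, hη, h⟩ := exists_openSquare_subset
    ((graphChart z he hg).continuous.continuousAt.preimage_mem_nhds h1)
  exact ⟨η, hη, _, isCompact_closedBall z R, hRO, image_subset_iff.2 h⟩

theorem isOpen_graphChart_image {z e : ℂ} (he : ‖e‖ = 1) {g : ℝ → ℝ} (hg : Continuous g)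
    {S : Set (ℝ × ℝ)} (hS : IsOpen S) : IsOpen (graphChart z he hg '' S) :=
  (graphChart z he hg).isOpenMap _ hS

theorem mem_graphChart_image {z e : ℂ} (he : ‖e‖ = 1) {g : ℝ → ℝ} (hg : Continuous g)
    (hg0 : g 0 = 0) {η : ℝ} (hη : 0 < η) : z ∈ graphChart z he hg '' openSquare η :=
  ⟨0, ⟨⟨by simpa, by simpa⟩, by simpa, by simpa⟩, by simp [graphChart_apply, hg0]⟩

/-! ### The measure `∂Φ/∂z̄` is absolutely continuous with respect to length -/

/-- The jump formula across a straight line through `z`, with the same function on both sides. -/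
theorem exists_measure_eq_zero_of_mem_piece {U : Opens ℂ} {A Φ : ℂ → ℂ} {μ : Measure ℂ}
    (hA : DifferentiableOn ℂ A U) (hμ : DbarEqMeasure U Φ μ) {z : ℂ} (hz : z ∈ piece U Φ A) :
    ∃ N ∈ 𝓝 z, μ N = 0 := by
  have hP := isOpen_piece U.isOpen Φ A
  have hg : ContDiff ℝ 1 fun _ : ℝ => (0 : ℝ) := contDiff_const
  obtain ⟨η, hη, K, hK, hKP, hNK⟩ := exists_openSquare_image_subset (e := 1) (by simp)
    hg.continuous rfl hP hz
  set N := graphChart z (e := 1) (by simp) hg.continuous '' openSquare η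
  have hN : IsOpen N := isOpen_graphChart_image _ _ (isOpen_openSquare η)
  have hNP : N ⊆ piece U Φ A := hNK.trans hKP
  have hNU : N ⊆ U := hNP.trans (piece_subset _ _ _)
  have hae := ae_eq_of_subset_piece hN hNP
  have h1 := restrict_eq_restrict_of_integral_testFunction (μ := μ) (ν := 0) hN hNU
    ((measure_mono hNK).trans_lt (hμ.2.1 K hK (hKP.trans (piece_subset _ _ _)))) (by simp)
    (fun ψ hψN _ => by
      have := hμ.2.2 ψ
      rw [dbarPairing_eq_integral_graph (e := 1) (by simp) hg hN rfl (hA.mono hNU) (hA.mono hNU)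
        (ae_mono (Measure.restrict_mono (image_mono upperSquare_subset) le_rfl) hae)
        (ae_mono (Measure.restrict_mono (image_mono lowerSquare_subset) le_rfl) hae)
        (contDiff_one_testFunction ψ) ψ.hasCompactSupport hψN] at this
      simp only [sub_self, zero_mul, mul_zero, integral_zero] at this
      rw [integral_zero_measure]
      exact_mod_cast this.symm)
  refine ⟨N, hN.mem_nhds (mem_graphChart_image _ _ rfl hη), ?_⟩
  have := congrArg (fun κ : Measure ℂ => κ N) h1
  simpa using this

theorem measure_diff_interface_eq_zero {U : Opens ℂ} {r : ℕ} {A : Fin r → ℂ → ℂ} {Φ : ℂ → ℂ}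
    {μ : Measure ℂ} (hA : ∀ i, DifferentiableOn ℂ (A i) U) (hμ : DbarEqMeasure U Φ μ) :
    μ (U \ interface U A Φ) = 0 := by
  refine measure_null_of_locally_null _ fun z hz => ?_
  rw [interface, sdiff_sdiff_right_self] at hz
  obtain ⟨i, hi⟩ := mem_iUnion.1 hz.2
  obtain ⟨N, hN, h⟩ := exists_measure_eq_zero_of_mem_piece (hA i) hμ hi
  exact ⟨N, mem_nhdsWithin_of_mem_nhds hN, h⟩

/-- Since the interface is a null set, Φ is almost everywhere one of the `A i`. This gives the local
bound behind the linear growth of `μ`. -/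
theorem ae_norm_le_sum {U : Opens ℂ} {r : ℕ} {A : Fin r → ℂ → ℂ} {Φ : ℂ → ℂ}
    (hΦ : IsPiecewiseAnalytic U A Φ) : ∀ᵐ w, w ∈ U → ‖Φ w‖ ≤ ∑ i, ‖A i w‖ := by
  have h1 : ∀ᵐ w, ∀ i, w ∈ piece U Φ (A i) → Φ w = A i w := ae_all_iff.2 fun i =>
    (ae_restrict_iff' (isOpen_piece U.isOpen _ _).measurableSet).1
      (ae_eq_of_subset_piece (isOpen_piece U.isOpen _ _) le_rfl)
  have h2 : ∀ᵐ w, w ∉ interface U A Φ := measure_eq_zero_iff_ae_notMem.1 hΦ.volume_interface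
  filter_upwards [h1, h2] with w hw hwi hwU
  have : w ∈ ⋃ i, piece U Φ (A i) := by
    by_contra h
    exact hwi ⟨hwU, h⟩
  obtain ⟨i, hi⟩ := mem_iUnion.1 this
  rw [hw i hi]
  exact Finset.single_le_sum (f := fun i => ‖A i w‖) (fun _ _ => norm_nonneg _) (Finset.mem_univ i)

theorem norm_dbar_le (ψ : ℂ → ℝ) (w : ℂ) : ‖dbar ψ w‖ ≤ ‖fderiv ℝ ψ w‖ := by
  have h1 : ‖((fderiv ℝ ψ w 1 : ℝ) : ℂ)‖ ≤ ‖fderiv ℝ ψ w‖ := by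
    have := (fderiv ℝ ψ w).le_opNorm 1
    simpa using this
  have h2 : ‖Complex.I * ((fderiv ℝ ψ w Complex.I : ℝ) : ℂ)‖ ≤ ‖fderiv ℝ ψ w‖ := by
    have := (fderiv ℝ ψ w).le_opNorm Complex.I
    simpa using this
  have h3 := norm_add_le ((fderiv ℝ ψ w 1 : ℝ) : ℂ) (Complex.I * (fderiv ℝ ψ w Complex.I : ℝ))
  rw [dbar, norm_div]
  simp only [Complex.norm_ofNat]
  linarith

/-- The bump `χ((w - z)/ρ)` is 1 on the ball of radius ρ. Its pairing with `∂Φ/∂z̄` is at most `M ·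
(D/ρ) · 4πρ²`, where `D` bounds the gradient of `χ` and `4πρ²` is the area of the ball of radius
`2ρ` containing the support. The radius `3R` leaves room for that ball. -/
theorem exists_measure_closedBall_le {U : Opens ℂ} {Φ : ℂ → ℂ} {μ : Measure ℂ}
    (hμ : DbarEqMeasure U Φ μ) {z₀ : ℂ} {R M : ℝ}
    (hRU : closedBall z₀ (3 * R) ⊆ U) (hM : ∀ᵐ w, w ∈ closedBall z₀ (3 * R) → ‖Φ w‖ ≤ M) :
    ∃ C > 0, ∀ z ∈ ball z₀ R, ∀ ρ, 0 < ρ → ρ ≤ R →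
      μ (closedBall z ρ) ≤ ENNReal.ofReal (C * ρ) := by
  obtain ⟨χ, hχO, hχ01, hχ⟩ := exists_testFunction (U := (⊤ : Opens ℂ))
    (isCompact_closedBall (0 : ℂ) 1) (isOpen_ball (x := (0 : ℂ)) (ε := 2))
    (closedBall_subset_ball (by norm_num)) (subset_univ _)
  obtain ⟨D, hD⟩ := ((contDiff_one_testFunction χ).continuous_fderiv one_ne_zero
    ).bounded_above_of_compact_support (χ.hasCompactSupport.fderiv ℝ)
  refine ⟨max 1 (|M| * |D| * 4 * Real.pi), by positivity, fun z hz ρ hρ hρR => ?_⟩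
  have hball : ball z (2 * ρ) ⊆ closedBall z₀ (3 * R) := by
    refine ball_subset_closedBall.trans (closedBall_subset_closedBall' ?_)
    have := mem_ball.1 hz
    linarith
  set a : ℂ → ℂ := fun w => (ρ⁻¹ : ℝ) • (w - z)
  have ha : ∀ w, HasFDerivAt a ((ρ⁻¹ : ℝ) • ContinuousLinearMap.id ℝ ℂ) w := fun w =>
    ((hasFDerivAt_id w).sub_const z).const_smul ρ⁻¹
  have hts : tsupport (fun w => χ (a w)) ⊆ closedBall z (2 * ρ) ∩ ball z (2 * ρ) := by
    have hcont : Continuous a := by fun_prop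
    refine (closure_minimal (t := a ⁻¹' tsupport χ) (fun w hw => subset_tsupport χ hw)
      ((isClosed_tsupport χ).preimage hcont)).trans fun w hw => ?_
    have h1 := hχO hw
    have h2 : dist w z < 2 * ρ := by
      simp only [a, mem_ball_zero_iff, norm_smul, norm_inv, Real.norm_eq_abs,
        abs_of_pos hρ] at h1
      rw [inv_mul_lt_iff₀ hρ] at h1
      rw [dist_eq_norm]; linarith
    exact ⟨h2.le, h2⟩
  let ψ : 𝓓(U, ℝ) := ⟨fun w => χ (a w), χ.contDiff.comp (by fun_prop),
    (isCompact_closedBall z (2 * ρ)).of_isClosed_subset (isClosed_tsupport _)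
      (hts.trans inter_subset_left), hts.trans (inter_subset_right.trans (hball.trans hRU))⟩
  have hψa : ∀ w, ψ w = χ (a w) := fun w => rfl
  have hd : ∀ w, ‖dbar ψ w‖ ≤ ρ⁻¹ * |D| := by
    intro w
    refine (norm_dbar_le ψ w).trans ?_
    have h1 := ((contDiff_one_testFunction χ).differentiable one_ne_zero (a w)).hasFDerivAt.comp w
      (ha w)
    have h2 : fderiv ℝ ψ w = _ := h1.fderiv
    rw [h2, ContinuousLinearMap.comp_smul, ContinuousLinearMap.comp_id, norm_smul, norm_inv,
      Real.norm_eq_abs, abs_of_pos hρ]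
    gcongr
    exact (hD _).trans (le_abs_self D)
  have hpair : ‖dbarPairing Φ ψ‖ ≤ |M| * (ρ⁻¹ * |D|) * volume.real (ball z (2 * ρ)) := by
    rw [dbarPairing, norm_neg, ← setIntegral_eq_integral_of_forall_compl_eq_zero
      (s := ball z (2 * ρ)) fun w hw => by
        rw [dbar_eq_zero_of_notMem_tsupport (ψ := ψ) fun h => hw (hts h).2, mul_zero]]
    refine norm_setIntegral_le_of_norm_le_const_ae measure_ball_lt_top ?_
    filter_upwards [ae_restrict_mem measurableSet_ball, ae_restrict_of_ae hM] with w hw hwM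
    rw [norm_mul]
    exact mul_le_mul ((hwM (hball hw)).trans (le_abs_self M)) (hd w) (norm_nonneg _) (abs_nonneg _)
  have hvol : volume.real (ball z (2 * ρ)) = 4 * Real.pi * ρ ^ 2 := by
    rw [Measure.real, Complex.volume_ball, ENNReal.toReal_mul, ENNReal.toReal_pow,
      ENNReal.toReal_ofReal (by positivity)]
    simp; ring
  rw [hvol, hμ.2.2 ψ, Complex.norm_real, Real.norm_eq_abs] at hpair
  have hint : ∫ w, ψ w ∂μ ≤ max 1 (|M| * |D| * 4 * Real.pi) * ρ := by
    refine (le_abs_self _).trans (hpair.trans ?_)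
    calc |M| * (ρ⁻¹ * |D|) * (4 * Real.pi * ρ ^ 2) = |M| * |D| * 4 * Real.pi * ρ := by
          field_simp
      _ ≤ _ := by gcongr; exact le_max_right _ _
  have hfin : μ (tsupport ψ) < ⊤ := hμ.2.1 _ ψ.hasCompactSupport ψ.tsupport_subset
  have hintg : Integrable ψ μ := by
    have : IsFiniteMeasure (μ.restrict (tsupport ψ)) := ⟨by simpa using hfin⟩
    have : IntegrableOn ψ (tsupport ψ) μ :=
      ψ.continuous.integrable_of_hasCompactSupport ψ.hasCompactSupport
    exact (integrableOn_iff_integrable_of_support_subset (subset_tsupport _)).1 this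
  calc μ (closedBall z ρ) = ∫⁻ w in closedBall z ρ, 1 ∂μ := by simp
    _ = ∫⁻ w in closedBall z ρ, ENNReal.ofReal (ψ w) ∂μ := by
        refine setLIntegral_congr_fun isClosed_closedBall.measurableSet fun w hw => ?_
        have : χ (a w) = 1 := by
          refine hχ _ ?_
          rw [mem_closedBall, dist_eq_norm] at hw
          simp only [a, mem_closedBall_zero_iff, norm_smul, norm_inv, Real.norm_eq_abs,
            abs_of_pos hρ]
          rw [inv_mul_le_iff₀ hρ]
          linarith
        simp [hψa, this]
    _ ≤ ∫⁻ w, ENNReal.ofReal (ψ w) ∂μ := setLIntegral_le_lintegral _ _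
    _ = ENNReal.ofReal (∫ w, ψ w ∂μ) :=
        (ofReal_integral_eq_lintegral_ofReal hintg (ae_of_all _ fun w => (hχ01 (a w)).1)).symm
    _ ≤ _ := ENNReal.ofReal_le_ofReal hint

/-- A measure with linear growth on small balls is absolutely continuous with respect to
one-dimensional Hausdorff measure. -/
theorem measure_inter_eq_zero_of_hausdorffMeasure_eq_zero {X : Type*} [MetricSpace X]
    [MeasurableSpace X] [BorelSpace X]
    {μ : Measure X} {W : Set X} (hW : MeasurableSet W) {C R : ℝ} (hC : 0 < C) (hR : 0 < R)
    (h : ∀ z ∈ W, ∀ ρ, 0 < ρ → ρ ≤ R → μ (closedBall z ρ) ≤ ENNReal.ofReal (C * ρ))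
    {S : Set X} (hS : μH[1] S = 0) : μ (S ∩ W) = 0 := by
  have hC' : ENNReal.ofReal C ≠ 0 := by simpa using hC
  -- Mass distribution principle: a set of small diameter `d` that meets `W` lies in a ball of
  -- radius `d` centred in `W`, so its part in `W` has measure at most `C d`.
  have key : (ENNReal.ofReal C)⁻¹ • μ.restrict W ≤ μH[1] := by
    refine Measure.le_hausdorffMeasure 1 _ (ENNReal.ofReal R) (by simpa) fun s hs => ?_
    rw [ENNReal.rpow_one, Measure.smul_apply, smul_eq_mul, Measure.restrict_apply' hW]
    rcases (s ∩ W).eq_empty_or_nonempty with h0 | ⟨z, hzs, hzW⟩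
    · simp [h0]
    have hfin : ediam s ≠ ⊤ := ne_top_of_le_ne_top ENNReal.ofReal_ne_top hs
    have hd : ediam s = ENNReal.ofReal (diam s) := (ENNReal.ofReal_toReal hfin).symm
    have hdR : diam s ≤ R := by
      rw [hd, ENNReal.ofReal_le_ofReal_iff hR.le] at hs
      exact hs
    have hbd : ∀ ρ, 0 < ρ → ρ ≤ R → diam s ≤ ρ → μ (s ∩ W) ≤ ENNReal.ofReal (C * ρ) := by
      intro ρ h1 h2 h3
      refine (measure_mono fun w hw => ?_).trans (h z hzW ρ h1 h2)
      exact (dist_le_diam_of_mem (isBounded_iff_ediam_ne_top.2 hfin) hw.1 hzs).trans h3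
    have hmain : μ (s ∩ W) ≤ ENNReal.ofReal (C * diam s) := by
      rcases (diam_nonneg (s := s)).eq_or_lt with h0 | h0
      -- The growth bound is assumed for positive radii only; diameter zero is reached by letting ρ
      -- tend to 0.
      · have ht : Tendsto (fun ρ => ENNReal.ofReal (C * ρ)) (𝓝[>] 0)
            (𝓝 (ENNReal.ofReal (C * 0))) :=
          ((ENNReal.continuous_ofReal.comp (by fun_prop : Continuous fun ρ => C * ρ)).tendsto
            0).mono_left nhdsWithin_le_nhds
        rw [← h0]
        refine ge_of_tendsto ht ?_
        filter_upwards [self_mem_nhdsWithin, Ioc_mem_nhdsGT hR] with ρ h1 h2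
        exact hbd ρ h1 h2.2 (h0 ▸ h1.le)
      · exact hbd _ h0 hdR le_rfl
    rw [ENNReal.inv_mul_le_iff hC' ENNReal.ofReal_ne_top, hd, ← ENNReal.ofReal_mul hC.le]
    exact hmain
  have h1 := le_antisymm ((key S).trans_eq hS) zero_le
  rw [Measure.smul_apply, smul_eq_mul, Measure.restrict_apply' hW] at h1
  exact (mul_eq_zero.1 h1).resolve_left (by simp)

/-- Linear growth holds at every point of `U`, so singular points need no separate treatment and no
structure of the interface enters. -/
theorem absolutelyContinuous_hausdorffMeasure_restrict {U : Opens ℂ} {r : ℕ} {A : Fin r → ℂ → ℂ}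
    {Φ : ℂ → ℂ} (hΦ : IsPiecewiseAnalytic U A Φ) {μ : Measure ℂ} (hμ : DbarEqMeasure U Φ μ) :
    μ ≪ (μH[1]).restrict (interface U A Φ) := by
  have hnull : ∀ S : Set ℂ, S ⊆ U → μH[1] S = 0 → μ S = 0 := by
    intro S hSU hS
    refine measure_null_of_locally_null _ fun z₀ hz₀ => ?_
    obtain ⟨R', hR', hRU⟩ := Metric.nhds_basis_closedBall.mem_iff.1 (U.isOpen.mem_nhds (hSU hz₀))
    obtain ⟨R, rfl⟩ : ∃ R, R' = 3 * R := ⟨R' / 3, by ring⟩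
    have hR : 0 < R := by linarith
    have hc : ContinuousOn (fun w => ∑ i, ‖A i w‖) (closedBall z₀ (3 * R)) :=
      continuousOn_finsetSum _ fun i _ => ((hΦ.differentiableOn i).mono hRU).continuousOn.norm
    obtain ⟨M, hM⟩ := (isCompact_closedBall z₀ (3 * R)).exists_bound_of_continuousOn hc
    obtain ⟨C, hC, hgr⟩ := exists_measure_closedBall_le (M := M) hμ hRU (by
      filter_upwards [ae_norm_le_sum hΦ] with w hw hwb
      exact (hw (hRU hwb)).trans ((le_abs_self _).trans (hM w hwb)))
    refine ⟨S ∩ ball z₀ R, inter_mem self_mem_nhdsWithin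
      (mem_nhdsWithin_of_mem_nhds (ball_mem_nhds z₀ hR)), ?_⟩
    exact measure_inter_eq_zero_of_hausdorffMeasure_eq_zero measurableSet_ball hC hR hgr hS
  refine Measure.AbsolutelyContinuous.mk fun S hS h0 => ?_
  rw [Measure.restrict_apply hS] at h0
  have h1 := hnull (S ∩ interface U A Φ) (fun w hw => hw.2.1) h0
  have h2 := measure_diff_interface_eq_zero hΦ.differentiableOn hμ
  refine measure_mono_null (t := (S ∩ interface U A Φ) ∪ ((U \ interface U A Φ) ∪ (U : Set ℂ)ᶜ))
    (fun w hw => ?_) (measure_union_null h1 (measure_union_null h2 hμ.1))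
  by_cases h3 : w ∈ interface U A Φ
  · exact Or.inl ⟨hw, h3⟩
  · by_cases h4 : w ∈ (U : Set ℂ)
    · exact Or.inr (Or.inl ⟨h4, h3⟩)
    · exact Or.inr (Or.inr h4)

/-! ### Curves as unions of graphs -/

/-- A compact arc on the graph of a `C¹` function, in suitable Euclidean coordinates. -/
def IsGraphArc (G : Set ℂ) : Prop :=
  ∃ (z e : ℂ) (g : ℝ → ℝ) (a b : ℝ), ‖e‖ = 1 ∧ ContDiff ℝ 1 g ∧ G = graphCurve z e g '' Icc a b

theorem IsGraphArc.isClosed {G : Set ℂ} (hG : IsGraphArc G) : IsClosed G := by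
  obtain ⟨z, e, g, a, b, -, hg, rfl⟩ := hG
  exact (isCompact_Icc.image (continuous_graphCurve hg.continuous)).isClosed

/-- After rotation by `e` the abscissa `X` has derivative at least `c > 0` on all of ℝ, so it is a
`C¹` diffeomorphism of ℝ and the arc lies on the graph of `Y ∘ X⁻¹`. -/
theorem isGraphArc_of_velocity {γ : ℝ → ℂ} {α β c : ℝ} {e : ℂ} (he : ‖e‖ = 1)
    (hc : 0 < c) {V : ℝ → ℂ} (hV : Continuous V) (hVc : ∀ s, c ≤ (V s).re)
    (hγ : ∀ s ∈ Icc α β, γ s = γ α + e * ∫ t in α..s, V t) : IsGraphArc (γ '' Icc α β) := by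
  set X : ℝ → ℝ := fun s => ∫ t in α..s, (V t).re
  set Y : ℝ → ℝ := fun s => ∫ t in α..s, (V t).im
  have hre : Continuous fun t => (V t).re := Complex.continuous_re.comp hV
  have him : Continuous fun t => (V t).im := Complex.continuous_im.comp hV
  have hX : ∀ s, HasDerivAt X (V s).re s := fun s =>
    intervalIntegral.integral_hasDerivAt_right (hre.intervalIntegrable _ _)
      hre.stronglyMeasurable.stronglyMeasurableAtFilter hre.continuousAt
  have hY : ∀ s, HasDerivAt Y (V s).im s := fun s =>
    intervalIntegral.integral_hasDerivAt_right (him.intervalIntegrable _ _)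
      him.stronglyMeasurable.stronglyMeasurableAtFilter him.continuousAt
  have hXC : ContDiff ℝ 1 X := contDiff_one_iff_deriv.2 ⟨fun s => (hX s).differentiableAt, by
    rwa [show deriv X = _ from funext fun s => (hX s).deriv]⟩
  have hYC : ContDiff ℝ 1 Y := contDiff_one_iff_deriv.2 ⟨fun s => (hY s).differentiableAt, by
    rwa [show deriv Y = _ from funext fun s => (hY s).deriv]⟩
  have hmono : StrictMono X := strictMono_of_deriv_pos fun s => by
    rw [(hX s).deriv]; exact hc.trans_le (hVc s)
  have hgrow : ∀ s t, s ≤ t → c * (t - s) ≤ X t - X s := fun s t hst =>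
    mul_sub_le_image_sub_of_le_deriv (fun s => (hX s).differentiableAt)
      (fun s => by rw [(hX s).deriv]; exact hVc s) hst
  have hsurj : Function.Surjective X := by
    refine hXC.continuous.surjective ?_ ?_
    · refine tendsto_atTop_mono' _ ?_ (tendsto_atTop_add_const_left _ (X 0)
        (tendsto_id.const_mul_atTop hc))
      filter_upwards [eventually_ge_atTop 0] with t ht
      have := hgrow 0 t ht
      simp only [id]; linarith
    · refine tendsto_atBot_mono' _ ?_ (tendsto_atBot_add_const_left _ (X 0)
        (tendsto_id.const_mul_atBot hc))
      filter_upwards [eventually_le_atBot 0] with t ht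
      have := hgrow t 0 ht
      simp only [id]; linarith
  let eX : ℝ ≃ₜ ℝ := (hmono.orderIsoOfSurjective X hsurj).toHomeomorph
  have heX : ∀ s, eX s = X s := fun s => rfl
  have hsymm : ContDiff ℝ 1 eX.symm := eX.contDiff_symm_deriv (f' := fun s => (V s).re)
    (fun s => (hc.trans_le (hVc s)).ne') hX hXC
  have hinv : ∀ s, eX.symm (X s) = s := fun s => eX.symm_apply_apply s
  refine ⟨γ α, e, Y ∘ eX.symm, X α, X β, he, hYC.comp hsymm, ?_⟩
  have hγ' : ∀ s ∈ Icc α β, γ s = graphCurve (γ α) e (Y ∘ eX.symm) (X s) := by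
    intro s hs
    rw [hγ s hs, graphCurve, Function.comp_apply, hinv]
    congr 2
    have hi : IntervalIntegrable V volume α s := hV.intervalIntegrable _ _
    refine Complex.ext ?_ ?_
    · simpa [X] using (Complex.reCLM.intervalIntegral_comp_comm hi).symm
    · simpa [Y] using (Complex.imCLM.intervalIntegral_comp_comm hi).symm
  apply Subset.antisymm
  · rintro _ ⟨s, hs, rfl⟩
    exact ⟨X s, ⟨hmono.monotone hs.1, hmono.monotone hs.2⟩, (hγ' s hs).symm⟩
  · rintro _ ⟨x, hx, rfl⟩
    obtain ⟨s, rfl⟩ := hsurj x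
    have hs : s ∈ Icc α β := ⟨hmono.le_iff_le.1 hx.1, hmono.le_iff_le.1 hx.2⟩
    exact ⟨s, hs, hγ' s hs⟩

/-- In coordinates whose axis is the tangent at `s₀`, the velocity keeps real part above `‖v s₀‖ /
2` near `s₀`, by continuity. -/
theorem exists_isGraphArc_nhds {γ : ℝ → ℂ} {a b : ℝ} (hab : a < b)
    (hγ : ContDiffOn ℝ 1 γ (Icc a b)) (hγ0 : ∀ s ∈ Icc a b, derivWithin γ (Icc a b) s ≠ 0)
    {s₀ : ℝ} (hs₀ : s₀ ∈ Icc a b) :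
    ∃ t ∈ 𝓝 s₀, IsGraphArc (γ '' (t ∩ Icc a b)) := by
  set v := derivWithin γ (Icc a b)
  have hv : ContinuousOn v (Icc a b) :=
    hγ.continuousOn_derivWithin (uniqueDiffOn_Icc hab) le_rfl
  have hv0 : 0 < ‖v s₀‖ := norm_pos_iff.2 (hγ0 s₀ hs₀)
  set e : ℂ := v s₀ / ‖v s₀‖ with he_def
  have he : ‖e‖ = 1 := by simp [he_def, hv0.ne']
  have he0 : e ≠ 0 := norm_ne_zero_iff.1 (by simp [he])
  have hes : e⁻¹ * v s₀ = ‖v s₀‖ := by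
    have : v s₀ ≠ 0 := hγ0 s₀ hs₀
    have h2 : (‖v s₀‖ : ℂ) ≠ 0 := by exact_mod_cast hv0.ne'
    rw [he_def]; field_simp
  have hcont : ContinuousOn (fun s => (e⁻¹ * v s).re) (Icc a b) :=
    Complex.continuous_re.comp_continuousOn (continuousOn_const.mul hv)
  have hev : ∀ᶠ s in 𝓝[Icc a b] s₀, ‖v s₀‖ / 2 < (e⁻¹ * v s).re := by
    refine (hcont s₀ hs₀).eventually (lt_mem_nhds ?_)
    simp only [hes, Complex.ofReal_re]; linarith
  obtain ⟨ε, hε, hball⟩ := (nhdsWithin_hasBasis nhds_basis_closedBall (Icc a b)).mem_iff.1 hev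
  refine ⟨closedBall s₀ ε, closedBall_mem_nhds s₀ hε, ?_⟩
  rw [Real.closedBall_eq_Icc, Icc_inter_Icc] at hball ⊢
  set α := (s₀ - ε) ⊔ a
  set β := (s₀ + ε) ⊓ b
  have hα : α ≤ s₀ := sup_le (by linarith) hs₀.1
  have hβ : s₀ ≤ β := le_inf (by linarith) hs₀.2
  have hαβ : α ≤ β := hα.trans hβ
  have hsub : Icc α β ⊆ Icc a b := Icc_subset_Icc le_sup_right inf_le_right
  -- The velocity is continued beyond `[α, β]` by its end values, which preserves the lower bound
  -- and makes it defined on all of ℝ.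
  have hVc : Continuous fun s => e⁻¹ * v (projIcc α β hαβ s) := by
    have h1 : Continuous fun x : Icc α β => v x := (hv.mono hsub).domRestrict
    exact continuous_const.mul (h1.comp continuous_projIcc)
  refine isGraphArc_of_velocity he (half_pos hv0) hVc
    (fun s => (hball (projIcc α β hαβ s).2).le) fun s hs => ?_
  have h1 : ∫ t in α..s, e⁻¹ * v (projIcc α β hαβ t) = e⁻¹ * ∫ t in α..s, v t := by
    rw [← intervalIntegral.integral_const_mul]
    refine intervalIntegral.integral_congr fun t ht => ?_
    rw [uIcc_of_le hs.1] at ht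
    rw [projIcc_of_mem hαβ ⟨ht.1, ht.2.trans hs.2⟩]
  have hsub' : Icc α s ⊆ Icc a b := (Icc_subset_Icc_right hs.2).trans hsub
  have h2 : ∫ t in α..s, v t = γ s - γ α := by
    refine intervalIntegral.integral_eq_sub_of_hasDeriv_right_of_le hs.1
      (hγ.continuousOn.mono hsub') (fun t ht => ?_) ?_
    · have hd := (hγ.differentiableOn one_ne_zero t (hsub' (Ioo_subset_Icc_self ht))).hasDerivWithinAt
      have hn : Icc a b ∈ 𝓝 t := Filter.mem_of_superset (isOpen_Ioo.mem_nhds ht)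
        (Ioo_subset_Icc_self.trans hsub')
      exact (hd.hasDerivAt hn).hasDerivWithinAt
    · exact ((hv.mono hsub').mono (by rw [uIcc_of_le hs.1])).intervalIntegrable
  rw [h1, h2, ← mul_assoc, mul_inv_cancel₀ he0]
  ring

theorem exists_finite_graphArcs_of_contDiffOn {γ : ℝ → ℂ} {a b : ℝ} (hab : a < b)
    (hγ : ContDiffOn ℝ 1 γ (Icc a b)) (hγ0 : ∀ s ∈ Icc a b, derivWithin γ (Icc a b) s ≠ 0) :
    ∃ 𝒢 : Set (Set ℂ), 𝒢.Finite ∧ (∀ G ∈ 𝒢, IsGraphArc G) ∧ ⋃₀ 𝒢 = γ '' Icc a b := by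
  have key : ∃ 𝒢 : Set (Set ℂ), 𝒢.Finite ∧ (∀ G ∈ 𝒢, IsGraphArc G) ∧
      γ '' (Icc a b ∩ Icc a b) ⊆ ⋃₀ 𝒢 ∧ ⋃₀ 𝒢 ⊆ γ '' Icc a b := by
    refine (isCompact_Icc (a := a) (b := b)).induction_on (p := fun S => ∃ 𝒢 : Set (Set ℂ),
      𝒢.Finite ∧ (∀ G ∈ 𝒢, IsGraphArc G) ∧ γ '' (S ∩ Icc a b) ⊆ ⋃₀ 𝒢 ∧ ⋃₀ 𝒢 ⊆ γ '' Icc a b)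
      ?_ ?_ ?_ ?_
    · exact ⟨∅, finite_empty, by simp, by simp, by simp⟩
    · rintro S T hST ⟨𝒢, h1, h2, h3, h4⟩
      exact ⟨𝒢, h1, h2, (image_mono (inter_subset_inter_left _ hST)).trans h3, h4⟩
    · rintro S T ⟨𝒢, h1, h2, h3, h4⟩ ⟨ℋ, k1, k2, k3, k4⟩
      refine ⟨𝒢 ∪ ℋ, h1.union k1, fun G hG => hG.elim (h2 G) (k2 G), ?_, ?_⟩
      · rw [union_inter_distrib_right, image_union, sUnion_union]
        exact union_subset_union h3 k3
      · rw [sUnion_union]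
        exact union_subset h4 k4
    · intro s hs
      obtain ⟨t, ht, h⟩ := exists_isGraphArc_nhds hab hγ hγ0 hs
      exact ⟨t, mem_nhdsWithin_of_mem_nhds ht, {γ '' (t ∩ Icc a b)}, finite_singleton _,
        by simpa using h, by simp, by simpa using image_mono inter_subset_right⟩
  obtain ⟨𝒢, h1, h2, h3, h4⟩ := key
  rw [inter_self] at h3
  exact ⟨𝒢, h1, h2, h4.antisymm h3⟩

theorem IsPiecewiseC1Curve.exists_finite_graphArcs {C : Set ℂ} (hC : IsPiecewiseC1Curve C) :
    ∃ 𝒢 : Set (Set ℂ), 𝒢.Finite ∧ (∀ G ∈ 𝒢, IsGraphArc G) ∧ ⋃₀ 𝒢 = C := by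
  obtain ⟨n, t, γ, hn, ht, -, hγ, rfl⟩ := hC
  have h : ∀ k : Fin n, ∃ 𝒢 : Set (Set ℂ), 𝒢.Finite ∧ (∀ G ∈ 𝒢, IsGraphArc G) ∧
      ⋃₀ 𝒢 = γ '' Icc (t k) (t (k + 1)) := fun k =>
    exists_finite_graphArcs_of_contDiffOn (ht (Nat.lt_succ_self _)) (hγ k k.2).1 (hγ k k.2).2
  have hcov : ∀ m, 1 ≤ m → ∀ s ∈ Icc (t 0) (t m), ∃ k < m, s ∈ Icc (t k) (t (k + 1)) := by
    intro m hm
    induction m, hm using Nat.le_induction with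
    | base => exact fun s hs => ⟨0, one_pos, hs⟩
    | succ m hm ih =>
      intro s hs
      rcases le_total s (t m) with h1 | h1
      · obtain ⟨k, hk, hk'⟩ := ih s ⟨hs.1, h1⟩
        exact ⟨k, hk.trans (Nat.lt_succ_self m), hk'⟩
      · exact ⟨m, Nat.lt_succ_self m, h1, hs.2⟩
  choose 𝒢 h1 h2 h3 using h
  refine ⟨⋃ k, 𝒢 k, finite_iUnion h1, fun G hG => ?_, ?_⟩
  · obtain ⟨k, hk⟩ := mem_iUnion.1 hG
    exact h2 k G hk
  · rw [sUnion_iUnion]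
    simp_rw [h3]
    rw [← image_iUnion]
    congr 1
    apply Subset.antisymm
    · exact iUnion_subset fun k => Icc_subset_Icc (ht.monotone (Nat.zero_le _)) (ht.monotone k.2)
    · intro s hs
      obtain ⟨k, hk, hk'⟩ := hcov n hn s hs
      exact mem_iUnion.2 ⟨⟨k, hk⟩, hk'⟩

theorem IsLocallyFiniteUnionOfCurves.exists_finite_graphArcs {U Γ : Set ℂ}
    (h : IsLocallyFiniteUnionOfCurves U Γ) {z : ℂ} (hz : z ∈ U) :
    ∃ V, IsOpen V ∧ z ∈ V ∧ ∃ 𝒢 : Set (Set ℂ), 𝒢.Finite ∧ (∀ G ∈ 𝒢, IsGraphArc G) ∧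
      Γ ∩ V ⊆ ⋃₀ 𝒢 := by
  obtain ⟨S, hS, hloc, rfl⟩ := h
  obtain ⟨V, hV, hfin⟩ := hloc z hz
  obtain ⟨W, hWV, hW, hzW⟩ := _root_.mem_nhds_iff.1 hV
  have h : ∀ C : S, ∃ 𝒢 : Set (Set ℂ), 𝒢.Finite ∧ (∀ G ∈ 𝒢, IsGraphArc G) ∧ ⋃₀ 𝒢 = C :=
    fun C => (hS C C.2).exists_finite_graphArcs
  choose 𝒢 h1 h2 h3 using h
  have : Finite {C : S | ((C : Set ℂ) ∩ V).Nonempty} := by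
    refine Set.Finite.of_finite_image (f := Subtype.val) (hfin.subset ?_)
      Subtype.val_injective.injOn
    rintro _ ⟨C, hC, rfl⟩
    exact ⟨C.2, hC⟩
  refine ⟨W, hW, hzW, ⋃ C : {C : S | ((C : Set ℂ) ∩ V).Nonempty}, 𝒢 C,
    finite_iUnion fun C => h1 C, fun G hG => ?_, ?_⟩
  · obtain ⟨C, hC⟩ := mem_iUnion.1 hG
    exact h2 C G hC
  · rintro w ⟨⟨C, hCS, hwC⟩, hwW⟩
    rw [sUnion_iUnion]
    refine mem_iUnion.2 ⟨⟨⟨C, hCS⟩, ⟨w, hwC, hWV hwW⟩⟩, ?_⟩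
    rw [h3]
    exact hwC

/-! ### Regular points are dense in the interface. -/

/-- If a set is locally covered by finitely many closed sets, then some nonempty relatively open
part of it lies in one of them. -/
theorem exists_subset_of_finite_cover {X : Type*} [TopologicalSpace X] {𝒢 : Set (Set X)}
    (hfin : 𝒢.Finite) (hcl : ∀ G ∈ 𝒢, IsClosed G) {F : Set X} :
    ∀ V, IsOpen V → (F ∩ V).Nonempty → F ∩ V ⊆ ⋃₀ 𝒢 →
      ∃ G ∈ 𝒢, ∃ V' ⊆ V, IsOpen V' ∧ (F ∩ V').Nonempty ∧ F ∩ V' ⊆ G := by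
  induction 𝒢, hfin using Set.Finite.induction_on with
  | empty =>
    intro V _ hne hcov
    obtain ⟨x, hx⟩ := hne
    simpa using hcov hx
  | @insert G 𝒢 _ _ ih =>
    intro V hV hne hcov
    -- Either `F ∩ V` has points outside the closed set `G`, and `V \ G` needs one set fewer, or `F
    -- ∩ V` lies in `G`.
    by_cases h : (F ∩ (V \ G)).Nonempty
    · obtain ⟨G', hG', V', hV', h1, h2, h3⟩ := ih (fun G hG => hcl G (mem_insert_of_mem _ hG))
        (V \ G) (hV.sdiff (hcl G (mem_insert _ _))) h (by
          rintro x ⟨hxF, hxV, hxG⟩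
          have := hcov ⟨hxF, hxV⟩
          rw [sUnion_insert] at this
          exact this.resolve_left hxG)
      exact ⟨G', mem_insert_of_mem _ hG', V', hV'.trans sdiff_subset, h1, h2, h3⟩
    · refine ⟨G, mem_insert _ _, V, le_rfl, hV, hne, fun x hx => ?_⟩
      by_contra hxG
      exact h ⟨x, hx.1, hx.2, hxG⟩

theorem graphCurve_add {z e : ℂ} {g : ℝ → ℝ} (s₀ s : ℝ) : graphCurve z e g (s₀ + s) =
    graphCurve (graphCurve z e g s₀) e (fun u => g (s₀ + u) - g s₀) s := by
  simp only [graphCurve]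
  push_cast
  ring

/-- Either the curve leaves the closed arc `G`, and a neighborhood of such a point misses `G`; or it
runs inside `G`. In the second case the abscissa `P` on `G` is injective along `c`, so by the
intermediate value theorem the curve covers all of `G` over an interval of abscissas. -/
theorem exists_nhds_inter_graphArc_subset {c : ℝ → ℂ} (hc : Continuous c)
    (hinj : Function.Injective c) {G : Set ℂ} (hG : IsGraphArc G) {a b : ℝ} (hab : a < b) :
    ∃ s ∈ Ioo a b, ∃ W, IsOpen W ∧ c s ∈ W ∧ G ∩ W ⊆ c '' Ioo a b := by
  by_cases h : ∃ s ∈ Ioo a b, c s ∉ G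
  · obtain ⟨s, hs, hsG⟩ := h
    exact ⟨s, hs, Gᶜ, hG.isClosed.isOpen_compl, hsG, by simp⟩
  push Not at h
  obtain ⟨z, e, g, α, β, he, hg, rfl⟩ := hG
  have he0 : e ≠ 0 := norm_ne_zero_iff.1 (by simp [he])
  set P : ℂ → ℝ := fun w => (e⁻¹ * (w - z)).re
  have hP : Continuous P := by fun_prop
  have hPc : ∀ t, P (graphCurve z e g t) = t := fun t => by
    simp only [P, graphCurve, add_sub_cancel_left, inv_mul_cancel_left₀ he0]
    simp
  have hcP : ∀ s ∈ Ioo a b, graphCurve z e g (P (c s)) = c s := by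
    intro s hs
    obtain ⟨t, -, ht⟩ := h s hs
    rw [← ht, hPc]
  obtain ⟨s₁, hs₁⟩ := exists_between hab
  obtain ⟨s₂, hs₂⟩ := exists_between hs₁.2
  have hs₁' : s₁ ∈ Ioo a b := hs₁
  have hs₂' : s₂ ∈ Ioo a b := ⟨hs₁.1.trans hs₂.1, hs₂.2⟩
  have hne : P (c s₁) ≠ P (c s₂) := by
    intro heq
    have : c s₁ = c s₂ := by rw [← hcP s₁ hs₁', ← hcP s₂ hs₂', heq]
    exact hs₂.1.ne (hinj this)
  have hsub : uIcc s₁ s₂ ⊆ Ioo a b := by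
    rw [uIcc_of_le hs₂.1.le]
    exact Icc_subset_Ioo hs₁'.1 hs₂'.2
  have hivt : uIcc (P (c s₁)) (P (c s₂)) ⊆ (fun s => P (c s)) '' uIcc s₁ s₂ :=
    intermediate_value_uIcc (f := fun s => P (c s)) (hP.comp hc).continuousOn
  obtain ⟨m, hm⟩ : (Ioo (min (P (c s₁)) (P (c s₂))) (max (P (c s₁)) (P (c s₂)))).Nonempty :=
    nonempty_Ioo.2 (min_lt_max.2 hne)
  obtain ⟨s, hs, hsm⟩ := hivt (Ioo_subset_Icc_self hm)
  refine ⟨s, hsub hs, P ⁻¹' Ioo (min (P (c s₁)) (P (c s₂))) (max (P (c s₁)) (P (c s₂))),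
    isOpen_Ioo.preimage hP, ?_, ?_⟩
  · rw [mem_preimage]
    simp only at hsm
    rwa [hsm]
  · rintro _ ⟨⟨t, -, rfl⟩, ht⟩
    rw [mem_preimage, hPc] at ht
    obtain ⟨u, hu, hut⟩ := hivt (Ioo_subset_Icc_self ht)
    refine ⟨u, hsub hu, ?_⟩
    simp only at hut
    rw [← hcP u (hsub hu), hut]

theorem exists_nhds_inter_graphArcs_subset {c : ℝ → ℂ} (hc : Continuous c)
    (hinj : Function.Injective c) {𝒢 : Set (Set ℂ)} (hfin : 𝒢.Finite)
    (h𝒢 : ∀ G ∈ 𝒢, IsGraphArc G) {a b : ℝ} (hab : a < b) :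
    ∃ s ∈ Ioo a b, ∃ W, IsOpen W ∧ c s ∈ W ∧ (⋃₀ 𝒢) ∩ W ⊆ c '' Ioo a b := by
  -- The induction over the arcs needs a whole parameter interval on which to treat the next arc,
  -- not just one good point.
  suffices ∃ a' b', a' < b' ∧ Ioo a' b' ⊆ Ioo a b ∧ ∃ W, IsOpen W ∧ c '' Ioo a' b' ⊆ W ∧
      (⋃₀ 𝒢) ∩ W ⊆ c '' Ioo a b by
    obtain ⟨a', b', hab', hsub, W, hW, hcW, h⟩ := this
    obtain ⟨s, hs⟩ := exists_between hab'
    exact ⟨s, hsub hs, W, hW, hcW (mem_image_of_mem c hs), h⟩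
  induction 𝒢, hfin using Set.Finite.induction_on with
  | empty => exact ⟨a, b, hab, le_rfl, univ, isOpen_univ, subset_univ _, by simp⟩
  | @insert G 𝒢 _ _ ih =>
    obtain ⟨a', b', hab', hsub, W, hW, hcW, h⟩ := ih fun G hG => h𝒢 G (mem_insert_of_mem _ hG)
    obtain ⟨s, hs, W', hW', hsW', h'⟩ :=
      exists_nhds_inter_graphArc_subset hc hinj (h𝒢 G (mem_insert _ _)) hab'
    have hopen : IsOpen (Ioo a' b' ∩ c ⁻¹' W') := isOpen_Ioo.inter (hW'.preimage hc)
    obtain ⟨a'', b'', hs'', hsub''⟩ := mem_nhds_iff_exists_Ioo_subset.1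
      (hopen.mem_nhds ⟨hs, hsW'⟩)
    refine ⟨a'', b'', hs''.1.trans hs''.2, (hsub''.trans inter_subset_left).trans hsub, W ∩ W',
      hW.inter hW', subset_inter ((image_mono (hsub''.trans inter_subset_left)).trans hcW)
        (image_subset_iff.2 (hsub''.trans inter_subset_right)), ?_⟩
    rw [sUnion_insert, union_inter_distrib_right]
    refine union_subset ?_ ?_
    · exact (inter_subset_inter_right _ inter_subset_right).trans (h'.trans (image_mono hsub))
    · exact (inter_subset_inter_right _ inter_subset_left).trans h

theorem isRegularPoint_of_inter_subset {Γ W : Set ℂ} {z e : ℂ} (he : ‖e‖ = 1) {g : ℝ → ℝ}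
    (hg : ContDiff ℝ 1 g) {a b s₀ : ℝ} (hs₀ : s₀ ∈ Ioo a b)
    (hΓ : graphCurve z e g '' Ioo a b ⊆ Γ) (hW : IsOpen W) (hsW : graphCurve z e g s₀ ∈ W)
    (h : Γ ∩ W ⊆ graphCurve z e g '' Ioo a b) : IsRegularPoint Γ (graphCurve z e g s₀) := by
  have he0 : e ≠ 0 := norm_ne_zero_iff.1 (by simp [he])
  set F : ℝ × ℝ → ℂ := fun p => graphCurve z e g s₀ + e * (p.1 + p.2 * Complex.I)
  have hF : Continuous F := by fun_prop
  have hopen : IsOpen (F ⁻¹' W ∩ {p | s₀ + p.1 ∈ Ioo a b}) :=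
    (hW.preimage hF).inter (isOpen_Ioo.preimage (by fun_prop))
  obtain ⟨δ, hδ, hsub⟩ := exists_openSquare_subset
    (hopen.mem_nhds (show (0 : ℝ × ℝ) ∈ _ from ⟨by simpa [F] using hsW, by simpa using hs₀⟩))
  refine ⟨e, δ, fun u => g (s₀ + u) - g s₀, he, hδ, (hg.comp (by fun_prop)).sub contDiff_const,
    by simp, fun s t hs ht => ?_⟩
  have hst := hsub (show ((s, t) : ℝ × ℝ) ∈ openSquare δ from ⟨abs_lt.1 hs, abs_lt.1 ht⟩)
  constructor
  · intro hmem
    obtain ⟨u, hu, huE⟩ := h ⟨hmem, hst.1⟩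
    simp only [graphCurve] at huE
    have h1 : ((u - s₀ : ℝ) : ℂ) + ((g u - g s₀ : ℝ) : ℂ) * Complex.I = s + t * Complex.I := by
      apply mul_left_cancel₀ he0
      push_cast
      linear_combination huE
    have hre := congrArg Complex.re h1
    have him := congrArg Complex.im h1
    simp at hre him
    rw [← him, ← hre]
    simp
  · rintro rfl
    have : graphCurve z e g (s₀ + s) ∈ Γ := hΓ (mem_image_of_mem _ hst.2)
    rw [graphCurve_add] at this
    exact this

/-- If both sides of a graph belong to one piece, so does the graph. -/
theorem image_openSquare_subset_piece {U : Set ℂ} {Ψ f : ℂ → ℂ} {z e : ℂ}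
    (he : ‖e‖ = 1) {g : ℝ → ℝ} (hg : Continuous g) {η : ℝ}
    (hU : graphChart z he hg '' openSquare η ⊆ U)
    (h₁ : graphChart z he hg '' upperSquare η ⊆ piece U Ψ f)
    (h₂ : graphChart z he hg '' lowerSquare η ⊆ piece U Ψ f) :
    graphChart z he hg '' openSquare η ⊆ piece U Ψ f := by
  have hB := isOpen_graphChart_image (z := z) he hg (isOpen_openSquare η)
  have a1 := (ae_restrict_iff' (isOpen_graphChart_image (z := z) he hg
    (isOpen_upperSquare η)).measurableSet).1
    (ae_eq_of_subset_piece (isOpen_graphChart_image he hg (isOpen_upperSquare η)) h₁)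
  have a2 := (ae_restrict_iff' (isOpen_graphChart_image (z := z) he hg
    (isOpen_lowerSquare η)).measurableSet).1
    (ae_eq_of_subset_piece (isOpen_graphChart_image he hg (isOpen_lowerSquare η)) h₂)
  have hnull : volume (graphChart z he hg '' (univ ×ˢ {0})) = 0 := by
    rw [← (measurePreserving_graphChart (z := z) (he := he) (hg := hg)).map_eq,
      measurableEmbedding_graphChart.map_apply,
      preimage_image_eq _ (graphChart z he hg).injective, Measure.volume_eq_prod, Measure.prod_prod]
    simp
  refine mem_piece_of_ae_eq hB hU ((ae_restrict_iff' hB.measurableSet).2 ?_)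
  filter_upwards [a1, a2, measure_eq_zero_iff_ae_notMem.1 hnull] with w b1 b2 b3
  rintro ⟨p, hp, rfl⟩
  rcases lt_trichotomy p.2 0 with h | h | h
  · exact b2 ⟨p, ⟨hp.1, hp.2.1, h⟩, rfl⟩
  · exact absurd ⟨p, ⟨mem_univ _, h⟩, rfl⟩ b3
  · exact b1 ⟨p, ⟨hp.1, h, hp.2.2⟩, rfl⟩

/-- The part of an interface in an open set contains regular points of any locally finite union of
curves that contains the interface. -/
theorem exists_isRegularPoint_mem {U Γ : Set ℂ} (hU : IsOpen U) (hc : IsPreconnected U)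
    (hΓ : IsLocallyFiniteUnionOfCurves U Γ) {ι : Type*} {Ψ : ℂ → ℂ} {f : ι → ℂ → ℂ}
    (hf : ∀ q, DifferentiableOn ℂ (f q) U) (hFΓ : U \ ⋃ q, piece U Ψ (f q) ⊆ Γ) {V : Set ℂ}
    (hV : IsOpen V) (hne : ((U \ ⋃ q, piece U Ψ (f q)) ∩ V).Nonempty) :
    ∃ w ∈ (U \ ⋃ q, piece U Ψ (f q)) ∩ V, IsRegularPoint Γ w := by
  -- `F` may be smaller than Γ: for uniqueness it is the interface of a difference `Φ - Φ'`.
  set F := U \ ⋃ q, piece U Ψ (f q) with hF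
  obtain ⟨z₀, hz₀F, hz₀V⟩ := hne
  obtain ⟨V₀, hV₀, hz₀V₀, 𝒢, hfin, h𝒢, hcov⟩ := hΓ.exists_finite_graphArcs hz₀F.1
  obtain ⟨G, hG, V', hV'sub, hV', ⟨z, hzF, hzV'⟩, hFG⟩ :=
    exists_subset_of_finite_cover hfin (fun G hG => (h𝒢 G hG).isClosed) (F := F) (V₀ ∩ V ∩ U)
      ((hV₀.inter hV).inter hU) ⟨z₀, hz₀F, ⟨hz₀V₀, hz₀V⟩, hz₀F.1⟩
      (fun w hw => hcov ⟨hFΓ hw.1, hw.2.1.1⟩)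
  obtain ⟨z₁, e, g₁, α, β, he, hg₁, rfl⟩ := h𝒢 G hG
  obtain ⟨s₁, -, hs₁⟩ := hFG ⟨hzF, hzV'⟩
  set g : ℝ → ℝ := fun u => g₁ (s₁ + u) - g₁ s₁
  have hg : ContDiff ℝ 1 g := (hg₁.comp (by fun_prop)).sub contDiff_const
  have hg0 : g 0 = 0 := by simp [g]
  have hrange : graphCurve z₁ e g₁ '' Icc α β ⊆ range (graphCurve z e g) := by
    rintro _ ⟨s, -, rfl⟩
    refine ⟨s - s₁, ?_⟩
    have := graphCurve_add (z := z₁) (e := e) (g := g₁) s₁ (s - s₁)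
    rw [hs₁, add_sub_cancel] at this
    exact this.symm
  obtain ⟨η, hη, K, hK, hKV, hBK⟩ := exists_openSquare_image_subset he hg.continuous hg0 hV' hzV'
  set ch := graphChart z he hg.continuous with hch
  have hBV : ch '' openSquare η ⊆ V' := hBK.trans hKV
  have hBU : ch '' openSquare η ⊆ U := fun w hw => (hV'sub (hBV hw)).2
  -- Here `F` lies on a single graph, so each open side of the graph avoids `F` and therefore lies
  -- in one piece.
  have hoff : ∀ p ∈ openSquare η, p.2 ≠ 0 → ch p ∈ ⋃ q, piece U Ψ (f q) := by
    intro p hp hp0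
    by_contra hcon
    obtain ⟨s, hs⟩ := hrange (hFG ⟨⟨hBU (mem_image_of_mem _ hp), hcon⟩, hBV (mem_image_of_mem _ hp)⟩)
    rw [← graphChart_zero (he := he) (hg := hg.continuous)] at hs
    obtain rfl := ch.injective hs
    exact hp0 rfl
  obtain ⟨q₁, hq₁⟩ := exists_subset_piece hU hc hf
    ((isConnected_upperSquare hη).isPreconnected.image ch ch.continuous.continuousOn)
    ((isConnected_upperSquare hη).nonempty.image ch)
    (image_subset_iff.2 fun p hp => hoff p (upperSquare_subset hp) hp.2.1.ne')
  obtain ⟨q₂, hq₂⟩ := exists_subset_piece hU hc hf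
    ((isConnected_lowerSquare hη).isPreconnected.image ch ch.continuous.continuousOn)
    ((isConnected_lowerSquare hη).nonempty.image ch)
    (image_subset_iff.2 fun p hp => hoff p (lowerSquare_subset hp) hp.2.2.ne)
  -- If a point of the curve were in a piece, that piece would meet both sides. All three functions
  -- would then coincide and the whole square, including the point `z` of `F`, would lie in this
  -- piece.
  have hcF : ∀ s ∈ Ioo (-η) η, graphCurve z e g s ∈ F := by
    intro s hs
    have hsq : (s, (0 : ℝ)) ∈ openSquare η := ⟨hs, by simpa, by simpa⟩
    rw [← graphChart_zero (he := he) (hg := hg.continuous)]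
    refine ⟨hBU (mem_image_of_mem _ hsq), fun hmem => ?_⟩
    obtain ⟨q, hq⟩ := mem_iUnion.1 hmem
    have hcont : Continuous fun τ : ℝ => ch (s, τ) := by fun_prop
    have hnear : ∀ᶠ τ in 𝓝 (0 : ℝ), ch (s, τ) ∈ piece U Ψ (f q) :=
      hcont.continuousAt.eventually ((isOpen_piece hU _ _).mem_nhds hq)
    obtain ⟨τ₁, hτ₁, hτ₁'⟩ := ((hnear.filter_mono nhdsWithin_le_nhds).and
      (Ioo_mem_nhdsGT hη)).exists
    obtain ⟨τ₂, hτ₂, hτ₂'⟩ := ((hnear.filter_mono nhdsWithin_le_nhds).and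
      (Ioo_mem_nhdsLT (neg_lt_zero.2 hη))).exists
    have e1 := piece_congr hU (Ψ := Ψ) (eqOn_of_mem_piece_of_mem_piece hU hc (hf q) (hf q₁) hτ₁
      (hq₁ ⟨(s, τ₁), ⟨hs, hτ₁'⟩, rfl⟩))
    have e2 := piece_congr hU (Ψ := Ψ) (eqOn_of_mem_piece_of_mem_piece hU hc (hf q) (hf q₂) hτ₂
      (hq₂ ⟨(s, τ₂), ⟨hs, hτ₂'⟩, rfl⟩))
    rw [← e1] at hq₁
    rw [← e2] at hq₂
    have hz := image_openSquare_subset_piece he hg.continuous hBU hq₁ hq₂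
      (mem_graphChart_image he hg.continuous hg0 hη)
    exact hzF.2 (mem_iUnion.2 ⟨q, hz⟩)
  -- The other arcs covering Γ may still touch the curve; at a suitable `s` they contribute nothing
  -- outside it.
  obtain ⟨s, hs, W, hW, hsW, hWsub⟩ := exists_nhds_inter_graphArcs_subset
    (continuous_graphCurve hg.continuous) (graphCurve_injective (z := z) he hg.continuous) hfin h𝒢
    (show -η < η by linarith)
  have hsV' : graphCurve z e g s ∈ V' := by
    rw [← graphChart_zero (he := he) (hg := hg.continuous)]
    exact hBV (mem_image_of_mem _ ⟨hs, by simpa, by simpa⟩)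
  refine ⟨graphCurve z e g s, ⟨hcF s hs, (hV'sub hsV').1.2⟩,
    isRegularPoint_of_inter_subset he hg hs (image_subset_iff.2 fun u hu => hFΓ (hcF u hu))
      (hW.inter hV₀) ⟨hsW, (hV'sub hsV').1.1⟩ fun w hw => hWsub ⟨hcov ⟨hw.1, hw.2.2⟩, hw.2.1⟩⟩

/-! ### Regular points -/

/-- A chart around `z`, with image in a compact subset of `O`, that straightens `Γ`. -/
structure StraighteningChart (Γ O : Set ℂ) (z : ℂ) where
  e : ℂ
  g : ℝ → ℝ
  η : ℝ
  K : Set ℂ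
  norm_e : ‖e‖ = 1
  contDiff_g : ContDiff ℝ 1 g
  g_zero : g 0 = 0
  η_pos : 0 < η
  isCompact_K : IsCompact K
  K_subset : K ⊆ O
  image_subset : graphChart z norm_e contDiff_g.continuous '' openSquare η ⊆ K
  mem_iff : ∀ p ∈ openSquare η, graphChart z norm_e contDiff_g.continuous p ∈ Γ ↔ p.2 = 0

theorem openSquare_mono {η η' : ℝ} (h : η ≤ η') : openSquare η ⊆ openSquare η' :=
  prod_mono (Ioo_subset_Ioo (neg_le_neg h) h) (Ioo_subset_Ioo (neg_le_neg h) h)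

theorem IsRegularPoint.mem {Γ : Set ℂ} {z : ℂ} (h : IsRegularPoint Γ z) : z ∈ Γ := by
  obtain ⟨e, δ, g, -, hδ, -, hg0, hiff⟩ := h
  have := (hiff 0 0 (by simpa) (by simpa)).2 hg0.symm
  simpa using this

theorem IsRegularPoint.nonempty_straighteningChart {Γ O : Set ℂ} {z : ℂ} (h : IsRegularPoint Γ z)
    (hO : IsOpen O) (hz : z ∈ O) : Nonempty (StraighteningChart Γ O z) := by
  obtain ⟨e, δ, g, he, hδ, hg, hg0, hiff⟩ := h
  obtain ⟨η₁, hη₁, K, hK, hKO, hNK⟩ := exists_openSquare_image_subset he hg.continuous hg0 hO hz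
  have hopen : IsOpen {p : ℝ × ℝ | |p.1| < δ ∧ |g p.1 + p.2| < δ} := by
    have := hg.continuous
    have h1 : Continuous fun p : ℝ × ℝ => |p.1| := by fun_prop
    have h2 : Continuous fun p : ℝ × ℝ => |g p.1 + p.2| := by fun_prop
    exact (isOpen_lt h1 continuous_const).inter (isOpen_lt h2 continuous_const)
  obtain ⟨η₂, hη₂, hsub⟩ := exists_openSquare_subset
    (hopen.mem_nhds (show (0 : ℝ × ℝ) ∈ _ from ⟨by simpa, by simpa [hg0]⟩))
  refine ⟨⟨e, g, min η₁ η₂, K, he, hg, hg0, lt_min hη₁ hη₂, hK, hKO,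
    (image_mono (openSquare_mono (min_le_left _ _))).trans hNK, fun p hp => ?_⟩⟩
  have hp' := hsub (openSquare_mono (min_le_right _ _) hp)
  have := hiff p.1 (g p.1 + p.2) hp'.1 hp'.2
  rw [graphChart_apply, this]
  simp

namespace StraighteningChart

variable {Γ O : Set ℂ} {z : ℂ} (c : StraighteningChart Γ O z)

/-- The chart as a homeomorphism. -/
noncomputable def toHomeomorph : ℝ × ℝ ≃ₜ ℂ := graphChart z c.norm_e c.contDiff_g.continuous

/-- The image of the open square. -/
def nhd : Set ℂ := c.toHomeomorph '' openSquare c.η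

/-- The part of `nhd` above the curve. -/
def upper : Set ℂ := c.toHomeomorph '' upperSquare c.η

/-- The part of `nhd` below the curve. -/
def lower : Set ℂ := c.toHomeomorph '' lowerSquare c.η

/-- The parametrization of `Γ` near `z`. -/
noncomputable def curve : ℝ → ℂ := graphCurve z c.e c.g

/-- The derivative of the parametrization. -/
noncomputable def velocity (s : ℝ) : ℂ := c.e * (1 + deriv c.g s * Complex.I)

/-- The density of `∂Φ/∂z̄` with respect to the parameter, if `Φ` equals `A` above and `B` below
the curve. -/
noncomputable def density (A B : ℂ → ℂ) (s : ℝ) : ℂ :=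
  Complex.I / 2 * ((A (c.curve s) - B (c.curve s)) * c.velocity s)

theorem isOpen_nhd : IsOpen c.nhd := isOpen_graphChart_image _ _ (isOpen_openSquare _)

theorem isOpen_upper : IsOpen c.upper := isOpen_graphChart_image _ _ (isOpen_upperSquare _)

theorem isOpen_lower : IsOpen c.lower := isOpen_graphChart_image _ _ (isOpen_lowerSquare _)

theorem isConnected_upper : IsConnected c.upper :=
  (isConnected_upperSquare c.η_pos).image _ c.toHomeomorph.continuous.continuousOn

theorem isConnected_lower : IsConnected c.lower :=
  (isConnected_lowerSquare c.η_pos).image _ c.toHomeomorph.continuous.continuousOn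

theorem mem_nhd : z ∈ c.nhd := mem_graphChart_image _ _ c.g_zero c.η_pos

theorem nhd_subset_K : c.nhd ⊆ c.K := c.image_subset

theorem nhd_subset : c.nhd ⊆ O := c.image_subset.trans c.K_subset

theorem upper_subset : c.upper ⊆ c.nhd := image_mono upperSquare_subset

theorem lower_subset : c.lower ⊆ c.nhd := image_mono lowerSquare_subset

theorem toHomeomorph_zero (s : ℝ) : c.toHomeomorph (s, 0) = c.curve s := graphChart_zero s

theorem curve_zero : c.curve 0 = z := by simp [curve, graphCurve, c.g_zero]

theorem continuous_curve : Continuous c.curve := continuous_graphCurve c.contDiff_g.continuous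

theorem curve_injective : Function.Injective c.curve :=
  graphCurve_injective c.norm_e c.contDiff_g.continuous

theorem isClosedEmbedding_curve : IsClosedEmbedding c.curve :=
  isClosedEmbedding_graphCurve c.norm_e c.contDiff_g.continuous

theorem continuous_velocity : Continuous c.velocity := by
  have := c.contDiff_g.continuous_deriv_one
  unfold velocity
  fun_prop

theorem hasStrictDerivAt_curve (s : ℝ) : HasStrictDerivAt c.curve (c.velocity s) s :=
  hasStrictDerivAt_graphCurve c.contDiff_g s

theorem velocity_ne_zero (s : ℝ) : c.velocity s ≠ 0 := by
  have he : c.e ≠ 0 := norm_ne_zero_iff.1 (by simp [c.norm_e])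
  refine mul_ne_zero he fun h => ?_
  have := congrArg Complex.re h
  simp at this

theorem neg_η_lt : -c.η < c.η := by linarith [c.η_pos]

theorem mem_square_zero {s : ℝ} (hs : s ∈ Ioo (-c.η) c.η) : (s, (0 : ℝ)) ∈ openSquare c.η :=
  ⟨hs, by simpa using c.η_pos, c.η_pos⟩

theorem curve_mem_nhd {s : ℝ} (hs : s ∈ Ioo (-c.η) c.η) : c.curve s ∈ c.nhd :=
  ⟨_, c.mem_square_zero hs, c.toHomeomorph_zero s⟩

theorem curve_mem {s : ℝ} (hs : s ∈ Ioo (-c.η) c.η) : c.curve s ∈ Γ := by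
  rw [← c.toHomeomorph_zero]
  exact (c.mem_iff _ (c.mem_square_zero hs)).2 rfl

theorem curve_mem_K {s : ℝ} (hs : s ∈ Icc (-c.η) c.η) : c.curve s ∈ c.K := by
  rw [← closure_Ioo c.neg_η_lt.ne] at hs
  have : c.curve s ∈ closure (c.curve '' Ioo (-c.η) c.η) :=
    image_closure_subset_closure_image c.continuous_curve (mem_image_of_mem _ hs)
  refine closure_minimal ?_ c.isCompact_K.isClosed this
  rintro _ ⟨u, hu, rfl⟩
  exact c.nhd_subset_K (c.curve_mem_nhd hu)

theorem inter_nhd_eq : Γ ∩ c.nhd = c.curve '' Ioo (-c.η) c.η := by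
  apply Subset.antisymm
  · rintro _ ⟨hw, p, hp, rfl⟩
    have : p.2 = 0 := (c.mem_iff p hp).1 hw
    refine ⟨p.1, hp.1, ?_⟩
    rw [← c.toHomeomorph_zero, ← this]
  · rintro _ ⟨s, hs, rfl⟩
    exact ⟨c.curve_mem hs, c.curve_mem_nhd hs⟩

theorem nhd_diff_eq : c.nhd \ Γ = c.upper ∪ c.lower := by
  apply Subset.antisymm
  · rintro _ ⟨⟨p, hp, rfl⟩, hw⟩
    have h0 : p.2 ≠ 0 := fun h => hw ((c.mem_iff p hp).2 h)
    rcases h0.lt_or_gt with h | h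
    · exact Or.inr ⟨p, ⟨hp.1, hp.2.1, h⟩, rfl⟩
    · exact Or.inl ⟨p, ⟨hp.1, h, hp.2.2⟩, rfl⟩
  · rintro _ (⟨p, hp, rfl⟩ | ⟨p, hp, rfl⟩)
    · exact ⟨⟨p, upperSquare_subset hp, rfl⟩, fun h =>
        hp.2.1.ne' ((c.mem_iff p (upperSquare_subset hp)).1 h)⟩
    · exact ⟨⟨p, lowerSquare_subset hp, rfl⟩, fun h =>
        hp.2.2.ne ((c.mem_iff p (lowerSquare_subset hp)).1 h)⟩

theorem disjoint_upper_lower : Disjoint c.upper c.lower := by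
  rw [upper, lower, disjoint_image_iff c.toHomeomorph.injective, Set.disjoint_left]
  rintro p hp hp'
  exact lt_asymm hp.2.1 hp'.2.2

theorem subset_iUnion_piece {U : Set ℂ} {ι : Type*} {Ψ : ℂ → ℂ} {f : ι → ℂ → ℂ}
    (hOU : O ⊆ U) (hΓ : U \ ⋃ q, piece U Ψ (f q) ⊆ Γ) : c.nhd \ Γ ⊆ ⋃ q, piece U Ψ (f q) := by
  rintro w ⟨hw, hwΓ⟩
  by_contra h
  exact hwΓ (hΓ ⟨hOU (c.nhd_subset hw), h⟩)

/-- Each side is connected and avoids Γ. Equal indices are impossible: the curve is a null set, so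
`z` itself would lie in the piece. -/
theorem exists_subset_pieces {U : Set ℂ} (hU : IsOpen U) (hc : IsPreconnected U) {ι : Type*}
    {Ψ : ℂ → ℂ} {f : ι → ℂ → ℂ} (hf : ∀ q, DifferentiableOn ℂ (f q) U) (hOU : O ⊆ U)
    (hΓ : U \ ⋃ q, piece U Ψ (f q) = Γ) :
    ∃ i j, i ≠ j ∧ c.upper ⊆ piece U Ψ (f i) ∧ c.lower ⊆ piece U Ψ (f j) := by
  have hsub := c.subset_iUnion_piece hOU hΓ.le
  rw [c.nhd_diff_eq] at hsub
  obtain ⟨i, hi⟩ := exists_subset_piece hU hc hf c.isConnected_upper.isPreconnected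
    c.isConnected_upper.nonempty (subset_union_left.trans hsub)
  obtain ⟨j, hj⟩ := exists_subset_piece hU hc hf c.isConnected_lower.isPreconnected
    c.isConnected_lower.nonempty (subset_union_right.trans hsub)
  refine ⟨i, j, ?_, hi, hj⟩
  rintro rfl
  have h1 : z ∈ piece U Ψ (f i) := image_openSquare_subset_piece c.norm_e c.contDiff_g.continuous
    (c.nhd_subset.trans hOU) hi hj c.mem_nhd
  have h2 := c.curve_mem (s := 0) (by simpa using c.η_pos)
  rw [c.curve_zero, ← hΓ] at h2
  exact h2.2 (mem_iUnion.2 ⟨i, h1⟩)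

theorem continuousOn_density {A B : ℂ → ℂ} (hA : ContinuousOn A c.K) (hB : ContinuousOn B c.K) :
    ContinuousOn (c.density A B) (Icc (-c.η) c.η) := by
  have h1 := hA.comp c.continuous_curve.continuousOn fun s hs => c.curve_mem_K hs
  have h2 := hB.comp c.continuous_curve.continuousOn fun s hs => c.curve_mem_K hs
  exact continuousOn_const.mul ((h1.sub h2).mul c.continuous_velocity.continuousOn)

/-! ### Positivity of `μ` makes the density along the curve real and nonnegative. -/

section Density

variable {U : Opens ℂ} {A B Φ : ℂ → ℂ} {μ : Measure ℂ} (hOU : O ⊆ U)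
  (hA : DifferentiableOn ℂ A U) (hB : DifferentiableOn ℂ B U) (hμ : DbarEqMeasure U Φ μ)
  (hup : c.upper ⊆ piece U Φ A) (hlo : c.lower ⊆ piece U Φ B)

include hOU hA hB hμ hup hlo

theorem integral_eq {ψ : 𝓓(U, ℝ)} (hψ : tsupport ψ ⊆ c.nhd) :
    ((∫ w, ψ w ∂μ : ℝ) : ℂ) =
      ∫ s in Ioo (-c.η) c.η, c.density A B s * ψ (c.curve s) := by
  have hNU := c.nhd_subset.trans hOU
  rw [← hμ.2.2 ψ]
  exact dbarPairing_eq_integral_graph c.norm_e c.contDiff_g c.isOpen_nhd rfl (hA.mono hNU)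
    (hB.mono hNU) (ae_eq_of_subset_piece c.isOpen_upper hup)
    (ae_eq_of_subset_piece c.isOpen_lower hlo) (contDiff_one_testFunction ψ) ψ.hasCompactSupport hψ

omit hμ hup hlo in
theorem integrableOn_density_mul (ψ : 𝓓(U, ℝ)) :
    IntegrableOn (fun s => c.density A B s * ψ (c.curve s)) (Ioo (-c.η) c.η) := by
  have hKU := c.K_subset.trans hOU
  have h1 := c.continuousOn_density (hA.mono hKU).continuousOn (hB.mono hKU).continuousOn
  have h2 : Continuous fun s => ((ψ (c.curve s) : ℝ) : ℂ) :=
    Complex.continuous_ofReal.comp (ψ.continuous.comp c.continuous_curve)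
  exact ((h1.mul h2.continuousOn).integrableOn_Icc).mono_set Ioo_subset_Icc_self

theorem integral_re_eq {ψ : 𝓓(U, ℝ)} (hψ : tsupport ψ ⊆ c.nhd) :
    ∫ w, ψ w ∂μ = ∫ s in Ioo (-c.η) c.η, (c.density A B s).re * ψ (c.curve s) := by
  have h := congrArg Complex.re (c.integral_eq hOU hA hB hμ hup hlo hψ)
  rw [Complex.ofReal_re] at h
  rw [h]
  refine (Complex.reCLM.integral_comp_comm
    (c.integrableOn_density_mul hOU hA hB ψ)).symm.trans ?_
  simp

theorem integral_im_eq {ψ : 𝓓(U, ℝ)} (hψ : tsupport ψ ⊆ c.nhd) :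
    ∫ s in Ioo (-c.η) c.η, (c.density A B s).im * ψ (c.curve s) = 0 := by
  have h := congrArg Complex.im (c.integral_eq hOU hA hB hμ hup hlo hψ)
  rw [Complex.ofReal_im] at h
  rw [h]
  refine Eq.trans ?_ (Complex.imCLM.integral_comp_comm
    (c.integrableOn_density_mul hOU hA hB ψ))
  simp

omit hμ hup hlo in
theorem continuousOn_density_Ioo : ContinuousOn (c.density A B) (Ioo (-c.η) c.η) := by
  have hKU := c.K_subset.trans hOU
  exact (c.continuousOn_density (hA.mono hKU).continuousOn (hB.mono hKU).continuousOn).mono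
    Ioo_subset_Icc_self

theorem density_re_nonneg {s : ℝ} (hs : s ∈ Ioo (-c.η) c.η) : 0 ≤ (c.density A B s).re := by
  have hcont := c.continuousOn_density_Ioo hOU hA hB
  refine nonneg_of_integral_graph_nonneg (U := U) c.norm_e c.contDiff_g.continuous c.isOpen_nhd
    (c.nhd_subset.trans hOU) (fun s hs => c.curve_mem_nhd hs)
    (f := fun s => (c.density A B s).re) (Complex.continuous_re.comp_continuousOn hcont)
    (fun ψ hψ hnn => ?_) s hs
  exact (integral_nonneg hnn).trans_eq (c.integral_re_eq hOU hA hB hμ hup hlo hψ)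

/-- As `μ` is real, the imaginary part integrates to zero against all test functions, so the sign
lemma applies to it and to its negative. -/
theorem density_im_eq_zero {s : ℝ} (hs : s ∈ Ioo (-c.η) c.η) : (c.density A B s).im = 0 := by
  have hcont := c.continuousOn_density_Ioo hOU hA hB
  have hcont' := Complex.continuous_im.comp_continuousOn hcont
  have h1 := nonneg_of_integral_graph_nonneg (U := U) c.norm_e c.contDiff_g.continuous c.isOpen_nhd
    (c.nhd_subset.trans hOU) (fun s hs => c.curve_mem_nhd hs)
    (f := fun s => (c.density A B s).im) hcont'
    (fun ψ hψ hnn => (c.integral_im_eq hOU hA hB hμ hup hlo hψ).ge) s hs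
  have h2 := nonneg_of_integral_graph_nonneg (U := U) c.norm_e c.contDiff_g.continuous c.isOpen_nhd
    (c.nhd_subset.trans hOU) (fun s hs => c.curve_mem_nhd hs)
    (f := fun s => -(c.density A B s).im) hcont'.neg
    (fun ψ hψ hnn => by
      simp_rw [neg_mul]
      rw [integral_neg]
      have := c.integral_im_eq hOU hA hB hμ hup hlo hψ
      rw [curve] at this
      rw [this, neg_zero]) s hs
  exact le_antisymm (by linarith) h1

/-- A nonnegative real number is its own modulus, and `|i/2| = 1/2`. -/
theorem density_eq_norm {s : ℝ} (hs : s ∈ Ioo (-c.η) c.η) :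
    (c.density A B s).re = ‖A (c.curve s) - B (c.curve s)‖ / 2 * ‖c.velocity s‖ := by
  have h1 := c.density_re_nonneg hOU hA hB hμ hup hlo hs
  have h2 := c.density_im_eq_zero hOU hA hB hμ hup hlo hs
  have h3 : ‖c.density A B s‖ = (c.density A B s).re := by
    rw [← Complex.re_add_im (c.density A B s), h2]
    simp [abs_of_nonneg h1]
  rw [← h3, density, norm_mul, norm_mul, norm_div]
  simp
  ring

/-- If `μ` vanishes near a regular point, then the analytic functions on both sides agree. -/
theorem eq_of_measure_eq_zero (h0 : μ c.nhd = 0) {s : ℝ} (hs : s ∈ Ioo (-c.η) c.η) :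
    A (c.curve s) = B (c.curve s) := by
  have hcont := c.continuousOn_density_Ioo hOU hA hB
  have h1 := nonneg_of_integral_graph_nonneg (U := U) c.norm_e c.contDiff_g.continuous c.isOpen_nhd
    (c.nhd_subset.trans hOU) (fun s hs => c.curve_mem_nhd hs)
    (f := fun s => -(c.density A B s).re) (Complex.continuous_re.comp_continuousOn hcont).neg
    (fun ψ hψ hnn => by
      simp_rw [neg_mul]
      rw [integral_neg]
      have := c.integral_re_eq hOU hA hB hμ hup hlo hψ
      rw [curve] at this
      rw [← this, ← integral_testFunction_restrict hψ, Measure.restrict_eq_zero.2 h0]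
      simp) s hs
  have h2 := c.density_re_nonneg hOU hA hB hμ hup hlo hs
  have h3 := c.density_eq_norm hOU hA hB hμ hup hlo hs
  have h4 : ‖A (c.curve s) - B (c.curve s)‖ / 2 * ‖c.velocity s‖ = 0 := by linarith
  have h5 := (mul_eq_zero.1 h4).resolve_right (norm_ne_zero_iff.2 (c.velocity_ne_zero s))
  rw [div_eq_zero_iff, norm_eq_zero, sub_eq_zero] at h5
  exact h5.resolve_right two_ne_zero

end Density

/-! ### The measure near a regular point as a multiple of length. -/

theorem hausdorffMeasure_restrict_eq : (μH[1] : Measure ℂ).restrict (Γ ∩ c.nhd) =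
    ((volume.restrict (Ioo (-c.η) c.η)).withDensity fun s => ‖c.velocity s‖ₑ).map c.curve := by
  have hm := c.continuous_curve.measurable
  ext S hS
  rw [Measure.restrict_apply hS, c.inter_nhd_eq, inter_comm, ← image_inter_preimage,
    hausdorffMeasure_image_eq_lintegral c.isClosedEmbedding_curve c.hasStrictDerivAt_curve
      c.continuous_velocity c.velocity_ne_zero (measurableSet_Ioo.inter (hm hS)),
    Measure.map_apply hm hS, withDensity_apply _ (hm hS), Measure.restrict_restrict (hm hS),
    inter_comm]

theorem withDensity_eq {k : ℂ → ENNReal} (hk : ContinuousOn k c.nhd) :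
    ((μH[1] : Measure ℂ).restrict (Γ ∩ c.nhd)).withDensity k =
      ((volume.restrict (Ioo (-c.η) c.η)).withDensity
        fun s => ‖c.velocity s‖ₑ * k (c.curve s)).map c.curve := by
  have hm := c.continuous_curve.measurable
  have hv : Measurable fun s => ‖c.velocity s‖ₑ := c.continuous_velocity.enorm.measurable
  -- `k` is controlled only in `c.nhd`; extension by zero makes it measurable without changing
  -- either measure.
  have hk' : Measurable (c.nhd.indicator k) := by
    classical
    rw [← piecewise_eq_indicator]
    exact hk.measurable_piecewise continuousOn_const c.isOpen_nhd.measurableSet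
  have hΓm : MeasurableSet (Γ ∩ c.nhd) := by
    rw [c.inter_nhd_eq]
    exact c.isClosedEmbedding_curve.measurableEmbedding.measurableSet_image.2 measurableSet_Ioo
  have e1 : ((μH[1] : Measure ℂ).restrict (Γ ∩ c.nhd)).withDensity k =
      ((μH[1] : Measure ℂ).restrict (Γ ∩ c.nhd)).withDensity (c.nhd.indicator k) := by
    refine withDensity_congr_ae ?_
    filter_upwards [ae_restrict_mem hΓm] with w hw
    rw [indicator_of_mem hw.2]
  have e2 : (volume.restrict (Ioo (-c.η) c.η)).withDensity (fun s => ‖c.velocity s‖ₑ * k (c.curve s))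
      = (volume.restrict (Ioo (-c.η) c.η)).withDensity
        ((fun s => ‖c.velocity s‖ₑ) * (c.nhd.indicator k ∘ c.curve)) := by
    refine withDensity_congr_ae ?_
    filter_upwards [ae_restrict_mem measurableSet_Ioo] with s hs
    rw [Pi.mul_apply, Function.comp_apply, indicator_of_mem (c.curve_mem_nhd hs)]
  rw [e1, e2, withDensity_mul _ hv (hk'.comp hm), c.hausdorffMeasure_restrict_eq]
  ext S hS
  rw [withDensity_apply _ hS, Measure.map_apply hm hS, withDensity_apply _ (hm hS),
    setLIntegral_map hS hk' hm]
  rfl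

/-- Pulled back to the parameter, the right-hand side has density `(‖A - B‖ / 2) ‖γ'‖`, which is the
real density of the jump formula. Both measures therefore give the same integrals of test functions.
-/
theorem restrict_nhd_eq {U : Opens ℂ} {A B Φ : ℂ → ℂ} {μ : Measure ℂ} (hOU : O ⊆ U)
    (hA : DifferentiableOn ℂ A U) (hB : DifferentiableOn ℂ B U) (hμ : DbarEqMeasure U Φ μ)
    (hup : c.upper ⊆ piece U Φ A) (hlo : c.lower ⊆ piece U Φ B) :
    μ.restrict c.nhd = ((μH[1]).restrict (Γ ∩ c.nhd)).withDensity
      (fun w => ENNReal.ofReal (‖A w - B w‖ / 2)) := by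
  have hNU := c.nhd_subset.trans hOU
  have hKU := c.K_subset.trans hOU
  have hm := c.continuous_curve.measurable
  have hemb := c.isClosedEmbedding_curve.measurableEmbedding
  set ν := ((μH[1] : Measure ℂ).restrict (Γ ∩ c.nhd)).withDensity
      (fun w => ENNReal.ofReal (‖A w - B w‖ / 2)) with hν
  have hcont := c.continuousOn_density (hA.mono hKU).continuousOn (hB.mono hKU).continuousOn
  have hdi : IntegrableOn (fun s => (c.density A B s).re) (Ioo (-c.η) c.η) :=
    (Complex.continuous_re.comp_continuousOn hcont).integrableOn_Icc.mono_set Ioo_subset_Icc_self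
  have hνmap : ν = ((volume.restrict (Ioo (-c.η) c.η)).withDensity
        fun s => ENNReal.ofReal (c.density A B s).re).map c.curve := by
    rw [hν, c.withDensity_eq]
    · congr 1
      refine withDensity_congr_ae ?_
      filter_upwards [ae_restrict_mem measurableSet_Ioo] with s hs
      rw [c.density_eq_norm hOU hA hB hμ hup hlo hs, mul_comm, ENNReal.ofReal_mul (by positivity),
        ofReal_norm]
    · refine ENNReal.continuous_ofReal.comp_continuousOn ?_
      exact ((hA.mono hNU).continuousOn.sub (hB.mono hNU).continuousOn).norm.div_const _
  have hνN : ν.restrict c.nhd = ν := by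
    refine Measure.restrict_eq_self_of_ae_mem ?_
    refine (withDensity_absolutelyContinuous _ _).ae_le ?_
    exact ae_mono (Measure.restrict_mono inter_subset_right le_rfl)
      (ae_restrict_mem c.isOpen_nhd.measurableSet)
  rw [← hνN]
  refine restrict_eq_restrict_of_integral_testFunction c.isOpen_nhd hNU
    ((measure_mono c.nhd_subset_K).trans_lt (hμ.2.1 _ c.isCompact_K hKU)) ?_ fun ψ hψ _ => ?_
  · refine (measure_mono (subset_univ _)).trans_lt ?_
    rw [hνmap, Measure.map_apply hm MeasurableSet.univ, preimage_univ,
      withDensity_apply _ MeasurableSet.univ, Measure.restrict_univ]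
    exact hdi.lintegral_lt_top
  · rw [c.integral_re_eq hOU hA hB hμ hup hlo hψ, hνmap, hemb.integral_map]
    rw [integral_withDensity_eq_integral_toReal_smul₀ hdi.aestronglyMeasurable.aemeasurable.ennreal_ofReal
      (ae_of_all _ fun _ => ENNReal.ofReal_lt_top)]
    refine setIntegral_congr_fun measurableSet_Ioo fun s hs => ?_
    simp only [smul_eq_mul]
    rw [ENNReal.toReal_ofReal (c.density_re_nonneg hOU hA hB hμ hup hlo hs)]

/-- Near a regular point the interface lies on a level curve of the difference of the
potentials. -/
theorem exists_inter_subset_levelCurve {U : Opens ℂ} (hU : IsSimplyConnected (U : Set ℂ))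
    {A B Φ : ℂ → ℂ} {μ : Measure ℂ}
    (hOU : O ⊆ U) (hA : DifferentiableOn ℂ A U) (hB : DifferentiableOn ℂ B U)
    (hμ : DbarEqMeasure U Φ μ) (hup : c.upper ⊆ piece U Φ A) (hlo : c.lower ⊆ piece U Φ B)
    (p : ℂ) : ∃ d : ℝ, c.nhd ∩ Γ ⊆
      levelCurve U (fun w => harmonicPotential U A p w - harmonicPotential U B p w) d := by
  have hder : ∀ {f : ℂ → ℂ}, DifferentiableOn ℂ f U → ∀ s ∈ Ioo (-c.η) c.η,
      HasDerivAt (fun s => harmonicPotential U f p (c.curve s))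
        (f (c.curve s) * c.velocity s).re s := by
    intro f hf s hs
    have h1 := (integralFrom_spec U.isOpen hU hf p).2 (c.curve s)
      (hOU (c.nhd_subset (c.curve_mem_nhd hs)))
    have h2 := (h1.hasFDerivAt.restrictScalars ℝ).comp_hasDerivAt s
      (c.hasStrictDerivAt_curve s).hasDerivAt
    have h3 := Complex.reCLM.hasFDerivAt.comp_hasDerivAt s h2
    refine h3.congr_deriv ?_
    simp [mul_comm]
  set D : ℝ → ℝ := fun s => harmonicPotential U A p (c.curve s) - harmonicPotential U B p (c.curve s)
  have hD : ∀ s ∈ Ioo (-c.η) c.η, HasDerivAt D 0 s := by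
    intro s hs
    refine ((hder hA s hs).sub (hder hB s hs)).congr_deriv ?_
    -- The derivative of `D` is `Re((A - B)γ')`, twice the imaginary part of the density.
    have h1 := c.density_im_eq_zero hOU hA hB hμ hup hlo hs
    rw [density] at h1
    rw [← Complex.sub_re, ← sub_mul]
    simpa [Complex.mul_im, Complex.div_re, Complex.div_im] using h1
  refine ⟨D 0, ?_⟩
  rw [inter_comm, c.inter_nhd_eq]
  rintro _ ⟨s, hs, rfl⟩
  refine ⟨hOU (c.nhd_subset (c.curve_mem_nhd hs)), ?_⟩
  exact isOpen_Ioo.is_const_of_deriv_eq_zero isPreconnected_Ioo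
    (fun s hs => (hD s hs).differentiableAt.differentiableWithinAt) (fun s hs => (hD s hs).deriv) hs
    (by simpa using c.η_pos)

theorem infinite_nhd_inter : (c.nhd ∩ Γ).Infinite := by
  rw [inter_comm, c.inter_nhd_eq]
  exact (Ioo_infinite c.neg_η_lt).image c.curve_injective.injOn

/-- Identity theorem: the points of the curve accumulate at `z`. -/
theorem eqOn_of_eq_on_curve {U : Set ℂ} (hU : IsOpen U) (hc : IsPreconnected U) {A B : ℂ → ℂ}
    (hOU : O ⊆ U) (hA : DifferentiableOn ℂ A U) (hB : DifferentiableOn ℂ B U)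
    (h : ∀ s ∈ Ioo (-c.η) c.η, A (c.curve s) = B (c.curve s)) : EqOn A B U := by
  refine (hA.analyticOnNhd hU).eqOn_of_preconnected_of_frequently_eq (hB.analyticOnNhd hU) hc
    (hOU (c.nhd_subset c.mem_nhd)) ?_
  have ht : Tendsto c.curve (𝓝[≠] 0) (𝓝[≠] z) := by
    refine tendsto_nhdsWithin_iff.2 ⟨?_, ?_⟩
    · have := c.continuous_curve.tendsto 0
      rw [c.curve_zero] at this
      exact this.mono_left nhdsWithin_le_nhds
    · filter_upwards [self_mem_nhdsWithin] with s hs heq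
      exact hs (c.curve_injective (Eq.trans heq c.curve_zero.symm))
  refine ht.frequently (Eventually.frequently ?_)
  filter_upwards [nhdsWithin_le_nhds (Ioo_mem_nhds (neg_lt_zero.2 c.η_pos) c.η_pos)] with s hs
  exact h s hs

end StraighteningChart

/-! ### Support and uniqueness -/

/-- If `μ` vanished near `z`, the functions on the two sides would agree along the arc, hence in
`U`, contrary to distinctness. -/
theorem isRegularPoint_mem_support {U : Opens ℂ} (hc : IsPreconnected (U : Set ℂ)) {r : ℕ}
    {A : Fin r → ℂ → ℂ} {Φ : ℂ → ℂ} (hΦ : IsPiecewiseAnalytic U A Φ) {μ : Measure ℂ}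
    (hμ : DbarEqMeasure U Φ μ) {z : ℂ} (hz : IsRegularPoint (interface U A Φ) z) :
    z ∈ μ.support := by
  by_contra hcon
  obtain ⟨W, hW, hW0⟩ := Measure.notMem_support_iff_exists.1 hcon
  obtain ⟨W', hW', hWo, hzW⟩ := _root_.mem_nhds_iff.1 hW
  obtain ⟨c⟩ := hz.nonempty_straighteningChart (hWo.inter U.isOpen) ⟨hzW, hz.mem.1⟩
  obtain ⟨i, j, hij, hup, hlo⟩ := c.exists_subset_pieces U.isOpen hc hΦ.differentiableOn
    inter_subset_right rfl
  have h0 : μ c.nhd = 0 := measure_mono_null (c.nhd_subset.trans (inter_subset_left.trans hW')) hW0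
  exact hΦ.distinct i j hij (c.eqOn_of_eq_on_curve U.isOpen hc inter_subset_right
    (hΦ.differentiableOn i) (hΦ.differentiableOn j) fun s hs =>
      c.eq_of_measure_eq_zero inter_subset_right (hΦ.differentiableOn i) (hΦ.differentiableOn j) hμ
        hup hlo h0 hs)

theorem support_inter_eq_interface {U : Opens ℂ} (hc : IsPreconnected (U : Set ℂ)) {r : ℕ}
    {A : Fin r → ℂ → ℂ} {Φ : ℂ → ℂ} (hΦ : IsPiecewiseAnalytic U A Φ)
    (hΓ : IsLocallyFiniteUnionOfCurves U (interface U A Φ)) {μ : Measure ℂ}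
    (hμ : DbarEqMeasure U Φ μ) : μ.support ∩ U = interface U A Φ := by
  apply Subset.antisymm
  · rintro z ⟨hz, hzU⟩
    by_contra h
    have hn : (U : Set ℂ) \ interface U A Φ ∈ 𝓝 z :=
      (isOpen_compl_interface U.isOpen A Φ).mem_nhds ⟨hzU, h⟩
    exact ((Measure.mem_support_iff_forall z).1 hz _ hn).ne'
      (measure_diff_interface_eq_zero hΦ.differentiableOn hμ)
  · refine fun z hz => ⟨?_, hz.1⟩
    -- The support is closed and contains the regular points, which are dense in the interface.
    refine Measure.isClosed_support.closure_subset_iff.2 (?_ : {w | IsRegularPoint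
      (interface U A Φ) w} ⊆ _) (_root_.mem_closure_iff.2 fun V hV hzV => ?_)
    · exact fun w hw => isRegularPoint_mem_support hc hΦ hμ hw
    · obtain ⟨w, hw, hwr⟩ := exists_isRegularPoint_mem U.isOpen hc hΓ hΦ.differentiableOn
        (Ψ := Φ) le_rfl hV ⟨z, hz, hzV⟩
      exact ⟨w, hw.2, hwr⟩

/-- Test functions determine both measures on balls with closure in `U`, where they are finite;
countably many such balls cover `U`. -/
theorem DbarEqMeasure.unique {U : Opens ℂ} {Φ Φ' : ℂ → ℂ} {μ μ' : Measure ℂ}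
    (hμ : DbarEqMeasure U Φ μ) (hμ' : DbarEqMeasure U Φ' μ')
    (h : Φ =ᵐ[volume.restrict U] Φ') : μ = μ' := by
  have hpair : ∀ ψ : 𝓓(U, ℝ), dbarPairing Φ ψ = dbarPairing Φ' ψ := by
    intro ψ
    rw [dbarPairing, dbarPairing]
    congr 1
    refine integral_congr_ae ?_
    filter_upwards [(ae_restrict_iff' U.isOpen.measurableSet).1 h] with w hw
    by_cases hwU : w ∈ (U : Set ℂ)
    · rw [hw hwU]
    · rw [dbar_eq_zero_of_notMem_tsupport fun h => hwU (ψ.tsupport_subset h), mul_zero, mul_zero]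
  have hint : ∀ ψ : 𝓓(U, ℝ), ∫ w, ψ w ∂μ = ∫ w, ψ w ∂μ' := by
    intro ψ
    have := (hμ.2.2 ψ).symm.trans ((hpair ψ).trans (hμ'.2.2 ψ))
    exact_mod_cast this
  let S : Set (Set ℂ) := {N | (IsOpen N ∧ N ⊆ U) ∧ μ.restrict N = μ'.restrict N}
  have hS : ⋃₀ S = U := by
    apply Subset.antisymm
    · exact sUnion_subset fun N hN => hN.1.2
    · intro z hz
      obtain ⟨R, hR, hRU⟩ := Metric.nhds_basis_closedBall.mem_iff.1 (U.isOpen.mem_nhds hz)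
      have hb : ball z R ⊆ U := ball_subset_closedBall.trans hRU
      refine mem_sUnion.2 ⟨ball z R, ⟨⟨isOpen_ball, hb⟩, ?_⟩, mem_ball_self hR⟩
      exact restrict_eq_restrict_of_integral_testFunction isOpen_ball hb
        ((measure_mono ball_subset_closedBall).trans_lt (hμ.2.1 _ (isCompact_closedBall z R) hRU))
        ((measure_mono ball_subset_closedBall).trans_lt (hμ'.2.1 _ (isCompact_closedBall z R) hRU))
        fun ψ _ _ => hint ψ
  obtain ⟨T, hTc, hTS, hTU⟩ := isOpen_sUnion_countable S fun N hN => hN.1.1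
  have hUU : μ.restrict U = μ'.restrict U := by
    rw [← hS, ← hTU]
    exact (Measure.restrict_sUnion_congr hTc).2 fun N hN => (hTS hN).2
  have hself : ∀ {Φ : ℂ → ℂ} {κ : Measure ℂ}, DbarEqMeasure U Φ κ → κ.restrict U = κ :=
    fun hκ => Measure.restrict_eq_self_of_ae_mem hκ.1
  rw [← hself hμ, hUU, hself hμ']

/-- If level curves of different differences of potentials meet in finite sets only, then two
piecewise analytic functions with the same interface agree near its regular points. -/
theorem IsRegularPoint.exists_mem_piece_sub {U : Opens ℂ} (hU : IsSimplyConnected (U : Set ℂ))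
    {r : ℕ} {A : Fin r → ℂ → ℂ} {p : ℂ}
    (hfin : ∀ i j k l : Fin r, i < j → k < l → (i, j) ≠ (k, l) → ∀ c d : ℝ,
      (levelCurve U (fun w => harmonicPotential U (A i) p w - harmonicPotential U (A j) p w) c ∩
        levelCurve U (fun w =>
          harmonicPotential U (A k) p w - harmonicPotential U (A l) p w) d).Finite)
    {Φ Φ' : ℂ → ℂ} (hΦ : IsPiecewiseAnalytic U A Φ) (hΦ' : IsPiecewiseAnalytic U A Φ')
    {μ μ' : Measure ℂ} (hμ : DbarEqMeasure U Φ μ) (hμ' : DbarEqMeasure U Φ' μ')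
    (heq : interface U A Φ' = interface U A Φ) {z : ℂ}
    (hz : IsRegularPoint (interface U A Φ) z) :
    ∃ i, z ∈ piece U (fun w => Φ w - Φ' w) (fun w => A i w - A i w) := by
  have hc : IsPreconnected (U : Set ℂ) := hU.isPathConnected.isConnected.isPreconnected
  obtain ⟨c⟩ := hz.nonempty_straighteningChart U.isOpen hz.mem.1
  obtain ⟨i, j, hij, hup, hlo⟩ := c.exists_subset_pieces U.isOpen hc hΦ.differentiableOn le_rfl rfl
  obtain ⟨k, l, hkl, hup', hlo'⟩ := c.exists_subset_pieces U.isOpen hc hΦ'.differentiableOn le_rfl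
    heq
  have hA := hΦ.differentiableOn
  -- The finiteness hypothesis concerns ordered pairs `i < j`; exchanging the indices changes the
  -- sign of the level.
  have hlevel : ∀ {Φ₀ : ℂ → ℂ} {μ₀ : Measure ℂ}, DbarEqMeasure U Φ₀ μ₀ → ∀ i j : Fin r, i ≠ j →
      c.upper ⊆ piece U Φ₀ (A i) → c.lower ⊆ piece U Φ₀ (A j) →
      ∃ i' j', i' < j' ∧ (i' = i ∧ j' = j ∨ i' = j ∧ j' = i) ∧ ∃ d, c.nhd ∩ interface U A Φ ⊆
        levelCurve U (fun w => harmonicPotential U (A i') p w - harmonicPotential U (A j') p w) d := by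
    intro Φ₀ μ₀ hμ i j hij hup hlo
    obtain ⟨d, hd⟩ := c.exists_inter_subset_levelCurve hU le_rfl (hA i) (hA j) hμ hup hlo p
    rcases hij.lt_or_gt with h | h
    · exact ⟨i, j, h, Or.inl ⟨rfl, rfl⟩, d, hd⟩
    · refine ⟨j, i, h, Or.inr ⟨rfl, rfl⟩, -d, fun w hw => ⟨(hd hw).1, ?_⟩⟩
      have := (hd hw).2
      simp only at this ⊢
      linarith
  obtain ⟨i', j', hlt, hor, d, hd⟩ := hlevel hμ i j hij hup hlo
  obtain ⟨k', l', hlt', hor', d', hd'⟩ := hlevel hμ' k l hkl hup' hlo'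
  -- The arc is infinite and lies on a level curve for each of the two pairs.
  have hpair : (i', j') = (k', l') := by
    by_contra hne
    exact c.infinite_nhd_inter ((hfin i' j' k' l' hlt hlt' hne d d').subset (subset_inter hd hd'))
  obtain ⟨rfl, rfl⟩ := Prod.mk.inj hpair
  -- With the functions exchanged, the two densities are negatives of each other and both
  -- nonnegative. So they vanish, and the two functions agree on the arc.
  have hnot : ¬ (k = j ∧ l = i) := by
    rintro ⟨rfl, rfl⟩
    refine hΦ.distinct l k hij (c.eqOn_of_eq_on_curve U.isOpen hc le_rfl (hA l) (hA k)
      fun s hs => ?_)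
    have h1 := c.density_re_nonneg le_rfl (hA l) (hA k) hμ hup hlo hs
    have h2 := c.density_re_nonneg le_rfl (hA k) (hA l) hμ' hup' hlo' hs
    have h3 := c.density_eq_norm le_rfl (hA l) (hA k) hμ hup hlo hs
    have h4 : c.density (A k) (A l) s = -c.density (A l) (A k) s := by
      simp only [StraighteningChart.density]; ring
    rw [h4, Complex.neg_re] at h2
    have h5 : ‖A l (c.curve s) - A k (c.curve s)‖ / 2 * ‖c.velocity s‖ = 0 := by linarith
    have h6 := (mul_eq_zero.1 h5).resolve_right (norm_ne_zero_iff.2 (c.velocity_ne_zero s))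
    rw [div_eq_zero_iff, norm_eq_zero, sub_eq_zero] at h6
    exact h6.resolve_right two_ne_zero
  have hki : k = i ∧ l = j := by
    rcases hor with ⟨h1, h2⟩ | ⟨h1, h2⟩ <;> rcases hor' with ⟨h3, h4⟩ | ⟨h3, h4⟩
    · exact ⟨h3.symm.trans h1, h4.symm.trans h2⟩
    · exact absurd ⟨h4.symm.trans h2, h3.symm.trans h1⟩ hnot
    · exact absurd ⟨h3.symm.trans h1, h4.symm.trans h2⟩ hnot
    · exact ⟨h4.symm.trans h2, h3.symm.trans h1⟩
  obtain ⟨rfl, rfl⟩ := hki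
  have hside : ∀ {N : Set ℂ} (m : Fin r), IsOpen N → N ⊆ U → N ⊆ piece U Φ (A m) →
      N ⊆ piece U Φ' (A m) → N ⊆ piece U (fun w => Φ w - Φ' w) (fun w => A k w - A k w) := by
    intro N m hN hNU h1 h2
    refine mem_piece_of_ae_eq hN hNU ?_
    filter_upwards [ae_eq_of_subset_piece hN h1, ae_eq_of_subset_piece hN h2] with w e1 e2
    rw [e1, e2, sub_self, sub_self]
  exact ⟨k, image_openSquare_subset_piece c.norm_e c.contDiff_g.continuous c.nhd_subset
    (hside k c.isOpen_upper (c.upper_subset.trans c.nhd_subset) hup hup')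
    (hside l c.isOpen_lower (c.lower_subset.trans c.nhd_subset) hlo hlo') c.mem_nhd⟩

theorem measure_eq_of_support_eq {U : Opens ℂ} (hU : IsSimplyConnected (U : Set ℂ))
    {r : ℕ} {A : Fin r → ℂ → ℂ} {p : ℂ}
    (hfin : ∀ i j k l : Fin r, i < j → k < l → (i, j) ≠ (k, l) → ∀ c d : ℝ,
      (levelCurve U (fun w => harmonicPotential U (A i) p w - harmonicPotential U (A j) p w) c ∩
        levelCurve U (fun w =>
          harmonicPotential U (A k) p w - harmonicPotential U (A l) p w) d).Finite)
    {Φ Φ' : ℂ → ℂ} (hΦ : IsPiecewiseAnalytic U A Φ) (hΦ' : IsPiecewiseAnalytic U A Φ')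
    (hΓ : IsLocallyFiniteUnionOfCurves U (interface U A Φ))
    (hΓ' : IsLocallyFiniteUnionOfCurves U (interface U A Φ'))
    {μ μ' : Measure ℂ} (hμ : DbarEqMeasure U Φ μ) (hμ' : DbarEqMeasure U Φ' μ')
    (hsupp : μ'.support ∩ U = μ.support ∩ U) : μ' = μ := by
  have hc : IsPreconnected (U : Set ℂ) := hU.isPathConnected.isConnected.isPreconnected
  have heq : interface U A Φ' = interface U A Φ := by
    rw [← support_inter_eq_interface hc hΦ' hΓ' hμ', hsupp,
      support_inter_eq_interface hc hΦ hΓ hμ]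
  -- With an empty interface Φ and Φ' may be different analytic functions, but both measures are
  -- zero by absolute continuity.
  rcases (interface U A Φ).eq_empty_or_nonempty with hempty | ⟨z₀, hz₀⟩
  · have h1 := absolutelyContinuous_hausdorffMeasure_restrict hΦ hμ
    have h2 := absolutelyContinuous_hausdorffMeasure_restrict hΦ' hμ'
    rw [hempty, Measure.restrict_empty, Measure.absolutelyContinuous_zero_iff] at h1
    rw [heq, hempty, Measure.restrict_empty, Measure.absolutelyContinuous_zero_iff] at h2
    rw [h1, h2]
  set Ψ : ℂ → ℂ := fun w => Φ w - Φ' w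
  -- All differences are admitted as branches of `Φ - Φ'`; the diagonal ones are zero.
  set f : Fin r × Fin r → ℂ → ℂ := fun q w => A q.1 w - A q.2 w
  have hf : ∀ q, DifferentiableOn ℂ (f q) U := fun q =>
    (hΦ.differentiableOn q.1).sub (hΦ.differentiableOn q.2)
  have hreg : ∀ z, IsRegularPoint (interface U A Φ) z → ∃ i, z ∈ piece U Ψ (f (i, i)) :=
    fun z hz => hz.exists_mem_piece_sub hU hfin hΦ hΦ' hμ hμ' heq
  have hsub : (U : Set ℂ) \ ⋃ q, piece U Ψ (f q) ⊆ interface U A Φ := by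
    rintro z ⟨hzU, hz⟩
    by_contra hcon
    have h1 : z ∈ ⋃ i, piece U Φ (A i) := by
      by_contra h; exact hcon ⟨hzU, h⟩
    have h2 : z ∈ ⋃ i, piece U Φ' (A i) := by
      by_contra h; exact hcon (heq ▸ ⟨hzU, h⟩)
    obtain ⟨i, hi⟩ := mem_iUnion.1 h1
    obtain ⟨k, hk⟩ := mem_iUnion.1 h2
    refine hz (mem_iUnion.2 ⟨(i, k), ?_⟩)
    have hN := (isOpen_piece U.isOpen Φ (A i)).inter (isOpen_piece U.isOpen Φ' (A k))
    refine mem_piece_of_ae_eq hN (inter_subset_left.trans (piece_subset _ _ _)) ?_ ⟨hi, hk⟩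
    filter_upwards [ae_eq_of_subset_piece hN inter_subset_left,
      ae_eq_of_subset_piece hN inter_subset_right] with w e1 e2
    simp only [Ψ, f, e1, e2]
  -- A nonempty interface of `Φ - Φ'` would contain a regular point of Γ, but near such points `Φ -
  -- Φ'` is zero almost everywhere.
  have hcover : (U : Set ℂ) ⊆ ⋃ q, piece U Ψ (f q) := by
    by_contra hcon
    obtain ⟨z, hzU, hz⟩ := not_subset.1 hcon
    obtain ⟨w, hw, hwr⟩ := exists_isRegularPoint_mem U.isOpen hc hΓ hf hsub isOpen_univ
      ⟨z, ⟨hzU, hz⟩, mem_univ z⟩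
    obtain ⟨i, hi⟩ := hreg w hwr
    exact hw.1.2 (mem_iUnion.2 ⟨_, hi⟩)
  obtain ⟨q, hq⟩ := exists_subset_piece U.isOpen hc hf hc ⟨z₀, hz₀.1⟩ hcover
  obtain ⟨w, hw, hwr⟩ := exists_isRegularPoint_mem U.isOpen hc hΓ hΦ.differentiableOn
    (Ψ := Φ) le_rfl isOpen_univ ⟨z₀, hz₀, mem_univ z₀⟩
  obtain ⟨i, hi⟩ := hreg w hwr
  -- `Φ - Φ'` equals one analytic function on `U`, which vanishes near a regular point and hence
  -- everywhere.
  have hq0 := eqOn_of_mem_piece_of_mem_piece U.isOpen hc (hf q) (hf (i, i)) (hq hw.1.1) hi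
  rw [piece_congr U.isOpen hq0] at hq
  refine hμ'.unique hμ ?_
  filter_upwards [ae_eq_of_subset_piece U.isOpen hq] with w hw
  simp only [Ψ, f, sub_self] at hw
  exact (sub_eq_zero.1 hw).symm

/-! ### The theorem. -/

theorem mainTheorem7 (U : Opens ℂ) (hU : IsSimplyConnected (U : Set ℂ)) {r : ℕ}
    (A : Fin r → ℂ → ℂ) (Φ : ℂ → ℂ) (hΦ : IsPiecewiseAnalytic U A Φ)
    (hΓ : IsLocallyFiniteUnionOfCurves U (interface U A Φ)) (hpos : DbarNonneg U Φ)
    (p : ℂ) (hp : p ∈ U) (H : Fin r → ℂ → ℝ) (hH : H = fun i => harmonicPotential U (A i) p) :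
    ∃ μ : Measure ℂ,
      -- `∂Φ/∂z̄ = μ` in `U`
      DbarEqMeasure U Φ μ ∧
      -- the local description near the regular points of `Γ_Φ`
      (∀ z, IsRegularPoint (interface U A Φ) z →
        ∃ N : Set ℂ, IsOpen N ∧ z ∈ N ∧ N ⊆ U ∧ ∃ i j : Fin r, i ≠ j ∧
          (∃ Ni Nj : Set ℂ, N \ interface U A Φ = Ni ∪ Nj ∧ Disjoint Ni Nj ∧
            IsOpen Ni ∧ IsConnected Ni ∧ IsOpen Nj ∧ IsConnected Nj ∧
            Φ =ᵐ[volume.restrict Ni] A i ∧ Φ =ᵐ[volume.restrict Nj] A j) ∧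
          (∃ c : ℝ, N ∩ interface U A Φ ⊆ levelCurve U (fun w => H i w - H j w) c) ∧
          μ.restrict N = ((μH[1]).restrict (interface U A Φ ∩ N)).withDensity
            (fun w => ENNReal.ofReal (‖A i w - A j w‖ / 2))) ∧
      -- `μ` is absolutely continuous with respect to length on `Γ_Φ`; in particular no atoms
      μ ≪ (μH[1]).restrict (interface U A Φ) ∧
      (∀ z, μ {z} = 0) ∧
      -- the support of `μ` is `Γ_Φ`, and it determines `μ` if level curves meet in finite sets
      μ.support ∩ U = interface U A Φ ∧
      ((∀ i j k l : Fin r, i < j → k < l → (i, j) ≠ (k, l) → ∀ c d : ℝ,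
          (levelCurve U (fun w => H i w - H j w) c ∩
            levelCurve U (fun w => H k w - H l w) d).Finite) →
        ∀ (Φ' : ℂ → ℂ) (μ' : Measure ℂ), IsPiecewiseAnalytic U A Φ' →
          IsLocallyFiniteUnionOfCurves U (interface U A Φ') → DbarNonneg U Φ' →
          DbarEqMeasure U Φ' μ' → μ'.support ∩ U = μ.support ∩ U → μ' = μ) := by
  subst hH
  have hc : IsPreconnected (U : Set ℂ) := hU.isPathConnected.isConnected.isPreconnected
  obtain ⟨μ, hμ⟩ := exists_dbarEqMeasure hΦ.locallyIntegrableOn hpos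
  have hac := absolutelyContinuous_hausdorffMeasure_restrict hΦ hμ
  refine ⟨μ, hμ, fun z hz => ?_, hac, fun z => ?_, support_inter_eq_interface hc hΦ hΓ hμ,
    fun hfin Φ' μ' hΦ' hΓ' _ hμ' hsupp => ?_⟩
  · obtain ⟨c⟩ := hz.nonempty_straighteningChart U.isOpen hz.mem.1
    obtain ⟨i, j, hij, hup, hlo⟩ :=
      c.exists_subset_pieces U.isOpen hc hΦ.differentiableOn le_rfl rfl
    have hAi := hΦ.differentiableOn i
    have hAj := hΦ.differentiableOn j
    exact ⟨c.nhd, c.isOpen_nhd, c.mem_nhd, c.nhd_subset, i, j, hij,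
      ⟨c.upper, c.lower, c.nhd_diff_eq, c.disjoint_upper_lower, c.isOpen_upper,
        c.isConnected_upper, c.isOpen_lower, c.isConnected_lower,
        ae_eq_of_subset_piece c.isOpen_upper hup, ae_eq_of_subset_piece c.isOpen_lower hlo⟩,
      c.exists_inter_subset_levelCurve hU le_rfl hAi hAj hμ hup hlo p,
      c.restrict_nhd_eq le_rfl hAi hAj hμ hup hlo⟩
  · have := Measure.nullSingletonClass_hausdorff ℂ one_pos
    exact hac (Measure.absolutelyContinuous_of_le Measure.restrict_le_self
      (measure_singleton (μ := μH[1]) z))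
  · exact measure_eq_of_support_eq hU hfin hΦ hΦ' hΓ hΓ' hμ hμ' hsupp
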